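/- In the problem of maximizing a non-negative monotone submodular function subject to a matroid constraint, one is given a finite ground set $\mathcal N$, a set function $f\colon 2^{\mathcal N}\to\mathbb R_{\ge 0}$ with $f(S\cup\{u\})\ge f(S)$ for all $S\subseteq\mathcal N$, $u\in\mathcal N$, and $f(S\cup\{u\})-f(S)\ge f(T\cup\{u\})-f(T)$ for all $S\subseteq T\subseteq\mathcal N$, $u\in\mathcal N\setminus T$, and a matroid $M$ on $\mathcal N$ of rank $k$; the goal is an independent set of large value. A single-pass data stream algorithm knows $k$ and receives the elements of $\mathcal N$ one after the other, once each, in an adversarial order. It has access to $f$ and $M$ only through a value oracle and an independence oracle, which can be queried on sets of elements that are currently stored in its memory, and its output has to consist of elements stored in its memory. It is a $\rho$-approximation if on every instance, for every order of arrival, it terminates and outputs an independent set $R$ with $f(R)\ge\rho\cdot f(S)$ for every independent set $S$. The algorithm is a fixed finite program that can store ground elements (which it can only copy, compare for equality and pass to the oracles), real numbers (with exact rational constants, arithmetic operations and comparisons) and non-negative integers. Additional memory is the memory used besides the stored elements; it is counted as one unit for each stored real number and one unit for each bit of the stored integers. **Theorem.** There is a deterministic single-pass semi-streaming algorithm that is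 a $0.3178$-approximation for maximizing a non-negative monotone submodular function subject to a matroid constraint of rank $k$; at any time it stores at most $O(k)$ elements and uses at most $\widetilde O(k)=O(k\log^{O(1)}(k+2))$ additional memory (with $k$ replaced by $1$ in these bounds if $k=0$). More precisely, the equation $e^{\alpha}=\alpha+2$ has exactly one solution $\alpha>0$, and for every $\varepsilon>0$ there is such an algorithm that is a $\left(\frac1{\alpha+2}-\varepsilon\right)$-approximation, where the implied constants may depend on $\varepsilon$ but on nothing else. -/

import Mathlib

universe u

namespace DataStream

/-! ### Submodular functions -/

/-- `f(u ∣ S) ≥ f(u ∣ T)` for all `S ⊆ T` and `u ∉ T`. -/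
def Submodular {N : Type*} [DecidableEq N] (f : Finset N → ℝ) : Prop :=
  ∀ S T : Finset N, S ⊆ T → ∀ u, u ∉ T → f (insert u T) - f T ≤ f (insert u S) - f S

/-- All marginal contributions are non-negative. -/
def MonotoneSet {N : Type*} [DecidableEq N] (f : Finset N → ℝ) : Prop :=
  ∀ (S : Finset N) (u : N), 0 ≤ f (insert u S) - f S

/-! ### The machine

A machine has three kinds of memory: *element cells* `elem 0, elem 1, …`, each holding a ground
element or nothing; *number cells* `num 0, num 1, …`, each holding a real number; and `m + 1`
*integer variables*, each holding a natural number, whose length in bits is charged.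
Ground elements are opaque: they can be copied, compared for equality and handed to the oracles. -/

/-- The contents of the memory. -/
structure State (m : ℕ) (N : Type*) where
  elem : ℕ → Option N
  num : ℕ → ℝ
  var : Fin (m + 1) → ℕ

/-- The set of the elements held in the cells `elem i`, `lo ≤ i < hi`. -/
def State.cells {m : ℕ} {N : Type*} [DecidableEq N] (s : State m N) (lo hi : ℕ) : Finset N :=
  (Finset.Ico lo hi).biUnion fun i => (s.elem i).toFinset

def State.setElem {m : ℕ} {N : Type*} (s : State m N) (i : ℕ) (u : Option N) : State m N :=
  { s with elem := Function.update s.elem i u }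

def State.setNum {m : ℕ} {N : Type*} (s : State m N) (i : ℕ) (v : ℝ) : State m N :=
  { s with num := Function.update s.num i v }

def State.setVar {m : ℕ} {N : Type*} (s : State m N) (x : Fin (m + 1)) (v : ℕ) : State m N :=
  { s with var := Function.update s.var x v }

/-- The input to which the algorithm has oracle access only: the objective function and the
independent sets. -/
structure Oracles (N : Type*) where
  value : Finset N → ℝ
  indep : Finset N → Prop

/-- Integer expressions: `sub` is truncated subtraction, `div` and `mod` are division with
remainder (with `x / 0 = 0`). -/
inductive NatExp (m : ℕ) where
  | lit (n : ℕ)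
  | var (x : Fin (m + 1))
  | add (a b : NatExp m)
  | sub (a b : NatExp m)
  | mul (a b : NatExp m)
  | div (a b : NatExp m)
  | mod (a b : NatExp m)

def NatExp.eval {m : ℕ} {N : Type*} (s : State m N) : NatExp m → ℕ
  | .lit n => n
  | .var x => s.var x
  | .add a b => a.eval s + b.eval s
  | .sub a b => a.eval s - b.eval s
  | .mul a b => a.eval s * b.eval s
  | .div a b => a.eval s / b.eval s
  | .mod a b => a.eval s % b.eval s

/-- Numerical expressions: rational constants, number cells, the four arithmetic operations
(with `x / 0 = 0`), and a call `value lo hi` to the value oracle on the set of the elements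
stored in the element cells `lo, …, hi - 1`. There is no rounding operation. -/
inductive NumExp (m : ℕ) where
  | lit (q : ℚ)
  | cell (i : NatExp m)
  | add (a b : NumExp m)
  | sub (a b : NumExp m)
  | mul (a b : NumExp m)
  | div (a b : NumExp m)
  | value (lo hi : NatExp m)

noncomputable def NumExp.eval {m : ℕ} {N : Type*} [DecidableEq N] (O : Oracles N)
    (s : State m N) : NumExp m → ℝ
  | .lit q => (q : ℝ)
  | .cell i => s.num (i.eval s)
  | .add a b => a.eval O s + b.eval O s
  | .sub a b => a.eval O s - b.eval O s
  | .mul a b => a.eval O s * b.eval O s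
  | .div a b => a.eval O s / b.eval O s
  | .value lo hi => O.value (s.cells (lo.eval s) (hi.eval s))

/-- Tests: comparisons of integers and of numbers, equality of the contents of two element cells,
and a call `indep lo hi` to the independence oracle on the set of the elements stored in the
element cells `lo, …, hi - 1`. -/
inductive Cond (m : ℕ) where
  | natLe (a b : NatExp m)
  | numLe (a b : NumExp m)
  | same (i j : NatExp m)
  | indep (lo hi : NatExp m)
  | not (c : Cond m)
  | and (c d : Cond m)

def Cond.Holds {m : ℕ} {N : Type*} [DecidableEq N] (O : Oracles N) (s : State m N) :
    Cond m → Prop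
  | .natLe a b => a.eval s ≤ b.eval s
  | .numLe a b => a.eval O s ≤ b.eval O s
  | .same i j => s.elem (i.eval s) = s.elem (j.eval s)
  | .indep lo hi => O.indep (s.cells (lo.eval s) (hi.eval s))
  | .not c => ¬ c.Holds O s
  | .and c d => c.Holds O s ∧ d.Holds O s

/-- Commands: assignments to an integer variable or a number cell, copying an element cell
(`copyElem i j` copies cell `j` into cell `i`), erasing an element cell, and control structures.
The addresses are computed at run time. -/
inductive Cmd (m : ℕ) where
  | skip
  | setVar (x : Fin (m + 1)) (e : NatExp m)
  | setNum (i : NatExp m) (e : NumExp m)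
  | copyElem (i j : NatExp m)
  | eraseElem (i : NatExp m)
  | seq (c d : Cmd m)
  | ite (b : Cond m) (c d : Cmd m)
  | while (b : Cond m) (c : Cmd m)

/-- The memory at the disposal of a run: the number of element cells, the number of number cells,
and the number of bits of each integer variable. -/
structure Space where
  elems : ℕ
  nums : ℕ
  bits : ℕ

/-- `Exec O σ c s t`: started in `s`, the command `c` terminates in `t`, and all the time it stays
within the memory `σ` (writing to a cell beyond `σ`, or an integer too long for `σ`, aborts the
run). -/
inductive Exec {m : ℕ} {N : Type*} [DecidableEq N] (O : Oracles N) (σ : Space) :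
    Cmd m → State m N → State m N → Prop
  | skip (s : State m N) : Exec O σ .skip s s
  | setVar (x : Fin (m + 1)) (e : NatExp m) (s : State m N) (h : e.eval s < 2 ^ σ.bits) :
      Exec O σ (.setVar x e) s (s.setVar x (e.eval s))
  | setNum (i : NatExp m) (e : NumExp m) (s : State m N) (h : i.eval s < σ.nums) :
      Exec O σ (.setNum i e) s (s.setNum (i.eval s) (e.eval O s))
  | copyElem (i j : NatExp m) (s : State m N) (h : i.eval s < σ.elems) :
      Exec O σ (.copyElem i j) s (s.setElem (i.eval s) (s.elem (j.eval s)))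
  | eraseElem (i : NatExp m) (s : State m N) (h : i.eval s < σ.elems) :
      Exec O σ (.eraseElem i) s (s.setElem (i.eval s) none)
  | seq {c d : Cmd m} {s t r : State m N} (h₁ : Exec O σ c s t) (h₂ : Exec O σ d t r) :
      Exec O σ (.seq c d) s r
  | iteTrue {b : Cond m} {c d : Cmd m} {s t : State m N} (hb : b.Holds O s)
      (h : Exec O σ c s t) : Exec O σ (.ite b c d) s t
  | iteFalse {b : Cond m} {c d : Cmd m} {s t : State m N} (hb : ¬ b.Holds O s)
      (h : Exec O σ d s t) : Exec O σ (.ite b c d) s t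
  | whileTrue {b : Cond m} {c : Cmd m} {s t r : State m N} (hb : b.Holds O s)
      (h₁ : Exec O σ c s t) (h₂ : Exec O σ (.while b c) t r) : Exec O σ (.while b c) s r
  | whileFalse {b : Cond m} {c : Cmd m} {s : State m N} (hb : ¬ b.Holds O s) :
      Exec O σ (.while b c) s s

/-! ### Single-pass algorithms -/

/-- A single-pass data stream algorithm: a finite program, which consists of what to do before the
stream starts, on the arrival of an element, and after the stream has ended. -/
structure Algorithm where
  m : ℕ
  init : Cmd m
  arrive : Cmd m
  finish : Cmd m

/-- `Pass O σ c stream s t`: starting in `s`, the elements of the stream arrive one after the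
other; each is put in element cell `0`, and then the command `c` is run. -/
inductive Pass {m : ℕ} {N : Type*} [DecidableEq N] (O : Oracles N) (σ : Space) (c : Cmd m) :
    List N → State m N → State m N → Prop
  | nil (s : State m N) : Pass O σ c [] s s
  | cons {u : N} {us : List N} {s t r : State m N} (h₀ : 0 < σ.elems)
      (h₁ : Exec O σ c (s.setElem 0 (some u)) t) (h₂ : Pass O σ c us t r) :
      Pass O σ c (u :: us) s r

/-- The empty memory, except that integer variable `0` holds the rank `k`. -/
def State.initial (m : ℕ) (N : Type*) (k : ℕ) : State m N where
  elem := fun _ => none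
  num := fun _ => 0
  var := fun x => if x = 0 then k else 0

/-- Given the rank `k` and the stream, the algorithm `A` terminates within the memory `σ` with
output `R`: if integer variable `0` holds the number `j` at the end, then `R` is the set of the
elements that are stored in the element cells `0, …, j - 1`. -/
def Algorithm.Outputs (A : Algorithm) {N : Type*} [DecidableEq N] (O : Oracles N) (σ : Space)
    (k : ℕ) (stream : List N) (R : Finset N) : Prop :=
  k < 2 ^ σ.bits ∧ ∃ s₁ s₂ t : State A.m N,
    Exec O σ A.init (State.initial A.m N k) s₁ ∧ Pass O σ A.arrive stream s₁ s₂ ∧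
      Exec O σ A.finish s₂ t ∧ R = t.cells 0 (t.var 0)

/-- The memory besides the stored elements: one unit for each number cell and for each bit of
each integer variable. -/
def Algorithm.additionalMemory (A : Algorithm) (σ : Space) : ℕ :=
  σ.nums + (A.m + 1) * σ.bits

/-- The algorithm `A`, given memory `σ k` on matroids of rank `k`, is a `ρ`-approximation for
maximizing a non-negative monotone submodular function `f` subject to a matroid `M`, whatever the
order in which the elements of the ground set `N` arrive. -/
def Algorithm.Approximates (A : Algorithm) (σ : ℕ → Space) (ρ : ℝ) : Prop :=
  ∀ (N : Type u) [DecidableEq N] (M : Matroid N) (f : Finset N → ℝ) (k : ℕ) (stream : List N),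
    M.E = Set.univ → M.eRank = (k : ℕ∞) → stream.Nodup → (∀ u, u ∈ stream) →
    (∀ S, 0 ≤ f S) → MonotoneSet f → Submodular f →
    ∃ R : Finset N,
      A.Outputs ⟨f, fun S => M.Indep (S : Set N)⟩ (σ k) k stream R ∧
      M.Indep (R : Set N) ∧ ∀ S : Finset N, M.Indep (S : Set N) → ρ * f S ≤ f R

/-- Some single-pass algorithm is a `ρ`-approximation, stores `O(k)` elements and uses `Õ(k)`
additional memory on matroids of rank `k`. (The maximum with `1` matters for `k = 0` only: the
element that has just arrived is always in memory.) -/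
def SemiStreamingRatio (ρ : ℝ) : Prop :=
  ∃ (A : Algorithm) (σ : ℕ → Space) (C d : ℕ),
    (∀ k, (σ k).elems ≤ C * max k 1) ∧
    (∀ k, A.additionalMemory (σ k) ≤ C * max k 1 * (Nat.log 2 (k + 2)) ^ d) ∧
    A.Approximates.{u} σ ρ

end DataStream

/-! The algorithm maintains a fractional solution `x`, and `F` denotes the multilinear extension of
`f` (`expand` at `∅`). When `u` arrives, `g u` is the largest power of `c` below its marginal with
respect to the stored part of `x`, and `l u` is the highest level `t ≤ g u` at which the stored
elements with `g ≥ t` span `u` (but at least the threshold `θ`). The element is used on the interval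
`(l u, g u]` and gets the coordinate `x u = (g u - l u) / (al * g u)`. At each level `t` the
elements whose interval contains `t` are independent, and for `t ≥ c * θ` they span everything with
`g ≥ t`: a greedy basis is kept for all thresholds at once. Let `G` be the total length of the
intervals; these invariants form `History`.

Upper bound (`History.value_le`, `History.sum_g_le`): `f S` is at most `F(x)` plus the marginals of
the members of `S`. The former is at most `f ∅ + c * G / al`. The latter are at most `c * g u`, and
a comparison of cardinalities level by level bounds the sum of `g u` over `S` by about `G`. So `f S`
exceeds `f ∅` by at most about `(1 / al + 1) * G`.

Lower bound (`History.exists_indep_ge`): take `c = m / (m - al)`, go through the levels from the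
top, and split them into `m` residue classes. In each class the bases of the levels can be replaced
by nested sets with the same spans (`exists_layered_bases`). The average of the `m` final sets
dominates a point below `x` that collects `(1 - c⁻ᵐ) / al` of the length above a cut-off, and `c⁻ᵐ ≤
exp (-al)`. Convexity of `F` in the directions `e_v - e_u` rounds the average to one independent set
(`exists_indep_ge_expand_avg`). For large `m` the ratio tends to `(1 - exp (-al)) / (1 + al)`, which
is largest where `exp α = α + 2`, with value `1 / (α + 2)` (`exists_parameters`).

Memory: with `θ = G / (al * m * k)`, the levels up to about `θ` carry only an `O(1 / m)` fraction of
`G`, as each is covered at most `k` times. A used element with `g > θ` has length above `al * θ /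
m`, so fewer than `m² k` slots are needed for them (`History.exists_free_slot`). Running time is not
bounded, so marginals, spans and the final output are computed by enumerating all subsets of the
slots, each encoded by an integer of `m² k` bits. -/

namespace DataStream

/-! ### Multilinear extensions of monotone submodular functions. -/

section Multilinear

variable {N : Type*} [DecidableEq N]

/-- The expected value of `f` once `u` is added with probability `p`. -/
def mix (u : N) (p : ℝ) (f : Finset N → ℝ) : Finset N → ℝ :=
  fun S => p * f (insert u S) + (1 - p) * f S

/-- The expected value of `f` once each `u` in the list is added independently with
probability `x u`; at `∅` this is the multilinear extension of `f`. -/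
def expand (x : N → ℝ) : List N → (Finset N → ℝ) → Finset N → ℝ
  | [], f => f
  | u :: L, f => mix u (x u) (expand x L f)

/-- The marginal contribution of `u` to `S`. -/
def marg (f : Finset N → ℝ) (u : N) (S : Finset N) : ℝ := f (insert u S) - f S

lemma mix_eq (u : N) (p : ℝ) (f : Finset N → ℝ) (S : Finset N) :
    mix u p f S = f S + p * marg f u S := by
  unfold mix marg; ring

lemma marg_mix (u v : N) (p : ℝ) (f : Finset N → ℝ) (S : Finset N) :
    marg (mix v p f) u S = p * marg f u (insert v S) + (1 - p) * marg f u S := by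
  unfold mix marg; rw [Finset.insert_comm]; ring

lemma marg_of_mem (f : Finset N → ℝ) {u : N} {S : Finset N} (h : u ∈ S) : marg f u S = 0 := by
  unfold marg; rw [Finset.insert_eq_of_mem h, sub_self]

lemma mix_zero (u : N) (f : Finset N → ℝ) : mix u 0 f = f := by
  funext S; simp [mix]

lemma mix_comm (u v : N) (p q : ℝ) (f : Finset N → ℝ) :
    mix u p (mix v q f) = mix v q (mix u p f) := by
  funext S; simp only [mix]; rw [Finset.insert_comm]; ring

lemma MonotoneSet.marg_nonneg {f : Finset N → ℝ} (hm : MonotoneSet f) (u : N) (S : Finset N) :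
    0 ≤ marg f u S := hm S u

lemma Submodular.marg_anti {f : Finset N → ℝ} (hs : Submodular f) (hm : MonotoneSet f) (u : N)
    {S T : Finset N} (h : S ⊆ T) : marg f u T ≤ marg f u S := by
  by_cases hu : u ∈ T
  · rw [marg_of_mem f hu]; exact hm.marg_nonneg u S
  · exact hs S T h u hu

lemma MonotoneSet.mix {f : Finset N → ℝ} (hm : MonotoneSet f) {p : ℝ} (h0 : 0 ≤ p) (h1 : p ≤ 1)
    (v : N) : MonotoneSet (mix v p f) := by
  intro S u
  change 0 ≤ marg (DataStream.mix v p f) u S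
  rw [marg_mix]
  have := hm.marg_nonneg u S
  have := hm.marg_nonneg u (insert v S)
  have : 0 ≤ 1 - p := by linarith
  positivity

lemma Submodular.mix {f : Finset N → ℝ} (hs : Submodular f) (hm : MonotoneSet f) {p : ℝ}
    (h0 : 0 ≤ p) (h1 : p ≤ 1) (v : N) : Submodular (mix v p f) := by
  intro S T hST u _
  change marg (DataStream.mix v p f) u T ≤ marg (DataStream.mix v p f) u S
  rw [marg_mix, marg_mix]
  have h2 := hs.marg_anti hm u hST
  have h3 := hs.marg_anti hm u (Finset.insert_subset_insert v hST)
  have : 0 ≤ 1 - p := by linarith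
  gcongr

lemma expand_append (x : N → ℝ) (L L' : List N) (f : Finset N → ℝ) :
    expand x (L ++ L') f = expand x L (expand x L' f) := by
  induction L with
  | nil => rfl
  | cons u L ih => simp [expand, ih]

lemma expand_perm (x : N → ℝ) {L L' : List N} (h : L.Perm L') (f : Finset N → ℝ) :
    expand x L f = expand x L' f := by
  induction h with
  | nil => rfl
  | cons u _ ih => simp [expand, ih]
  | swap u v L => exact mix_comm _ _ _ _ _
  | trans _ _ h1 h2 => exact h1.trans h2

lemma expand_congr {x y : N → ℝ} {L : List N} (h : ∀ u ∈ L, x u = y u) (f : Finset N → ℝ) :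
    expand x L f = expand y L f := by
  induction L with
  | nil => rfl
  | cons u L ih =>
    simp only [List.mem_cons, forall_eq_or_imp] at h
    simp [expand, h.1, ih h.2]

lemma expand_filter (x : N → ℝ) (p : N → Prop) [DecidablePred p] (L : List N)
    (f : Finset N → ℝ) :
    expand (fun u => if p u then x u else 0) L f = expand x (L.filter p) f := by
  induction L with
  | nil => rfl
  | cons u L ih =>
    by_cases h : p u <;> simp [expand, h, ih, mix_zero]

lemma expand_mono_submod {x : N → ℝ} {f : Finset N → ℝ} (hm : MonotoneSet f) (hs : Submodular f)
    {L : List N} (h : ∀ u ∈ L, 0 ≤ x u ∧ x u ≤ 1) :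
    MonotoneSet (expand x L f) ∧ Submodular (expand x L f) := by
  induction L with
  | nil => exact ⟨hm, hs⟩
  | cons u L ih =>
    simp only [List.mem_cons, forall_eq_or_imp] at h
    obtain ⟨h1, h2⟩ := ih h.2
    exact ⟨h1.mix h.1.1 h.1.2 u, h2.mix h1 h.1.1 h.1.2 u⟩

lemma marg_mix_le {f : Finset N → ℝ} (hm : MonotoneSet f) (hs : Submodular f) {p : ℝ}
    (h0 : 0 ≤ p) (u v : N) (S : Finset N) : marg (mix v p f) u S ≤ marg f u S := by
  rw [marg_mix]
  nlinarith [hs.marg_anti hm u (Finset.subset_insert v S)]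

lemma le_expand {x : N → ℝ} {f : Finset N → ℝ} (hm : MonotoneSet f) (hs : Submodular f)
    {L : List N} (h : ∀ u ∈ L, 0 ≤ x u ∧ x u ≤ 1) (S : Finset N) : f S ≤ expand x L f S := by
  induction L with
  | nil => exact le_rfl
  | cons u L ih =>
    simp only [List.mem_cons, forall_eq_or_imp] at h
    have := (expand_mono_submod hm hs h.2).1.marg_nonneg u S
    have h0 := h.1.1
    simp only [expand, mix_eq]
    nlinarith [ih h.2, mul_nonneg h0 this]

lemma marg_expand_le {x : N → ℝ} {f : Finset N → ℝ} (hm : MonotoneSet f) (hs : Submodular f)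
    {L : List N} (h : ∀ u ∈ L, 0 ≤ x u ∧ x u ≤ 1) (u : N) (S : Finset N) :
    marg (expand x L f) u S ≤ marg f u S := by
  induction L with
  | nil => exact le_rfl
  | cons v L ih =>
    simp only [List.mem_cons, forall_eq_or_imp] at h
    have h' := expand_mono_submod hm hs h.2
    exact (marg_mix_le h'.1 h'.2 h.1.1 u v S).trans (ih h.2)

/-- Marginals decrease when the random set gets more elements. -/
lemma marg_expand_subset {x : N → ℝ} {f : Finset N → ℝ} (hm : MonotoneSet f) (hs : Submodular f)
    {L L' : List N} (hL : L.Nodup) (hsub : L ⊆ L') (h : ∀ u ∈ L', 0 ≤ x u ∧ x u ≤ 1)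
    (u : N) (S : Finset N) : marg (expand x L' f) u S ≤ marg (expand x L f) u S := by
  obtain ⟨l, hl, hl'⟩ := List.subperm_of_subset hL hsub
  obtain ⟨R, hR⟩ := hl'.exists_perm_append
  -- Up to order, `L'` is `L` together with further elements, and each further mixing lowers
  -- marginals.
  have hp : L'.Perm (R ++ L) := hR.trans (List.perm_append_comm.trans (hl.append_left R))
  rw [expand_perm x hp, expand_append]
  have h1 := expand_mono_submod hm hs fun v hv => h v (hsub hv)
  exact marg_expand_le h1.1 h1.2 (fun v hv => h v (hp.mem_iff.2 (by simp [hv]))) u S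

lemma mix_mono {f g : Finset N → ℝ} (h : ∀ S, f S ≤ g S) (hm : MonotoneSet g) {p q : ℝ}
    (h0 : 0 ≤ p) (h1 : p ≤ 1) (hpq : p ≤ q) (u : N) (S : Finset N) :
    mix u p f S ≤ mix u q g S := by
  have h2 : mix u p f S ≤ mix u p g S := by
    unfold mix
    have : 0 ≤ 1 - p := by linarith
    gcongr <;> exact h _
  refine h2.trans ?_
  rw [mix_eq, mix_eq]
  have := hm.marg_nonneg u S
  gcongr

lemma expand_mono {x y : N → ℝ} {f : Finset N → ℝ} (hm : MonotoneSet f) (hs : Submodular f)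
    {L : List N} (h : ∀ u ∈ L, 0 ≤ x u ∧ x u ≤ y u ∧ y u ≤ 1) (S : Finset N) :
    expand x L f S ≤ expand y L f S := by
  induction L generalizing S with
  | nil => exact le_rfl
  | cons u L ih =>
    simp only [List.mem_cons, forall_eq_or_imp] at h
    exact mix_mono (ih h.2)
      (expand_mono_submod hm hs fun v hv => ⟨by linarith [h.2 v hv], (h.2 v hv).2.2⟩).1
      h.1.1 (h.1.2.1.trans h.1.2.2) h.1.2.1 u S

lemma marg_expand_anti {x y : N → ℝ} {f : Finset N → ℝ} (hm : MonotoneSet f) (hs : Submodular f)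
    {L : List N} (h : ∀ u ∈ L, 0 ≤ x u ∧ x u ≤ y u ∧ y u ≤ 1) (u : N) (S : Finset N) :
    marg (expand y L f) u S ≤ marg (expand x L f) u S := by
  induction L generalizing S with
  | nil => exact le_rfl
  | cons v L ih =>
    simp only [List.mem_cons, forall_eq_or_imp] at h
    have hy := expand_mono_submod (L := L) (x := y) hm hs
      fun v hv => ⟨by linarith [h.2 v hv], (h.2 v hv).2.2⟩
    have h1 := hy.2.marg_anti hy.1 u (Finset.subset_insert v S)
    have h2 := ih h.2 S
    have h3 := ih h.2 (insert v S)
    simp only [expand, marg_mix]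
    have h4 : 0 ≤ 1 - x v := by linarith
    calc y v * marg (expand y L f) u (insert v S) + (1 - y v) * marg (expand y L f) u S
        ≤ x v * marg (expand y L f) u (insert v S) + (1 - x v) * marg (expand y L f) u S := by
          nlinarith
      _ ≤ _ := by
          have := h.1.1
          gcongr

lemma Submodular.le_add_sum_marg {f : Finset N → ℝ} (hm : MonotoneSet f) (hs : Submodular f)
    (S : Finset N) : f S ≤ f ∅ + ∑ u ∈ S, marg f u ∅ := by
  induction S using Finset.induction_on with
  | empty => simp
  | insert u S hu ih =>
    rw [Finset.sum_insert hu]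
    have := hs.marg_anti hm u (Finset.empty_subset S)
    have h2 : f (insert u S) = f S + marg f u S := by unfold marg; ring
    linarith

/-- Upper bound for the multilinear extension by the marginals at arrival. -/
lemma expand_le_add_sum {x b : N → ℝ} {f : Finset N → ℝ} {L : List N} (hx : ∀ u ∈ L, 0 ≤ x u)
    (h : ∀ u L', (u :: L') <:+ L → marg (expand x L' f) u ∅ ≤ b u) :
    expand x L f ∅ ≤ f ∅ + (L.map fun u => x u * b u).sum := by
  induction L with
  | nil => simp [expand]
  | cons u L ih =>
    have h1 := h u L (List.suffix_refl _)
    have h2 := ih (fun v hv => hx v (by simp [hv]))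
      fun v L' hL => h v L' (hL.trans (List.suffix_cons u L))
    simp only [expand, mix_eq, List.map_cons, List.sum_cons]
    nlinarith [hx u (by simp), mul_le_mul_of_nonneg_left h1 (hx u (by simp))]

/-- Elements with `x u = 0` gain nothing, so their marginals need no bound; later `x` is supported
on the used elements above the threshold, the only ones whose marginals are bounded from below. -/
lemma le_expand_of_sum {x b : N → ℝ} {f : Finset N → ℝ} {L : List N} (hx : ∀ u ∈ L, 0 ≤ x u)
    (h : ∀ u L', (u :: L') <:+ L → x u ≠ 0 → b u ≤ marg (expand x L' f) u ∅) :
    f ∅ + (L.map fun u => x u * b u).sum ≤ expand x L f ∅ := by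
  induction L with
  | nil => simp [expand]
  | cons u L ih =>
    have h1 := h u L (List.suffix_refl _)
    have h2 := ih (fun v hv => hx v (by simp [hv]))
      fun v L' hL => h v L' (hL.trans (List.suffix_cons u L))
    simp only [expand, mix_eq, List.map_cons, List.sum_cons]
    have h3 : x u * b u ≤ x u * marg (expand x L f) u ∅ := by
      by_cases h0 : x u = 0
      · simp [h0]
      · exact mul_le_mul_of_nonneg_left (h1 h0) (hx u (by simp))
    linarith

end Multilinear

/-! ### Rounding an average of independent sets by base exchanges. -/

section Rounding

/-- Symmetric exchange of elements between two bases. -/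
lemma exists_symm_exchange {N : Type*} {M : Matroid N} {B B' : Set N} (hB : M.IsBase B)
    (hB' : M.IsBase B') {e : N} (he : e ∈ B) (he' : e ∉ B') :
    ∃ v, v ∈ B' ∧ v ∉ B ∧ M.IsBase (insert v (B \ {e})) ∧ M.IsBase (insert e (B' \ {v})) := by
  have heE : e ∈ M.E := hB.subset_ground he
  have hcl : e ∈ M.closure B' := by rw [hB'.closure_eq]; exact heE
  have hC := hB'.fundCircuit_isCircuit heE he'
  have h1 : e ∈ M.closure (M.fundCircuit e B' \ {e}) :=
    hC.mem_closure_sdiff_singleton_of_mem (M.mem_fundCircuit e B')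
  have h2 : e ∉ M.closure (B \ {e}) := hB.indep.notMem_closure_sdiff_of_mem he
  -- `e` is spanned by the rest of its fundamental circuit but not by `B \ {e}`, so some `v` of the
  -- circuit is outside that span. Being outside makes `B - e + v` a base; being on the circuit
  -- makes `B' - v + e` one.
  have h3 : ¬ (M.fundCircuit e B' \ {e} ⊆ M.closure (B \ {e})) := fun h =>
    h2 (M.closure_subset_closure_of_subset_closure h h1)
  obtain ⟨v, ⟨hv, hve⟩, hv2⟩ := Set.not_subset.1 h3
  have hve : v ≠ e := hve
  have hvB' : v ∈ B' := (M.fundCircuit_subset_insert e B' hv).resolve_left hve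
  have hvE := hB'.subset_ground hvB'
  refine ⟨v, hvB', fun hvB => hv2 (M.mem_closure_of_mem' ⟨hvB, hve⟩ hvE), ?_, ?_⟩
  · exact hB.exchange_base_of_notMem_closure he hv2
  · have := (hB'.indep.mem_fundCircuit_iff hcl he').1 hv
    have h := hB'.exchange_isBase_of_indep' hvB' he' this
    rwa [← Set.insert_sdiff_singleton_comm hve.symm] at h

variable {N : Type*} [DecidableEq N]

lemma expand_indicator (R : Finset N) (L : List N) (f : Finset N → ℝ) (S : Finset N) :
    expand (fun u => if u ∈ R then 1 else 0) L f S = f (S ∪ L.toFinset.filter (· ∈ R)) := by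
  induction L generalizing S with
  | nil => simp [expand]
  | cons u L ih =>
    by_cases h : u ∈ R
    · simp only [expand, mix, h, if_true, ih, List.toFinset_cons, Finset.filter_insert]
      simp
    · simp only [expand, mix, h, if_false, ih, List.toFinset_cons, Finset.filter_insert]
      simp

/-- The multilinear extension is convex in the direction `e_v - e_u`. -/
lemma expand_convex_direction {f : Finset N → ℝ} (hm : MonotoneSet f) (hs : Submodular f)
    {L : List N} (hL : L.Nodup) {x y z : N → ℝ} (hx : ∀ w ∈ L, 0 ≤ x w ∧ x w ≤ 1) {u v : N}
    (hu : u ∈ L) (hv : v ∈ L) (huv : u ≠ v) (d : ℝ)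
    (hy : ∀ w, y w = x w + ((if w = v then d else 0) - (if w = u then d else 0)))
    (hz : ∀ w, z w = x w - ((if w = v then d else 0) - (if w = u then d else 0))) :
    2 * expand x L f ∅ ≤ expand y L f ∅ + expand z L f ∅ := by
  have hv' : v ∈ L.erase u := (List.mem_erase_of_ne huv.symm).2 hv
  have hp : L.Perm (u :: v :: (L.erase u).erase v) :=
    (List.perm_cons_erase hu).trans ((List.perm_cons_erase hv').cons u)
  have hn := (hp.nodup_iff).1 hL
  set R := (L.erase u).erase v
  simp only [List.nodup_cons, List.mem_cons, not_or] at hn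
  have hyR : expand y R f = expand x R f := expand_congr (fun w hw => by
    have h1 : w ≠ u := fun h => hn.1.2 (h ▸ hw)
    have h2 : w ≠ v := fun h => hn.2.1 (h ▸ hw)
    simp [hy, h1, h2]) f
  have hzR : expand z R f = expand x R f := expand_congr (fun w hw => by
    have h1 : w ≠ u := fun h => hn.1.2 (h ▸ hw)
    have h2 : w ≠ v := fun h => hn.2.1 (h ▸ hw)
    simp [hz, h1, h2]) f
  have hR := expand_mono_submod (x := x) (L := R) hm hs
    fun w hw => hx w (hp.mem_iff.2 (by simp [hw]))
  -- The coefficient of `x u * x v` is a second difference, nonpositive by submodularity. Along `e_v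
  -- - e_u` the quadratic term is `-d²` times this coefficient, and the linear terms cancel in the
  -- sum.
  have key := hR.2.marg_anti hR.1 u (Finset.empty_subset {v})
  simp only [expand_perm _ hp, expand, hyR, hzR]
  simp only [hy, hz, if_pos, huv, huv.symm, if_false]
  set h := expand x R f
  simp only [marg] at key
  have e1 : (insert u ∅ : Finset N) = {u} := by simp
  rw [e1] at key
  simp only [mix, e1]
  have e2 : (insert v ∅ : Finset N) = {v} := by simp
  have e3 : (insert v {u} : Finset N) = insert u {v} := by ext; simp [or_comm]
  rw [e2, e3]
  nlinarith [mul_nonneg (mul_self_nonneg d) (sub_nonneg.2 key)]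

lemma sum_update_apply {m : ℕ} {β : Type*} (J : Fin m → β) (j : Fin m) (A : β) (φ : β → ℝ) :
    ∑ i, φ (Function.update J j A i) = ∑ i, φ (J i) + (φ A - φ (J j)) := by
  rw [← Finset.add_sum_erase _ _ (Finset.mem_univ j),
    ← Finset.add_sum_erase _ (fun i => φ (J i)) (Finset.mem_univ j)]
  have : ∑ i ∈ Finset.univ.erase j, φ (Function.update J j A i)
      = ∑ i ∈ Finset.univ.erase j, φ (J i) :=
    Finset.sum_congr rfl fun i hi => by
      rw [Function.update_of_ne (Finset.ne_of_mem_erase hi)]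
  rw [this]; simp; ring

/-- The coordinatewise average of the characteristic vectors of the sets `J i`. -/
noncomputable def avg {m : ℕ} (J : Fin m → Finset N) (w : N) : ℝ :=
  (∑ i, if w ∈ J i then (1 : ℝ) else 0) / m

lemma avg_mem {m : ℕ} (J : Fin m → Finset N) (w : N) : 0 ≤ avg J w ∧ avg J w ≤ 1 := by
  unfold avg
  constructor
  · exact div_nonneg (Finset.sum_nonneg fun i _ => by split_ifs <;> simp) (Nat.cast_nonneg _)
  · apply div_le_one_of_le₀ _ (Nat.cast_nonneg _)
    calc _ ≤ ∑ _i : Fin m, (1 : ℝ) := Finset.sum_le_sum fun i _ => by split_ifs <;> simp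
      _ = m := by simp

lemma avg_update {m : ℕ} (J : Fin m → Finset N) (j : Fin m) {u v : N} (huv : u ≠ v)
    (hu : u ∈ J j) (hv : v ∉ J j) (w : N) :
    avg (Function.update J j (insert v ((J j).erase u))) w =
      avg J w + ((if w = v then (1 / m : ℝ) else 0) - (if w = u then (1 / m : ℝ) else 0)) := by
  unfold avg
  rw [sum_update_apply J j _ (fun A => if w ∈ A then (1 : ℝ) else 0), add_div]
  congr 1
  by_cases h1 : w = v
  · subst h1; simp [hv, huv.symm]
  by_cases h2 : w = u
  · subst h2; simp [hu, huv, neg_div]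
  simp [h1, h2]

/-- Rounding: a convex combination of independent sets is at most as good, in terms of the
multilinear extension, as some independent set. -/
lemma exists_indep_ge_expand_avg {M : Matroid N} (hE : M.E = Set.univ) {f : Finset N → ℝ}
    (hm : MonotoneSet f) (hs : Submodular f) {L : List N} (hL : L.Nodup) (hall : ∀ u, u ∈ L)
    {m : ℕ} (hm0 : 0 < m) (I : Fin m → Finset N) (V : Finset N)
    (hI : ∀ j, M.Indep (I j : Set N)) (hIV : ∀ j, I j ⊆ V) :
    ∃ R : Finset N, M.Indep (R : Set N) ∧ R ⊆ V ∧ expand (avg I) L f ∅ ≤ f R := by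
  classical
  let T : Finset (Fin m → Finset N) :=
    Fintype.piFinset fun _ => V.powerset.filter fun B => M.IsBasis (B : Set N) V
  have memT : ∀ J, J ∈ T ↔ ∀ j, M.IsBasis (J j : Set N) V := fun J => by
    simp only [T, Fintype.mem_piFinset, Finset.mem_filter, Finset.mem_powerset]
    exact ⟨fun h j => (h j).2, fun h j => ⟨by exact_mod_cast (h j).subset, h j⟩⟩
  have hext : ∀ j, ∃ B : Finset N, M.IsBasis (B : Set N) V ∧ I j ⊆ B := fun j => by
    obtain ⟨B, hB, hIB⟩ := (hI j).subset_isBasis_of_subset (X := (V : Set N))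
      (by exact_mod_cast hIV j) (by rw [hE]; exact Set.subset_univ _)
    have hfin : B.Finite := V.finite_toSet.subset hB.subset
    exact ⟨hfin.toFinset, by simpa using hB, by intro u hu; simpa using hIB hu⟩
  choose B hB hIB using hext
  have hBT : B ∈ T := (memT B).2 hB
  have hB1 : expand (avg I) L f ∅ ≤ expand (avg B) L f ∅ := by
    refine expand_mono hm hs (fun w _ => ⟨(avg_mem I w).1, ?_, (avg_mem B w).2⟩) ∅
    unfold avg
    gcongr with i
    by_cases h : w ∈ I i
    · simp [h, hIB i h]
    · simp only [h, if_false]; split_ifs <;> simp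
  let F := fun J : Fin m → Finset N => expand (avg J) L f ∅
  let Φ := fun J : Fin m → Finset N => ∑ w ∈ V, avg J w ^ 2
  -- In a maximiser with ties broken by `Φ` all bases coincide. Otherwise a symmetric exchange moves
  -- the average by `(e_v - e_u) / m` in either direction; convexity forces both moves to preserve
  -- `F`, and strict convexity of the squares lets one of them increase `Φ`.
  obtain ⟨J, hJT, hJ⟩ := T.exists_max_image (fun J => toLex (F J, Φ J)) ⟨B, hBT⟩
  have hmax : ∀ J' ∈ T, F J' ≤ F J ∧ (F J' = F J → Φ J' ≤ Φ J) := fun J' hJ' => by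
    have := hJ J' hJ'
    rw [Prod.Lex.toLex_le_toLex] at this
    rcases this with h | ⟨h, h'⟩
    · exact ⟨h.le, fun e => absurd e h.ne⟩
    · exact ⟨h.le, fun _ => h'⟩
  have hJb := (memT J).1 hJT
  have hconst : ∀ i j, J i = J j := by
    by_contra! hne
    obtain ⟨i, j, hij⟩ := hne
    have hbi : (M.restrict (V : Set N)).IsBase (J i : Set N) := (hJb i).isBase_restrict
    have hbj : (M.restrict (V : Set N)).IsBase (J j : Set N) := (hJb j).isBase_restrict
    obtain ⟨u, hui, huj⟩ : ∃ u, u ∈ J i ∧ u ∉ J j := by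
      by_contra! h
      exact hij (by exact_mod_cast hbi.eq_of_subset_isBase hbj (by exact_mod_cast h))
    obtain ⟨v, hvj, hvi, h1, h2⟩ := exists_symm_exchange hbi hbj (e := u)
      (by exact_mod_cast hui) (by exact_mod_cast huj)
    have hvj : v ∈ J j := by exact_mod_cast hvj
    have hvi : v ∉ J i := by exact_mod_cast hvi
    have huv : u ≠ v := fun h => huj (h ▸ hvj)
    let Jp := Function.update J i (insert v ((J i).erase u))
    let Jm := Function.update J j (insert u ((J j).erase v))
    have hVE : (V : Set N) ⊆ M.E := by rw [hE]; exact Set.subset_univ _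
    have hp : Jp ∈ T := (memT _).2 fun l => by
      by_cases hl : l = i
      · subst hl
        simpa [Jp] using (Matroid.isBase_restrict_iff hVE).1 h1
      · simpa [Jp, hl] using hJb l
    have hq : Jm ∈ T := (memT _).2 fun l => by
      by_cases hl : l = j
      · subst hl
        simpa [Jm] using (Matroid.isBase_restrict_iff hVE).1 h2
      · simpa [Jm, hl] using hJb l
    have avp := avg_update J i huv hui hvi
    have avm : ∀ w, avg Jm w = avg J w - ((if w = v then (1 / m : ℝ) else 0) -
        (if w = u then (1 / m : ℝ) else 0)) := fun w => by
      rw [avg_update J j huv.symm hvj huj]; ring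
    have hconv := expand_convex_direction hm hs hL (fun w _ => avg_mem J w) (hall u) (hall v) huv
      (1 / m) avp avm
    have m1 := hmax _ hp
    have m2 := hmax _ hq
    have hF1 : F Jp = F J := le_antisymm m1.1 (by have := m2.1; simp only [F, Jp, Jm] at *; linarith)
    have hF2 : F Jm = F J := le_antisymm m2.1 (by have := m1.1; simp only [F, Jp, Jm] at *; linarith)
    have hΦ : ∑ w ∈ V, 2 * avg J w ^ 2 < ∑ w ∈ V, (avg Jp w ^ 2 + avg Jm w ^ 2) := by
      apply Finset.sum_lt_sum
      · intro w _
        rw [avp, avm]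
        nlinarith [sq_nonneg ((if w = v then (1 / m : ℝ) else 0) -
          (if w = u then (1 / m : ℝ) else 0))]
      · refine ⟨u, by exact_mod_cast (hJb i).subset hui, ?_⟩
        rw [avp, avm]
        have : (0 : ℝ) < 1 / m := by positivity
        simp only [huv, if_false, if_true]
        nlinarith [mul_pos this this]
    rw [← Finset.mul_sum, Finset.sum_add_distrib] at hΦ
    have h3 := m1.2 hF1
    have h4 := m2.2 hF2
    simp only [Φ] at h3 h4
    linarith
  let i₀ : Fin m := ⟨0, hm0⟩
  refine ⟨J i₀, (hJb i₀).indep, by exact_mod_cast (hJb i₀).subset, ?_⟩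
  refine (hB1.trans (hmax B hBT).1).trans (le_of_eq ?_)
  have hav : avg J = fun u => if u ∈ J i₀ then 1 else 0 := by
    funext w
    simp only [avg, hconst _ i₀]
    by_cases h : w ∈ J i₀ <;> simp [h, hm0.ne']
  simp only [F]
  rw [hav, expand_indicator]
  congr 1
  ext w; simp [hall w]

end Rounding

/-! ### Levels: telescoping sums, covering multiplicities, and nested bases. -/

section Levels

/-- Splitting the sum over `m + R` terms in two ways: either the first `m` or the first `R` terms
are separated. -/
lemma sum_range_shift_sub (h : ℕ → ℝ) (m R : ℕ) :
    ∑ r ∈ Finset.range R, (h (r + m) - h r) = ∑ j ∈ Finset.range m, (h (R + j) - h j) := by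
  rw [Finset.sum_sub_distrib, Finset.sum_sub_distrib]
  have h1 := Finset.sum_range_add h R m
  have h2 := Finset.sum_range_add h m R
  rw [add_comm m R] at h2
  simp only [add_comm m] at h2
  linarith

/-- Intervals that cover each point at most `k` times have total length at most `k * y` within
`[0, y]`. -/
lemma sum_clamp_le {N : Type*} (U : Finset N) (l g : N → ℝ) (k : ℕ) (y : ℝ) (hy : 0 ≤ y)
    (hl : ∀ u ∈ U, 0 ≤ l u)
    (hk : ∀ t, (U.filter fun u => l u < t ∧ t ≤ g u).card ≤ k) :
    ∑ u ∈ U, (max (l u) (min y (g u)) - l u) ≤ k * y := by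
  classical
  -- Lengths are integrals of indicators, and at each point of `(0, y]` at most `k` indicators are
  -- nonzero.
  have key : ∑ u ∈ U, MeasureTheory.volume (Set.Ioc (l u) (min y (g u))) ≤
      k * MeasureTheory.volume (Set.Ioc 0 y) := by
    calc ∑ u ∈ U, MeasureTheory.volume (Set.Ioc (l u) (min y (g u)))
        = ∑ u ∈ U, ∫⁻ t, (Set.Ioc (l u) (min y (g u))).indicator (fun _ => 1) t := by
          refine Finset.sum_congr rfl fun u _ => ?_
          rw [MeasureTheory.lintegral_indicator measurableSet_Ioc]; simp
      _ = ∫⁻ t, ∑ u ∈ U, (Set.Ioc (l u) (min y (g u))).indicator (fun _ => 1) t := by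
          rw [MeasureTheory.lintegral_finsetSum]
          exact fun u _ => measurable_const.indicator measurableSet_Ioc
      _ ≤ ∫⁻ t, (Set.Ioc 0 y).indicator (fun _ => (k : ENNReal)) t := by
          refine MeasureTheory.lintegral_mono fun t => ?_
          by_cases ht : t ∈ Set.Ioc 0 y
          · rw [Set.indicator_of_mem ht]
            calc _ ≤ ∑ u ∈ U, (if l u < t ∧ t ≤ g u then (1 : ENNReal) else 0) := by
                  refine Finset.sum_le_sum fun u _ => ?_
                  by_cases h : t ∈ Set.Ioc (l u) (min y (g u))
                  · rw [Set.indicator_of_mem h, if_pos ⟨h.1, h.2.trans (min_le_right _ _)⟩]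
                  · rw [Set.indicator_of_notMem h]; exact zero_le
              _ = ((U.filter fun u => l u < t ∧ t ≤ g u).card : ENNReal) := by
                  rw [Finset.sum_boole]
              _ ≤ k := by exact_mod_cast hk t
          · rw [Set.indicator_of_notMem ht]
            refine le_of_eq (Finset.sum_eq_zero fun u hu => Set.indicator_of_notMem ?_ _)
            exact fun h => ht ⟨(hl u hu).trans_lt h.1, h.2.trans (min_le_left _ _)⟩
      _ = _ := by
          rw [MeasureTheory.lintegral_indicator measurableSet_Ioc]; simp
  simp only [Real.volume_Ioc, sub_zero] at key
  rw [← ENNReal.ofReal_natCast, ← ENNReal.ofReal_mul (Nat.cast_nonneg k)] at key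
  have h2 : ∀ u ∈ U, ENNReal.ofReal (min y (g u) - l u) =
      ENNReal.ofReal (max (l u) (min y (g u)) - l u) := fun u _ => by
    rcases le_total (l u) (min y (g u)) with h | h
    · rw [max_eq_right h]
    · rw [max_eq_left h, sub_self, ENNReal.ofReal_zero, ENNReal.ofReal_eq_zero]; linarith
  rw [Finset.sum_congr rfl h2, ← ENNReal.ofReal_sum_of_nonneg
    (fun u _ => sub_nonneg.2 (le_max_left _ _)),
    ENNReal.ofReal_le_ofReal_iff (by positivity)] at key
  exact key

/-- The levels `y c, y c², …, y c^R` approximate an interval from inside. -/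
lemma sum_levels_eq {c y l g : ℝ} (hc : 1 < c) (z₀ : ℤ) (hy : y = c ^ z₀)
    (hg : g ≤ y ∨ ∃ z : ℤ, g = c ^ z) (hl : l ≤ y ∨ ∃ z : ℤ, l = c ^ z) (hlg : l ≤ g)
    {R : ℕ} (hR : g ≤ y * c ^ R) :
    ∑ n ∈ Finset.range R,
      (if l < y * c ^ (n + 1) ∧ y * c ^ (n + 1) ≤ g then y * c ^ (n + 1) - y * c ^ n else 0)
      = g - max l (min y g) := by
  have hc0 : 0 < c := by linarith
  have hypos : 0 < y := hy ▸ zpow_pos hc0 _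
  have hlev : ∀ n : ℕ, y * c ^ n = c ^ (z₀ + n) := fun n => by
    rw [zpow_add₀ hc0.ne', hy, zpow_natCast]
  have hle : ∀ n : ℕ, y ≤ y * c ^ n := fun n =>
    le_mul_of_one_le_right hypos.le (one_le_pow₀ hc.le)
  have hstep : ∀ n : ℕ, y * c ^ n ≤ y * c ^ (n + 1) := fun n => by
    have := pow_le_pow_right₀ hc.le (Nat.le_succ n)
    gcongr
  -- No endpoint lies strictly between consecutive levels, so each step of the level sum is either a
  -- full gap or zero, and the sum telescopes.
  have hpow : ∀ (a : ℝ) (n : ℕ), (a ≤ y ∨ ∃ z : ℤ, a = c ^ z) → a < y * c ^ (n + 1) →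
      a ≤ y * c ^ n := fun a n ha h => by
    rcases ha with ha | ⟨z, rfl⟩
    · exact ha.trans (hle n)
    · rw [hlev] at h ⊢
      have := (zpow_lt_zpow_iff_right₀ hc).1 h
      exact (zpow_le_zpow_iff_right₀ hc).2 (by push_cast at this; omega)
  have hterm : ∀ n ∈ Finset.range R,
      (if l < y * c ^ (n + 1) ∧ y * c ^ (n + 1) ≤ g then y * c ^ (n + 1) - y * c ^ n else 0)
      = max l (min (y * c ^ (n + 1)) g) - max l (min (y * c ^ n) g) := fun n _ => by
    by_cases h1 : l < y * c ^ (n + 1)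
    · by_cases h2 : y * c ^ (n + 1) ≤ g
      · have h3 := hpow l n hl h1
        rw [if_pos ⟨h1, h2⟩, min_eq_left h2, max_eq_right h1.le,
          min_eq_left ((hstep n).trans h2), max_eq_right h3]
      · rw [if_neg (fun h => h2 h.2), min_eq_right (not_le.1 h2).le,
          min_eq_right (hpow g n hg (not_le.1 h2)), sub_self]
    · rw [if_neg (fun h => h1 h.1)]
      have h3 := not_lt.1 h1
      rw [max_eq_left ((min_le_left _ _).trans h3),
        max_eq_left ((min_le_left _ _).trans ((hstep n).trans h3)), sub_self]
  rw [Finset.sum_congr rfl hterm,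
    Finset.sum_range_sub (fun n => max l (min (y * c ^ n) g))]
  rw [min_eq_right hR, max_eq_right hlg, pow_zero, mul_one]

variable {N : Type*} [DecidableEq N]

/-- Given independent sets with increasing spans, one may choose for each residue class modulo
`m` an increasing sequence of independent sets with the same spans. -/
lemma exists_layered_bases {M : Matroid N} (hE : M.E = Set.univ) (D : ℕ → Finset N) {m : ℕ}
    (hm : 0 < m) (R : ℕ) (hD : ∀ r < R, M.Indep (D r : Set N))
    (hmono : ∀ r r', r ≤ r' → r' < R → (D r : Set N) ⊆ M.closure (D r' : Set N)) :
    ∃ Q : ℕ → Finset N, (∀ r < m, Q r = ∅) ∧ (∀ r, M.Indep (Q r : Set N)) ∧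
      (∀ r, Q r ⊆ Q (r + m)) ∧ (∀ r, Q (r + m) ⊆ Q r ∪ D r) ∧
      ∀ r < R, (Q (r + m)).card = (D r).card := by
  have hext : ∀ (I X : Finset N), ∃ B : Finset N, M.Indep (I : Set N) →
      (I ⊆ B ∧ B ⊆ I ∪ X ∧ M.IsBasis (B : Set N) (I ∪ X : Finset N)) := fun I X => by
    by_cases hI : M.Indep (I : Set N)
    · obtain ⟨B, hB, hIB⟩ := hI.subset_isBasis_of_subset (X := ((I ∪ X : Finset N) : Set N))
        (by simp) (by rw [hE]; exact Set.subset_univ _)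
      have hfin : B.Finite := (I ∪ X).finite_toSet.subset hB.subset
      refine ⟨hfin.toFinset, fun _ => ⟨fun u hu => by simpa using hIB hu, fun u hu => ?_,
        by rwa [hfin.coe_toFinset]⟩⟩
      exact_mod_cast hB.subset (by simpa using hu)
    · exact ⟨∅, fun h => absurd h hI⟩
  choose ext hext using hext
  -- `P j q` is the set of residue class `j` after `q` extensions; `Q r` will be `P (r % m) (r /
  -- m)`, so that the step from `r` to `r + m` extends by elements of `D r`.
  obtain ⟨P, hP0, hPs⟩ : ∃ P : ℕ → ℕ → Finset N, (∀ j, P j 0 = ∅) ∧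
      ∀ j q, P j (q + 1) = ext (P j q) (D (q * m + j)) :=
    ⟨fun j q => Nat.rec (motive := fun _ => Finset N) ∅ (fun q' A => ext A (D (q' * m + j))) q,
      fun _ => rfl, fun _ _ => rfl⟩
  have hP : ∀ j q, M.Indep (P j q : Set N) := fun j q => by
    induction q with
    | zero => simp [hP0]
    | succ q ih => rw [hPs]; exact (hext _ (D (q * m + j)) ih).2.2.indep
  have hQ : ∀ r, P ((r + m) % m) ((r + m) / m) = ext (P (r % m) (r / m)) (D r) := fun r => by
    rw [Nat.add_mod_right, Nat.add_div_right r hm, hPs, Nat.div_add_mod']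
  refine ⟨fun r => P (r % m) (r / m), fun r hr => by simp [hP0, Nat.div_eq_of_lt hr],
    fun r => hP _ _, fun r => ?_, fun r => ?_, fun r => ?_⟩
  · simp only [hQ]; exact (hext _ _ (hP _ _)).1
  · simp only [hQ]; exact (hext _ _ (hP _ _)).2.1
  -- Inductively the old set has the span of `D (r - m)`, which lies in the span of `D r`; hence
  -- extending by `D r` yields exactly that span, and with it the same cardinality.
  have hcl : ∀ r < R, M.closure (P ((r + m) % m) ((r + m) / m) : Set N) =
      M.closure (D r : Set N) := by
    intro r
    induction r using Nat.strong_induction_on with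
    | _ r ih =>
      intro hr
      rw [hQ, (hext _ _ (hP _ _)).2.2.closure_eq_closure, Finset.coe_union]
      have hsub : (P (r % m) (r / m) : Set N) ⊆ M.closure (D r : Set N) := by
        rcases lt_or_ge r m with h | h
        · simp [hP0, Nat.div_eq_of_lt h]
        · obtain ⟨r', rfl⟩ := Nat.exists_eq_add_of_le' h
          have h1 := M.subset_closure (P ((r' + m) % m) ((r' + m) / m) : Set N)
            (by rw [hE]; exact Set.subset_univ _)
          rw [ih r' (by omega) (by omega)] at h1
          exact h1.trans (M.closure_subset_closure_of_subset_closure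
            (hmono r' (r' + m) (by omega) hr))
      apply subset_antisymm
      · refine M.closure_subset_closure_of_subset_closure (Set.union_subset hsub ?_)
        exact M.subset_closure _ (by rw [hE]; exact Set.subset_univ _)
      · exact M.closure_subset_closure Set.subset_union_right
  intro hr
  have h1 := (hP ((r + m) % m) ((r + m) / m)).eRk_eq_encard
  rw [← Matroid.eRk_closure_eq, hcl r hr, Matroid.eRk_closure_eq, (hD r hr).eRk_eq_encard] at h1
  simp only [Set.encard_coe_eq_coe_finsetCard] at h1
  exact_mod_cast h1.symm

end Levels

/-! ### The invariant of the algorithm, and the upper and lower bounds in terms of `G`. -/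

section Analysis

variable {N : Type*}

/-- The coordinate of `u` in the fractional solution. -/
noncomputable def weight (al : ℝ) (g l : N → ℝ) (u : N) : ℝ := (g u - l u) / (al * g u)

/-- The elements at level `t`. -/
def level (H : List N) (g l : N → ℝ) (t : ℝ) : Set N := {u | u ∈ H ∧ l u < t ∧ t ≤ g u}

lemma weight_mem {al : ℝ} (hal : 1 ≤ al) {g l : N → ℝ} {u : N} (h0 : 0 ≤ l u) (h1 : l u ≤ g u) :
    0 ≤ weight al g l u ∧ weight al g l u ≤ 1 := by
  unfold weight
  refine ⟨div_nonneg (by linarith) (mul_nonneg (by linarith) (h0.trans h1)), ?_⟩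
  apply div_le_one_of_le₀ _ (mul_nonneg (by linarith) (h0.trans h1))
  nlinarith [h0.trans h1]

lemma encard_le_of_subset_closure {M : Matroid N} {S A : Finset N} (hS : M.Indep (S : Set N))
    (h : (S : Set N) ⊆ M.closure A) : S.card ≤ A.card := by
  have h1 := hS.encard_le_eRk_of_subset h
  rw [Matroid.eRk_closure_eq] at h1
  have := h1.trans (M.eRk_le_encard _)
  simpa using this

lemma card_le_rank {M : Matroid N} {k : ℕ} (hk : M.eRank = k) {S : Finset N} (hS : M.Indep (S : Set N)) :
    S.card ≤ k := by
  have := hS.encard_le_eRank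
  rw [hk] at this
  simpa using this

variable [DecidableEq N]

/-- What the algorithm has achieved once the elements of `H` have arrived (the head of `H` is the
last one): `g u` is the rounded marginal of `u` at its arrival, and `u` is used at the levels
between `l u` and `g u`; `G` is the total length of these intervals, and levels below `θ` are
given up. -/
structure History (M : Matroid N) (f : Finset N → ℝ) (al c : ℝ) (H : List N) (g l : N → ℝ)
    (G θ : ℝ) : Prop where
  nodup : H.Nodup
  total : G = (H.map fun u => g u - l u).sum
  l_nonneg : ∀ u ∈ H, 0 ≤ l u
  l_le : ∀ u ∈ H, l u ≤ g u
  g_pow : ∀ u ∈ H, g u = 0 ∨ ∃ z : ℤ, g u = c ^ z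
  l_pow : ∀ u ∈ H, l u < g u → l u ≤ θ ∨ ∃ z : ℤ, l u = c ^ z
  gap : ∀ u ∈ H, l u < g u → c * l u ≤ g u
  upper : ∀ u H', (u :: H') <:+ H → marg (expand (weight al g l) H' f) u ∅ ≤ c * g u
  -- The threshold grows in the course of the stream, so the bound is kept for all later thresholds
  -- `ϑ`.
  lower : ∀ u H', (u :: H') <:+ H → l u < g u → ∀ ϑ, θ ≤ ϑ → ϑ < g u →
    g u ≤ marg (expand (weight al g l) (H'.filter fun v => l v < g v ∧ ϑ < g v) f) u ∅
  indep : ∀ t, M.Indep (level H g l t)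
  span : ∀ t, 0 < t → c * θ ≤ t → ∀ v ∈ H, t ≤ g v → v ∈ M.closure (level H g l t)

variable {M : Matroid N} {f : Finset N → ℝ} {al c : ℝ} {H : List N} {g l : N → ℝ} {G θ : ℝ}

namespace History

lemma weight_mem (h : History M f al c H g l G θ) (hal : 1 ≤ al) :
    ∀ u ∈ H, 0 ≤ weight al g l u ∧ weight al g l u ≤ 1 := fun u hu =>
  DataStream.weight_mem hal (h.l_nonneg u hu) (h.l_le u hu)

lemma total_eq (h : History M f al c H g l G θ) : G = ∑ u ∈ H.toFinset, (g u - l u) := by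
  rw [h.total, List.sum_toFinset _ h.nodup]

/-- Adding `S` to the random set gives `f S ≤ F(x) + ∑ marginals`. Since `x u * g u = (g u - l u) /
al`, the bounds at arrival sum to `f ∅ + c * G / al` for `F(x)`, and by submodularity they also
bound the marginals of `S` with respect to the final `x`. -/
lemma value_le (h : History M f al c H g l G θ) (hal : 1 ≤ al)
    (hm : MonotoneSet f) (hs : Submodular f) (hall : ∀ u, u ∈ H) (S : Finset N) :
    f S ≤ f ∅ + c / al * G + c * ∑ u ∈ S, g u := by
  have hw := h.weight_mem hal
  have hE := expand_mono_submod hm hs hw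
  have h1 := le_expand hm hs hw S
  have h2 := hE.2.le_add_sum_marg hE.1 S
  have h3 : expand (weight al g l) H f ∅ ≤ f ∅ + c / al * G := by
    have h4 := expand_le_add_sum (f := f) (b := fun u => c * g u)
      (fun u hu => (hw u hu).1) h.upper
    have h5 : (H.map fun u => weight al g l u * (c * g u)).sum = c / al * G := by
      rw [h.total, ← List.sum_map_mul_left]
      congr 1
      refine List.map_congr_left fun u hu => ?_
      unfold weight
      have hal0 : al ≠ 0 := by linarith
      by_cases hg : g u = 0
      · have : l u = 0 := le_antisymm (hg ▸ h.l_le u hu) (h.l_nonneg u hu)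
        simp [hg, this]
      · field_simp
    rwa [h5] at h4
  have h6 : ∑ u ∈ S, marg (expand (weight al g l) H f) u ∅ ≤ c * ∑ u ∈ S, g u := by
    rw [Finset.mul_sum]
    refine Finset.sum_le_sum fun u _ => ?_
    obtain ⟨A, B, hAB⟩ := List.append_of_mem (hall u)
    have hB : B ⊆ H := fun v hv => by rw [hAB]; simp [hv]
    have hBn : B.Nodup := ((hAB ▸ h.nodup).of_append_right).of_cons
    exact (marg_expand_subset hm hs hBn hB hw u ∅).trans (h.upper u B ⟨A, hAB.symm⟩)
  linarith

end History

namespace History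

lemma coe_levelFinset (t : ℝ) :
    ((H.toFinset.filter fun u => l u < t ∧ t ≤ g u : Finset N) : Set N) = level H g l t := by
  ext u; simp [level]

variable {y : ℝ} {R : ℕ}

/-- The total length of the intervals above `y`. -/
lemma sum_levels (h : History M f al c H g l G θ) (hc : 1 < c) {z₀ : ℤ} (hy : y = c ^ z₀)
    (hθ : θ ≤ y) (hR : ∀ u ∈ H, g u ≤ y * c ^ R) {u : N} (hu : u ∈ H) :
    ∑ n ∈ Finset.range R, (if l u < y * c ^ (n + 1) ∧ y * c ^ (n + 1) ≤ g u then
      y * c ^ (n + 1) - y * c ^ n else 0) = g u - max (l u) (min y (g u)) := by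
  have hypos : 0 < y := hy ▸ zpow_pos (by linarith) _
  have hg : g u ≤ y ∨ ∃ z : ℤ, g u = c ^ z :=
    (h.g_pow u hu).imp (fun h0 => by rw [h0]; exact hypos.le) id
  rcases (h.l_le u hu).lt_or_eq with hlt | heq
  · exact sum_levels_eq hc z₀ hy hg ((h.l_pow u hu hlt).imp (fun h0 => h0.trans hθ) id) hlt.le
      (hR u hu)
  · exact sum_levels_eq hc z₀ hy hg (heq ▸ hg) heq.le (hR u hu)

/-- Double counting: the length above `y`, level by level on one side and element by element on the
other. -/
lemma sum_card_levels (h : History M f al c H g l G θ) (hc : 1 < c) {z₀ : ℤ} (hy : y = c ^ z₀)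
    (hθ : θ ≤ y) (hR : ∀ u ∈ H, g u ≤ y * c ^ R) :
    ∑ n ∈ Finset.range R, (y * c ^ (n + 1) - y * c ^ n) *
      ((H.toFinset.filter fun u => l u < y * c ^ (n + 1) ∧ y * c ^ (n + 1) ≤ g u).card : ℝ)
      = ∑ u ∈ H.toFinset, (g u - max (l u) (min y (g u))) := by
  rw [← Finset.sum_congr rfl fun u hu =>
    h.sum_levels hc hy hθ hR (List.mem_toFinset.1 hu), Finset.sum_comm]
  refine Finset.sum_congr rfl fun n _ => ?_
  rw [← Finset.sum_boole, Finset.mul_sum]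
  exact Finset.sum_congr rfl fun u _ => by split_ifs <;> simp

lemma level_card_le (h : History M f al c H g l G θ) {k : ℕ} (hk : M.eRank = k) (t : ℝ) :
    (H.toFinset.filter fun u => l u < t ∧ t ≤ g u).card ≤ k :=
  card_le_rank hk (by rw [coe_levelFinset]; exact h.indep t)

/-- Each level set is independent, so the part of the intervals below `y` covers every point at most
`k` times. -/
lemma total_le (h : History M f al c H g l G θ) {k : ℕ} (hk : M.eRank = k) (hy : 0 ≤ y) :
    G ≤ ∑ u ∈ H.toFinset, (g u - max (l u) (min y (g u))) + k * y := by
  have := sum_clamp_le H.toFinset l g k y hy (fun u hu => h.l_nonneg u (List.mem_toFinset.1 hu))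
    (h.level_card_le hk)
  rw [h.total_eq]
  have h2 : ∑ u ∈ H.toFinset, (g u - l u) = ∑ u ∈ H.toFinset, (g u - max (l u) (min y (g u))) +
      ∑ u ∈ H.toFinset, (max (l u) (min y (g u)) - l u) := by
    rw [← Finset.sum_add_distrib]; exact Finset.sum_congr rfl fun u _ => by ring
  linarith

lemma clamped_le_total (h : History M f al c H g l G θ) :
    ∑ u ∈ H.toFinset, (g u - max (l u) (min y (g u))) ≤ G := by
  rw [h.total_eq]
  exact Finset.sum_le_sum fun u _ => by linarith [le_max_left (l u) (min y (g u))]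

/-- At a level `t` above `y`, the members of `S` with `g ≥ t` are independent and spanned by the
level set, hence not more numerous. Below `y` each of the at most `k` members contributes at most
`y`. -/
lemma sum_g_le (h : History M f al c H g l G θ) (hc : 1 < c) {z₀ : ℤ} (hy : y = c ^ z₀)
    (hθ : θ ≤ y) (hR : ∀ u ∈ H, g u ≤ y * c ^ R) {k : ℕ} (hk : M.eRank = k)
    (hall : ∀ u, u ∈ H) {S : Finset N} (hS : M.Indep (S : Set N)) :
    ∑ u ∈ S, g u ≤ k * y + ∑ u ∈ H.toFinset, (g u - max (l u) (min y (g u))) := by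
  have hypos : 0 < y := hy ▸ zpow_pos (by linarith) _
  rw [← h.sum_card_levels hc hy hθ hR]
  have h1 : ∀ u ∈ S, g u ≤ y + ∑ n ∈ Finset.range R, (if y * c ^ (n + 1) ≤ g u then
      y * c ^ (n + 1) - y * c ^ n else 0) := fun u _ => by
    have hg : g u ≤ y ∨ ∃ z : ℤ, g u = c ^ z :=
      (h.g_pow u (hall u)).imp (fun h0 => by rw [h0]; exact hypos.le) id
    have h2 := sum_levels_eq (l := 0) hc z₀ hy hg (Or.inl hypos.le)
      ((h.l_nonneg u (hall u)).trans (h.l_le u (hall u))) (hR u (hall u))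
    have h3 : ∀ n : ℕ, 0 < y * c ^ (n + 1) := fun n => by positivity
    simp only [h3, true_and] at h2
    rw [h2]
    have : max 0 (min y (g u)) ≤ y := max_le hypos.le (min_le_left _ _)
    linarith
  refine (Finset.sum_le_sum h1).trans ?_
  rw [Finset.sum_add_distrib, Finset.sum_const, nsmul_eq_mul, Finset.sum_comm]
  have h4 : (S.card : ℝ) ≤ k := by exact_mod_cast card_le_rank hk hS
  gcongr with n hn
  rw [← Finset.sum_filter, Finset.sum_const, nsmul_eq_mul, mul_comm]
  have hstep : y * c ^ n ≤ y * c ^ (n + 1) := by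
    gcongr
    · exact hc.le
    · exact Nat.le_succ n
  refine mul_le_mul_of_nonneg_left ?_ (by linarith)
  norm_cast
  apply encard_le_of_subset_closure (M := M)
  · exact hS.subset (Finset.coe_subset.2 (Finset.filter_subset _ _))
  · intro u hu
    rw [coe_levelFinset]
    refine h.span _ (by positivity) ?_ u (hall u) (by simpa using (Finset.mem_filter.1 hu).2)
    calc c * θ ≤ c * y := by gcongr
      _ = y * c ^ 1 := by ring
      _ ≤ y * c ^ (n + 1) := by
        gcongr
        · exact hc.le
        · omega

set_option maxHeartbeats 1000000 in
/-- Some independent set of elements above `θ` has a large value. -/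
lemma exists_indep_ge (h : History M f al c H g l G θ) (hE : M.E = Set.univ) (hal : 1 ≤ al)
    (hc : 1 < c) {m : ℕ} (hm0 : 0 < m) (hcm : c * (m - al) = m)
    (hm : MonotoneSet f) (hs : Submodular f) {z₀ : ℤ} (hy : y = c ^ z₀) (hθ : θ ≤ y)
    (hR : ∀ u ∈ H, g u ≤ y * c ^ R) (hall : ∀ u, u ∈ H) :
    ∃ B : Finset N, M.Indep (B : Set N) ∧ (∀ u ∈ B, l u < g u ∧ θ < g u) ∧
      f ∅ + (1 - (c ^ m)⁻¹) / al * ∑ u ∈ H.toFinset, (g u - max (l u) (min y (g u))) ≤ f B := by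
  have hc0 : 0 < c := by linarith
  have hal0 : 0 < al := by linarith
  have hypos : 0 < y := hy ▸ zpow_pos hc0 _
  have hmpos : (0 : ℝ) < m := by exact_mod_cast hm0
  let lev : ℕ → ℝ := fun n => y * c ^ n
  have hylev : ∀ n, y ≤ lev n := fun n => le_mul_of_one_le_right hypos.le (one_le_pow₀ hc.le)
  have hlevmono : ∀ {a b : ℕ}, a ≤ b → lev a ≤ lev b := fun hab => by
    simp only [lev]; gcongr; exact hc.le
  have hcy : ∀ n, c * θ ≤ lev (n + 1) := fun n => by
    calc c * θ ≤ c * y := by gcongr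
      _ = lev 1 := by simp only [lev]; ring
      _ ≤ lev (n + 1) := hlevmono (by omega)
  have hθlev : ∀ n, θ < lev (n + 1) := fun n => by
    have : y < c * y := by nlinarith
    calc θ ≤ y := hθ
      _ < c * y := this
      _ = lev 1 := by simp only [lev]; ring
      _ ≤ lev (n + 1) := hlevmono (by omega)
  let A : ℝ → Finset N := fun t => H.toFinset.filter fun u => l u < t ∧ t ≤ g u
  have hA : ∀ t, (A t : Set N) = level H g l t := fun t => coe_levelFinset t
  have memA : ∀ t u, u ∈ A t ↔ l u < t ∧ t ≤ g u := fun t u => by simp [A, hall u]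
  -- Levels are counted from the top, so that the spans increase with `r`.
  let D : ℕ → Finset N := fun r => if r < R then A (lev (R - 1 - r + 1)) else ∅
  obtain ⟨Q, hQ0, hQI, hQmono, hQsub, hQcard⟩ := exists_layered_bases hE D hm0 R
    (fun r hr => by simp only [D, hr, if_true, hA]; exact h.indep _)
    (fun r r' hrr hr' => by
      have hr : r < R := by omega
      simp only [D, hr, hr', if_true, hA]
      intro u hu
      refine h.span _ (hypos.trans_le (hylev _)) (hcy _) u hu.1
        (le_trans (hlevmono (by omega)) hu.2.2))
  have hDmem : ∀ r u, u ∈ D r → r < R ∧ l u < lev (R - 1 - r + 1) ∧ lev (R - 1 - r + 1) ≤ g u := by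
    intro r u hu
    by_cases hr : r < R
    · simp only [D, hr, if_true, memA] at hu; exact ⟨hr, hu⟩
    · simp [D, hr] at hu
  let V : Finset N := H.toFinset.filter fun u => l u < g u ∧ θ < g u
  have memV : ∀ u, u ∈ V ↔ l u < g u ∧ θ < g u := fun u => by simp [V, hall u]
  have hDV : ∀ r, D r ⊆ V := fun r u hu => by
    obtain ⟨_, h1, h2⟩ := hDmem r u hu
    exact (memV u).2 ⟨h1.trans_le h2, (hθlev _).trans_le h2⟩
  have hQV : ∀ r, Q r ⊆ V := by
    intro r
    induction r using Nat.strong_induction_on with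
    | _ r ih =>
      rcases lt_or_ge r m with hr | hr
      · simp [hQ0 r hr]
      · obtain ⟨r', rfl⟩ := Nat.exists_eq_add_of_le' hr
        exact (hQsub r').trans (Finset.union_subset (ih r' (by omega)) (hDV r'))
  let P : ℕ → Finset N := fun r => Q (r + m) \ Q r
  have hPD : ∀ r, P r ⊆ D r := fun r u hu => by
    obtain ⟨h1, h2⟩ := Finset.mem_sdiff.1 hu
    exact (Finset.mem_union.1 (hQsub r h1)).resolve_left h2
  -- The final set of each residue class; `u` belongs to as many of them as there are `r` with `u ∈
  -- P r`.
  let J : Fin m → Finset N := fun j => Q (R + j)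
  obtain ⟨B, hB, hBV, hBf⟩ := exists_indep_ge_expand_avg hE hm hs h.nodup hall hm0 J V
    (fun j => hQI _) (fun j => hQV _)
  refine ⟨B, hB, fun u hu => (memV u).1 (hBV hu), le_trans ?_ hBf⟩
  have hind : ∀ r u, (if u ∈ P r then (1 : ℝ) else 0) =
      (if u ∈ Q (r + m) then 1 else 0) - (if u ∈ Q r then 1 else 0) := fun r u => by
    by_cases h1 : u ∈ Q r
    · simp [P, h1, hQmono r h1]
    · simp [P, h1]
  have havg : ∀ u, avg J u = (∑ r ∈ Finset.range R, if u ∈ P r then (1 : ℝ) else 0) / m := by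
    intro u
    unfold avg
    congr 1
    rw [Finset.sum_congr rfl fun r _ => hind r u,
      sum_range_shift_sub (fun r => if u ∈ Q r then (1 : ℝ) else 0),
      ← Fin.sum_univ_eq_sum_range
        (fun j => (if u ∈ Q (R + j) then (1 : ℝ) else 0) - if u ∈ Q j then 1 else 0)]
    refine Finset.sum_congr rfl fun j _ => ?_
    simp [J, hQ0 j j.2]
  let w : ℕ → ℝ := fun r => y * c ^ R / c ^ r / m
  have hw0 : ∀ r, 0 ≤ w r := fun r => by positivity
  have hwlev : ∀ r < R, w r = lev (R - 1 - r + 1) / m := fun r hr => by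
    have : R = (R - 1 - r + 1) + r := by omega
    simp only [w, lev]
    rw [eq_div_iff hmpos.ne', div_mul_cancel₀ _ hmpos.ne', div_eq_iff (by positivity), mul_assoc,
      ← pow_add, ← this]
  -- The reason for `c = m / (m - al)`: written as `lev / m`, the weight `w r` is compared with the
  -- average of the `J j`; written as a gap over `al`, it is compared with `weight`.
  have hwstep : ∀ n, lev (n + 1) / m = (lev (n + 1) - lev n) / al := fun n => by
    rw [div_eq_div_iff hmpos.ne' hal0.ne']
    simp only [lev, pow_succ]
    linear_combination (-(y * c ^ n)) * hcm
  let x : N → ℝ := fun u => (∑ r ∈ Finset.range R, if u ∈ P r then w r else 0) / g u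
  have hg0 : ∀ u, 0 ≤ g u := fun u => (h.l_nonneg u (hall u)).trans (h.l_le u (hall u))
  have hsum0 : ∀ u, 0 ≤ ∑ r ∈ Finset.range R, if u ∈ P r then w r else 0 := fun u =>
    Finset.sum_nonneg fun r _ => by split_ifs; exacts [hw0 r, le_rfl]
  have hx0 : ∀ u, 0 ≤ x u := fun u => div_nonneg (hsum0 u) (hg0 u)
  have hxV : ∀ u, u ∉ V → x u = 0 := fun u hu => by
    have : ∀ r ∈ Finset.range R, (if u ∈ P r then w r else 0) = 0 := fun r _ =>
      if_neg fun h' => hu (hDV r (hPD r h'))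
    simp only [x]
    rw [Finset.sum_eq_zero this, zero_div]
  have hxavg : ∀ u, x u ≤ avg J u := fun u => by
    by_cases hu : u ∈ V
    · have hgu : 0 < g u := (h.l_nonneg u (hall u)).trans_lt ((memV u).1 hu).1
      rw [havg]
      simp only [x]
      rw [div_le_iff₀ hgu, div_mul_eq_mul_div, Finset.sum_mul, Finset.sum_div]
      refine Finset.sum_le_sum fun r hr => ?_
      by_cases hP : u ∈ P r
      · rw [if_pos hP, if_pos hP, hwlev r (Finset.mem_range.1 hr), one_mul]
        have := (hDmem r u (hPD r hP)).2.2
        gcongr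
      · simp [hP]
    · rw [hxV u hu]; exact (avg_mem J u).1
  have hxw : ∀ u, x u ≤ if l u < g u ∧ θ < g u then weight al g l u else 0 := fun u => by
    by_cases hu : u ∈ V
    · rw [if_pos ((memV u).1 hu)]
      have hgu : 0 < g u := (h.l_nonneg u (hall u)).trans_lt ((memV u).1 hu).1
      simp only [x, weight]
      rw [← div_div]
      refine div_le_div_of_nonneg_right ?_ hgu.le
      calc (∑ r ∈ Finset.range R, if u ∈ P r then w r else 0)
          ≤ ∑ r ∈ Finset.range R, (if l u < lev (R - 1 - r + 1) ∧ lev (R - 1 - r + 1) ≤ g u then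
              lev (R - 1 - r + 1) - lev (R - 1 - r) else 0) / al := by
            refine Finset.sum_le_sum fun r hr => ?_
            by_cases hP : u ∈ P r
            · rw [if_pos hP, if_pos (hDmem r u (hPD r hP)).2, hwlev r (Finset.mem_range.1 hr),
                hwstep]
            · rw [if_neg hP]
              split_ifs
              · exact div_nonneg (sub_nonneg.2 (hlevmono (by omega))) hal0.le
              · simp
        _ = (∑ n ∈ Finset.range R, if l u < lev (n + 1) ∧ lev (n + 1) ≤ g u then
              lev (n + 1) - lev n else 0) / al := by
            rw [← Finset.sum_div, Finset.sum_range_reflect (fun n =>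
              if l u < lev (n + 1) ∧ lev (n + 1) ≤ g u then lev (n + 1) - lev n else 0)]
        _ ≤ (g u - l u) / al := by
            refine div_le_div_of_nonneg_right ?_ hal0.le
            simp only [lev]
            rw [h.sum_levels hc hy hθ hR (hall u)]
            linarith [le_max_left (l u) (min y (g u))]
    · rw [hxV u hu, if_neg fun h' => hu ((memV u).2 h')]
  have hmono1 : expand x H f ∅ ≤ expand (avg J) H f ∅ :=
    expand_mono hm hs (fun u _ => ⟨hx0 u, hxavg u, (avg_mem J u).2⟩) ∅
  -- On its support, `x` is below the part of the fractional solution above the final threshold, to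
  -- which the invariant `lower` refers; smaller coordinates only raise marginals.
  have hlow := le_expand_of_sum (f := f) (x := x) (b := g) (L := H) (fun u _ => hx0 u)
    (fun u H' hH' hxu => by
      have hu : u ∈ V := by by_contra hu; exact hxu (hxV u hu)
      refine (h.lower u H' hH' ((memV u).1 hu).1 θ le_rfl ((memV u).1 hu).2).trans ?_
      rw [← expand_filter]
      refine marg_expand_anti hm hs (fun v _ => ⟨hx0 v, hxw v, ?_⟩) u ∅
      split_ifs
      · exact (h.weight_mem hal v (hall v)).2
      · exact zero_le_one)
  refine le_trans ?_ (hlow.trans hmono1)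
  have hval : (H.map fun u => x u * g u).sum = ∑ r ∈ Finset.range R, w r * ((P r).card : ℝ) := by
    rw [← List.sum_toFinset _ h.nodup]
    calc ∑ u ∈ H.toFinset, x u * g u
        = ∑ u ∈ H.toFinset, ∑ r ∈ Finset.range R, if u ∈ P r then w r else 0 := by
          refine Finset.sum_congr rfl fun u _ => ?_
          by_cases hu : u ∈ V
          · have hgu : 0 < g u := (h.l_nonneg u (hall u)).trans_lt ((memV u).1 hu).1
            simp only [x]
            rw [div_mul_cancel₀ _ hgu.ne']
          · rw [hxV u hu, zero_mul]
            exact (Finset.sum_eq_zero fun r _ =>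
              if_neg fun h' => hu (hDV r (hPD r h'))).symm
      _ = _ := by
          rw [Finset.sum_comm]
          refine Finset.sum_congr rfl fun r _ => ?_
          rw [← Finset.sum_filter, Finset.sum_const, nsmul_eq_mul, mul_comm]
          congr 3
          ext u; simp [hall u]
  rw [hval]
  have hcardP : ∀ r, ((P r).card : ℝ) = (Q (r + m)).card - (Q r).card := fun r => by
    rw [Finset.cast_card_sdiff (hQmono r)]
  have hD : ∑ r ∈ Finset.range R, w r * ((D r).card : ℝ) =
      1 / al * ∑ u ∈ H.toFinset, (g u - max (l u) (min y (g u))) := by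
    rw [← h.sum_card_levels hc hy hθ hR, Finset.mul_sum, ← Finset.sum_range_reflect]
    refine Finset.sum_congr rfl fun r hr => ?_
    have hr := Finset.mem_range.1 hr
    rw [hwlev _ (by omega)]
    have e : R - 1 - (R - 1 - r) = r := by omega
    have e2 : R - 1 - r < R := by omega
    rw [e, hwstep]
    simp only [D, e2, if_true, e]
    simp only [A, lev]
    ring
  -- Shift the index by `m`: `Q (r + m)` has the size of `D r`, the weight drops by the factor `c ^
  -- m`, and the first `m` sets are empty. This is the loss due to elements inherited from `m` steps
  -- before.
  have hQ : ∑ r ∈ Finset.range R, w r * ((Q r).card : ℝ) ≤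
      (c ^ m)⁻¹ * ∑ r ∈ Finset.range R, w r * ((D r).card : ℝ) := by
    calc ∑ r ∈ Finset.range R, w r * ((Q r).card : ℝ)
        ≤ ∑ r ∈ Finset.range (m + R), w r * ((Q r).card : ℝ) :=
          Finset.sum_le_sum_of_subset_of_nonneg (Finset.range_mono (by omega))
            fun r _ _ => mul_nonneg (hw0 r) (Nat.cast_nonneg _)
      _ = ∑ r ∈ Finset.range R, w (m + r) * ((Q (m + r)).card : ℝ) := by
          have h0 : ∑ r ∈ Finset.range m, w r * ((Q r).card : ℝ) = 0 :=
            Finset.sum_eq_zero fun r hr => by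
              rw [hQ0 r (Finset.mem_range.1 hr), Finset.card_empty, Nat.cast_zero, mul_zero]
          rw [Finset.sum_range_add, h0, zero_add]
      _ = _ := by
          rw [Finset.mul_sum]
          refine Finset.sum_congr rfl fun r hr => ?_
          rw [add_comm m r, hQcard r (Finset.mem_range.1 hr)]
          have hw : w (r + m) = (c ^ m)⁻¹ * w r := by
            simp only [w, pow_add]
            field_simp
          rw [hw, mul_assoc]
  have hQD : ∑ r ∈ Finset.range R, w r * ((Q (r + m)).card : ℝ) =
      ∑ r ∈ Finset.range R, w r * ((D r).card : ℝ) :=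
    Finset.sum_congr rfl fun r hr => by rw [hQcard r (Finset.mem_range.1 hr)]
  have hfin : ∑ r ∈ Finset.range R, w r * ((P r).card : ℝ) =
      ∑ r ∈ Finset.range R, w r * ((Q (r + m)).card : ℝ) -
        ∑ r ∈ Finset.range R, w r * ((Q r).card : ℝ) := by
    rw [← Finset.sum_sub_distrib]
    exact Finset.sum_congr rfl fun r _ => by rw [hcardP]; ring
  rw [hfin, hQD]
  rw [hD] at hQ ⊢
  have : (1 - (c ^ m)⁻¹) / al * ∑ u ∈ H.toFinset, (g u - max (l u) (min y (g u))) =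
      1 / al * ∑ u ∈ H.toFinset, (g u - max (l u) (min y (g u))) -
      (c ^ m)⁻¹ * (1 / al * ∑ u ∈ H.toFinset, (g u - max (l u) (min y (g u)))) := by ring
  linarith

end History

end Analysis

/-! ### The approximation guarantee implied by the invariant. -/

section Approximation

variable {N : Type*} [DecidableEq N]
variable {M : Matroid N} {f : Finset N → ℝ} {al c : ℝ} {H : List N} {g l : N → ℝ} {G θ : ℝ}

namespace History

lemma total_nonneg (h : History M f al c H g l G θ) : 0 ≤ G := by
  rw [h.total_eq]
  exact Finset.sum_nonneg fun u hu => sub_nonneg.2 (h.l_le u (List.mem_toFinset.1 hu))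

/-- If all intervals are empty, so are all levels; an element with `g u > 0` is then spanned by `∅`,
so it is a loop and cannot be in `S`. -/
lemma value_le_of_total_eq_zero (h : History M f al c H g l G θ)
    (hal : 1 ≤ al) (hm : MonotoneSet f) (hs : Submodular f) (hall : ∀ u, u ∈ H) (hG : G = 0)
    (hθ : θ = 0) {S : Finset N} (hS : M.Indep (S : Set N)) : f S ≤ f ∅ := by
  have h1 := h.value_le hal hm hs hall S
  have hlg : ∀ u, l u = g u := fun u => by
    have h2 := h.total_eq
    rw [hG] at h2
    have := (Finset.sum_eq_zero_iff_of_nonneg fun u hu =>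
      sub_nonneg.2 (h.l_le u (List.mem_toFinset.1 hu))).1 h2.symm u (by simpa using hall u)
    linarith
  have h3 : ∀ u ∈ S, g u = 0 := fun u hu => by
    by_contra hne
    have hpos : 0 < g u :=
      lt_of_le_of_ne ((h.l_nonneg u (hall u)).trans (h.l_le u (hall u))) (Ne.symm hne)
    have h4 := h.span (g u) hpos (by rw [hθ]; simpa using hpos.le) u (hall u) le_rfl
    have h5 : level H g l (g u) = ∅ := by
      ext v
      simp only [level, hlg, Set.mem_ofPred_eq, Set.mem_empty_iff_false, iff_false]
      exact fun h => absurd h.2.2 (not_le.2 h.2.1)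
    rw [h5] at h4
    have h6 : M.Indep {u} := hS.subset (by simpa using hu)
    have h7 := h6.notMem_closure_sdiff_of_mem rfl
    simp only [sdiff_self, Set.bot_eq_empty] at h7
    exact h7 h4
  rw [Finset.sum_eq_zero h3, hG] at h1
  simpa using h1

lemma exists_levels_bound (h : History M f al c H g l G θ) (hc : 1 < c) {y : ℝ} (hy : 0 < y) :
    ∃ R : ℕ, ∀ u ∈ H, g u ≤ y * c ^ R := by
  obtain ⟨R, hR⟩ := pow_unbounded_of_one_lt ((∑ u ∈ H.toFinset, g u) / y) hc
  refine ⟨R, fun u hu => ?_⟩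
  rw [div_lt_iff₀ hy] at hR
  have := Finset.single_le_sum (f := g) (fun v hv =>
    (h.l_nonneg v (List.mem_toFinset.1 hv)).trans (h.l_le v (List.mem_toFinset.1 hv)))
    (List.mem_toFinset.2 hu)
  linarith

/-- The approximation guarantee. -/
lemma exists_approx (h : History M f al c H g l G θ) (hE : M.E = Set.univ) (hal : 1 ≤ al)
    (hc : 1 < c) {m : ℕ} (hm0 : 0 < m) (hcm : c * (m - al) = m) {k : ℕ} (hk : M.eRank = k)
    (hθ : θ = G / (al * m * k)) (h0 : ∀ S, 0 ≤ f S)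
    (hm : MonotoneSet f) (hs : Submodular f) (hall : ∀ u, u ∈ H) {ρ : ℝ} (hρ0 : 0 ≤ ρ)
    (hρ1 : ρ ≤ 1)
    (hρ : ρ * (c / al + c + c ^ 2 / (al * m)) ≤
      (1 - (c ^ m)⁻¹) / al * (1 - c / (al * m))) :
    ∃ B : Finset N, M.Indep (B : Set N) ∧ (∀ u ∈ B, l u < g u ∧ θ < g u) ∧
      ∀ S : Finset N, M.Indep (S : Set N) → ρ * f S ≤ f B := by
  have hmpos : (0 : ℝ) < m := by exact_mod_cast hm0
  have hal0 : 0 < al := by linarith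
  have hc0 : 0 < c := by linarith
  rcases h.total_nonneg.eq_or_lt with hG | hG
  · refine ⟨∅, by simp, by simp, fun S hS => ?_⟩
    have := h.value_le_of_total_eq_zero hal hm hs hall hG.symm (by rw [hθ, ← hG, zero_div]) hS
    nlinarith [h0 S, h0 ∅]
  have hk0 : 0 < k := by
    rcases Nat.eq_zero_or_pos k with rfl | hk0
    · exfalso
      refine hG.ne' ?_
      rw [h.total_eq]
      refine Finset.sum_eq_zero fun u hu => ?_
      have h1 := h.level_card_le hk (g u)
      rw [Nat.le_zero, Finset.card_eq_zero, Finset.filter_eq_empty_iff] at h1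
      have h2 := h1 hu
      have h3 := h.l_le u (List.mem_toFinset.1 hu)
      have h4 : ¬ l u < g u := fun h' => h2 ⟨h', le_rfl⟩
      linarith
    · exact hk0
  have hkpos : (0 : ℝ) < k := by exact_mod_cast hk0
  have hθpos : 0 < θ := by rw [hθ]; positivity
  -- The cut-off `y` is the least power of `c` with `θ ≤ y`. As `y ≤ c * θ`, the amount `k * y` lost
  -- below it is at most `c / (al * m) * G`.
  obtain ⟨z, hz1, hz2⟩ := exists_mem_Ioc_zpow hθpos hc
  obtain ⟨y, hy⟩ : ∃ y, y = c ^ (z + 1) := ⟨_, rfl⟩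
  have hyθ : y ≤ c * θ := by
    rw [hy, zpow_add_one₀ hc0.ne', mul_comm]; gcongr
  rw [← hy] at hz2
  have hypos := hθpos.trans_le hz2
  obtain ⟨R, hR⟩ := h.exists_levels_bound hc hypos
  obtain ⟨B, hB, hBV, hBf⟩ := h.exists_indep_ge hE hal hc hm0 hcm hm hs hy hz2 hR hall
  refine ⟨B, hB, hBV, fun S hS => ?_⟩
  have h1 := h.value_le hal hm hs hall S
  have h2 := h.sum_g_le hc hy hz2 hR hk hall hS
  have h3 := h.clamped_le_total (y := y)
  have h4 := h.total_le hk hypos.le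
  set Gi := ∑ u ∈ H.toFinset, (g u - max (l u) (min y (g u)))
  have h5 : k * y ≤ c / (al * m) * G := by
    calc k * y ≤ k * (c * θ) := by gcongr
      _ = c / (al * m) * G := by rw [hθ]; field_simp
  have hcm1 : 0 ≤ (1 - (c ^ m)⁻¹) / al :=
    div_nonneg (sub_nonneg.2 (inv_le_one_of_one_le₀ (one_le_pow₀ hc.le))) hal0.le
  have h6 : f S ≤ f ∅ + (c / al + c + c ^ 2 / (al * m)) * G := by
    have : c * ∑ u ∈ S, g u ≤ c * (c / (al * m) * G + G) := by gcongr; linarith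
    calc f S ≤ f ∅ + c / al * G + c * (c / (al * m) * G + G) := by linarith
      _ = _ := by ring
  calc ρ * f S ≤ ρ * (f ∅ + (c / al + c + c ^ 2 / (al * m)) * G) := by gcongr
    _ = ρ * f ∅ + ρ * (c / al + c + c ^ 2 / (al * m)) * G := by ring
    _ ≤ 1 * f ∅ + (1 - (c ^ m)⁻¹) / al * (1 - c / (al * m)) * G := by
      have := h0 ∅
      gcongr
    _ = f ∅ + (1 - (c ^ m)⁻¹) / al * (G - c / (al * m) * G) := by ring
    _ ≤ f ∅ + (1 - (c ^ m)⁻¹) / al * Gi := by gcongr; linarith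
    _ ≤ f B := hBf

end History

end Approximation

/-! ### The number `α` and the choice of `al` and `m`. -/

section Constants

open Filter Topology

/-- The lower bound allows rational approximations `al ≥ 1`, which keep the coordinates at most `1`;
the upper bound is fine enough for `0.3178 < 1 / (α + 2)`. -/
lemma exists_root : ∃ α : ℝ, 1 < α ∧ α < 1.1466 ∧ Real.exp α = α + 2 := by
  have hcont : ContinuousOn (fun x : ℝ => Real.exp x - (x + 2)) (Set.Icc 1 1.1466) := by fun_prop
  have h1 : Real.exp 1 - (1 + 2) < 0 := by have := Real.exp_one_lt_d9; linarith
  have h2 : 0 < Real.exp 1.1466 - (1.1466 + 2) := by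
    have e : Real.exp 1.1466 = Real.exp 1 * Real.exp 0.1466 := by
      rw [← Real.exp_add]; norm_num
    have h3 := Real.exp_one_gt_d9
    have h5 : (0.1466 : ℝ) ^ 3 / 6 + (1 + 0.1466 + 0.1466 ^ 2 / 2) ≤ Real.exp 0.1466 := by
      have := Real.sum_le_exp_of_nonneg (x := 0.1466) (by norm_num) 4
      norm_num [Finset.sum_range_succ, Nat.factorial] at this ⊢
      linarith
    rw [e]
    norm_num at h5 ⊢
    nlinarith
  obtain ⟨α, hα, h⟩ := intermediate_value_Ioo (by norm_num) hcont ⟨h1, h2⟩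
  exact ⟨α, hα.1, hα.2, by simpa [sub_eq_zero] using h⟩

/-- For roots `0 < a < b` the tangent bound `exp b ≥ exp a * (b - a + 1)` becomes `(a + 2) * (b - a)
≤ b - a`, which is absurd. -/
lemma root_unique {α β : ℝ} (hα : 0 < α) (hβ : 0 < β) (h1 : Real.exp α = α + 2)
    (h2 : Real.exp β = β + 2) : β = α := by
  have key : ∀ {a b : ℝ}, 0 < a → a < b → Real.exp a = a + 2 → Real.exp b = b + 2 → False := by
    intro a b ha hab e1 e2
    have h := Real.add_one_le_exp (b - a)
    have e : Real.exp b = Real.exp a * Real.exp (b - a) := by rw [← Real.exp_add]; ring_nf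
    have := Real.exp_pos a
    have h3 : Real.exp a * (b - a + 1) ≤ Real.exp b := by rw [e]; gcongr
    rw [e1, e2] at h3
    nlinarith
  rcases lt_trichotomy α β with h | h | h
  · exact (key hα h h1 h2).elim
  · exact h.symm
  · exact (key hβ h h2 h1).elim

/-- The parameters of the algorithm. -/
lemma exists_parameters {α ρ : ℝ} (hα : 1 < α) (he : Real.exp α = α + 2)
    (hρ : ρ < 1 / (α + 2)) :
    ∃ (al : ℚ) (m : ℕ), (1 : ℝ) ≤ al ∧ (al : ℝ) < m ∧ ∀ c : ℝ, c = m / (m - al) →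
      ρ * (c / al + c + c ^ 2 / (al * m)) ≤ (1 - (c ^ m)⁻¹) / al * (1 - c / (al * m)) := by
  -- The right-hand side is the limiting ratio for `al = α`; continuity then permits a rational `al`
  -- nearby.
  have hval : 1 / (α + 2) = (1 - Real.exp (-α)) / (1 + α) := by
    rw [Real.exp_neg, he]; field_simp; ring
  have hcont : ContinuousAt (fun a : ℝ => (1 - Real.exp (-a)) / (1 + a)) α :=
    ContinuousAt.div (by fun_prop) (by fun_prop) (by linarith)
  have hev : ∀ᶠ a in 𝓝 α, ρ < (1 - Real.exp (-a)) / (1 + a) ∧ 1 < a :=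
    (hcont.eventually (lt_mem_nhds (by rw [hval] at hρ; exact hρ))).and (lt_mem_nhds hα)
  obtain ⟨al, hal⟩ : ∃ al : ℚ, ρ < (1 - Real.exp (-(al : ℝ))) / (1 + al) ∧ 1 < (al : ℝ) := by
    obtain ⟨s, hs, hso, hαs⟩ := eventually_nhds_iff.1 hev
    obtain ⟨al, hal⟩ := Rat.denseRange_cast.exists_mem_open hso ⟨α, hαs⟩
    exact ⟨al, hs _ hal⟩
  have hal0 : (0 : ℝ) < al := by linarith [hal.2]
  have hinv : Tendsto (fun m : ℕ => ((m : ℝ))⁻¹) atTop (𝓝 0) := tendsto_inv_atTop_nhds_zero_nat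
  -- For fixed `al` and `m → ∞` the rounding errors vanish, and the two sides tend to `ρ * (1 / al +
  -- 1)` and `(1 - exp (-al)) / al`.
  have hc : Tendsto (fun m : ℕ => (m : ℝ) / (m - al)) atTop (𝓝 1) := by
    have h1 : Tendsto (fun m : ℕ => (1 - (al : ℝ) * (m : ℝ)⁻¹)⁻¹) atTop (𝓝 1) := by
      have := ((tendsto_const_nhds (x := (1 : ℝ))).sub (hinv.const_mul (al : ℝ))).inv₀
        (by norm_num)
      simpa using this
    refine h1.congr' ?_
    filter_upwards [eventually_gt_atTop 0] with m hm
    have : (m : ℝ) ≠ 0 := by positivity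
    rw [show (1 - (al : ℝ) * (m : ℝ)⁻¹) = (m - al) / m by field_simp, inv_div]
  have hL : Tendsto (fun m : ℕ => ρ * ((m : ℝ) / (m - al) / al + (m : ℝ) / (m - al) +
      ((m : ℝ) / (m - al)) ^ 2 * (al : ℝ)⁻¹ * (m : ℝ)⁻¹)) atTop
      (𝓝 (ρ * (1 / al + 1 + 1 ^ 2 * (al : ℝ)⁻¹ * 0))) :=
    (((hc.div_const _).add hc).add (((hc.pow 2).mul_const _).mul hinv)).const_mul _
  have hR : Tendsto (fun m : ℕ => (1 - Real.exp (-al)) / al *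
      (1 - (m : ℝ) / (m - al) * (al : ℝ)⁻¹ * (m : ℝ)⁻¹)) atTop
      (𝓝 ((1 - Real.exp (-al)) / al * (1 - 1 * (al : ℝ)⁻¹ * 0))) :=
    (((hc.mul_const _).mul hinv).const_sub _).const_mul _
  have hlt : ρ * (1 / al + 1 + 1 ^ 2 * (al : ℝ)⁻¹ * 0) <
      (1 - Real.exp (-al)) / al * (1 - 1 * (al : ℝ)⁻¹ * 0) := by
    have h1 := hal.1
    rw [lt_div_iff₀ (by linarith)] at h1
    simp only [mul_zero, add_zero, sub_zero, mul_one]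
    rw [lt_div_iff₀ hal0]
    calc ρ * (1 / al + 1) * al = ρ * (1 + al) := by field_simp
      _ < _ := h1
  have h1 := (hL.eventually_lt hR hlt)
  have h2 : ∀ᶠ m : ℕ in atTop, (m : ℝ) / (m - al) * (al : ℝ)⁻¹ * (m : ℝ)⁻¹ < 1 := by
    have := (hc.mul_const (al : ℝ)⁻¹).mul hinv
    exact this.eventually (gt_mem_nhds (by simp))
  obtain ⟨m, ⟨h1, h2⟩, hm⟩ := ((h1.and h2).and (eventually_gt_atTop ⌈(al : ℝ)⌉₊)).exists
  have hm' : (al : ℝ) < m := (Nat.le_ceil _).trans_lt (by exact_mod_cast hm)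
  have hm0 : (0 : ℝ) < m := hal0.trans hm'
  refine ⟨al, m, hal.2.le, hm', ?_⟩
  rintro c rfl
  set c : ℝ := m / (m - al) with hcdef
  have e1 : c ^ 2 / (al * m) = c ^ 2 * (al : ℝ)⁻¹ * (m : ℝ)⁻¹ := by
    rw [← div_div, div_eq_mul_inv, div_eq_mul_inv]
  have e2 : c / (al * m) = c * (al : ℝ)⁻¹ * (m : ℝ)⁻¹ := by
    rw [← div_div, div_eq_mul_inv, div_eq_mul_inv]
  rw [e1, e2]
  refine h1.le.trans ?_
  -- Since `c⁻¹ = 1 - al / m`, this is `(1 - al / m) ^ m ≤ exp (-al)`.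
  have h3 : (c ^ m)⁻¹ ≤ Real.exp (-al) := by
    have h4 : c⁻¹ = 1 - al / m := by
      rw [hcdef, inv_div]; field_simp
    have h5 : 1 - (al : ℝ) / m ≤ Real.exp (-(al / m)) := Real.one_sub_le_exp_neg _
    have h6 : 0 ≤ 1 - (al : ℝ) / m := by
      rw [sub_nonneg, div_le_one hm0]; exact hm'.le
    rw [← inv_pow, h4]
    calc (1 - (al : ℝ) / m) ^ m ≤ Real.exp (-(al / m)) ^ m := by gcongr
      _ = Real.exp (-al) := by
        rw [← Real.exp_nat_mul]; congr 1; field_simp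
  have h7 : 0 ≤ 1 - c * (al : ℝ)⁻¹ * (m : ℝ)⁻¹ := by linarith
  gcongr

end Constants

/-! ### The stored elements, and how they suffice to maintain the invariant. -/

section Slots

variable {N : Type*}

/-- The elements stored in the first `K` slots. -/
def slotList (e : ℕ → Option N) (K : ℕ) : List N := (List.range K).filterMap e

lemma mem_slotList {e : ℕ → Option N} {K : ℕ} {u : N} :
    u ∈ slotList e K ↔ ∃ i < K, e i = some u := by
  simp [slotList]

lemma slotList_succ_none {e : ℕ → Option N} {n : ℕ} (h : e n = none) :
    slotList e (n + 1) = slotList e n := by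
  simp [slotList, List.range_succ, h]

lemma slotList_succ_some {e : ℕ → Option N} {n : ℕ} {u : N} (h : e n = some u) :
    slotList e (n + 1) = slotList e n ++ [u] := by
  simp [slotList, List.range_succ, h]

/-- The stored elements at levels `≥ t`. -/
def slotsAbove (e : ℕ → Option N) (gs : ℕ → ℝ) (K : ℕ) (t : ℝ) : Set N :=
  {v | ∃ j < K, e j = some v ∧ t ≤ gs j}

/-- The slots hold all elements above `θ` that are in use, with their data. -/
structure Slots (al : ℝ) (H : List N) (g l : N → ℝ) (θ : ℝ) (K : ℕ) (e : ℕ → Option N)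
    (gs as : ℕ → ℝ) : Prop where
  empty : ∀ i < K, e i = none → gs i = 0
  full : ∀ i < K, ∀ u, e i = some u → u ∈ H ∧ gs i = g u ∧ as i = weight al g l u ∧ l u < g u
  inj : ∀ i < K, ∀ j < K, ∀ u, e i = some u → e j = some u → i = j
  stored : ∀ u ∈ H, l u < g u → θ < g u → ∃ i < K, e i = some u

namespace Slots

variable {al : ℝ} {H : List N} {g l : N → ℝ} {θ : ℝ} {K : ℕ} {e : ℕ → Option N} {gs as : ℕ → ℝ}

lemma nodup (s : Slots al H g l θ K e gs as) : (slotList e K).Nodup := by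
  unfold slotList List.Nodup
  rw [List.pairwise_filterMap]
  refine List.Pairwise.imp_of_mem ?_ (List.nodup_range (n := K))
  intro i j hi hj hij u hu v hv huv
  subst huv
  exact hij (s.inj i (List.mem_range.1 hi) j (List.mem_range.1 hj) u hu hv)

lemma subset (s : Slots al H g l θ K e gs as) : slotList e K ⊆ H := fun u hu => by
  obtain ⟨i, hi, hiu⟩ := mem_slotList.1 hu
  exact (s.full i hi u hiu).1

variable [DecidableEq N]

lemma skip (s : Slots al H g l θ K e gs as) {u : N} (hu : u ∉ H) (a : ℝ) :
    Slots al (u :: H) (Function.update g u a) (Function.update l u a) θ K e gs as where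
  empty := s.empty
  full i hi v hv := by
    obtain ⟨h1, h2, h3, h4⟩ := s.full i hi v hv
    have : v ≠ u := fun h => hu (h ▸ h1)
    simp [weight, this, h1, h2, h3, h4]
  inj := s.inj
  stored v hv h1 h2 := by
    by_cases h : v = u
    · subst h; simp at h1
    · simp only [Function.update_of_ne h] at h1 h2
      exact s.stored v (by simpa [h] using hv) h1 h2

/-- The previous occupant of slot `i` may be lost, because its `g` does not exceed `θ`. -/
lemma insert (s : Slots al H g l θ K e gs as) {u : N} (hu : u ∉ H) {a b θ' : ℝ}
    (hab : b < a) (hθ : θ ≤ θ') {i : ℕ} (hi : i < K) (hgi : gs i ≤ θ) :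
    Slots al (u :: H) (Function.update g u a) (Function.update l u b) θ' K
      (Function.update e i (some u)) (Function.update gs i a)
      (Function.update as i ((a - b) / (al * a))) where
  empty j hj h := by
    by_cases hji : j = i
    · subst hji; simp at h
    · simp only [Function.update_of_ne hji] at h ⊢; exact s.empty j hj h
  full j hj v hv := by
    by_cases hji : j = i
    · subst hji
      simp only [Function.update_self, Option.some.injEq] at hv
      subst hv
      simp [weight, hab]
    · simp only [Function.update_of_ne hji] at hv ⊢
      obtain ⟨h1, h2, h3, h4⟩ := s.full j hj v hv
      have : v ≠ u := fun h => hu (h ▸ h1)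
      simp [weight, this, h1, h2, h3, h4]
  inj j hj j' hj' v hv hv' := by
    by_cases hji : j = i <;> by_cases hji' : j' = i
    · rw [hji, hji']
    · subst hji
      simp only [Function.update_self, Option.some.injEq, Function.update_of_ne hji'] at hv hv'
      exact absurd (hv ▸ (s.full j' hj' v hv').1) hu
    · subst hji'
      simp only [Function.update_self, Option.some.injEq, Function.update_of_ne hji] at hv hv'
      exact absurd (hv' ▸ (s.full j hj v hv).1) hu
    · simp only [Function.update_of_ne hji, Function.update_of_ne hji'] at hv hv'
      exact s.inj j hj j' hj' v hv hv'
  stored v hv h1 h2 := by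
    by_cases h : v = u
    · subst h; exact ⟨i, hi, by simp⟩
    · simp only [Function.update_of_ne h] at h1 h2
      obtain ⟨j, hj, hjv⟩ := s.stored v (by simpa [h] using hv) h1 (hθ.trans_lt h2)
      refine ⟨j, hj, ?_⟩
      have hji : j ≠ i := by
        rintro rfl
        have := (s.full j hj v hjv).2.1
        linarith
      rw [Function.update_of_ne hji, hjv]

end Slots

variable [DecidableEq N]
variable {M : Matroid N} {f : Finset N → ℝ} {al c : ℝ} {H : List N} {g l : N → ℝ} {G θ : ℝ}
  {K : ℕ} {e : ℕ → Option N} {gs as : ℕ → ℝ}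

lemma weight_update_expand {u : N} {a b : ℝ} {L : List N} (hu : u ∉ L) (f : Finset N → ℝ) :
    expand (weight al (Function.update g u a) (Function.update l u b)) L f =
      expand (weight al g l) L f :=
  expand_congr (fun v hv => by
    have : v ≠ u := fun h => hu (h ▸ hv)
    simp [weight, this]) f

lemma level_cons {u : N} (hu : u ∉ H) (a b t : ℝ) :
    level (u :: H) (Function.update g u a) (Function.update l u b) t =
      if b < t ∧ t ≤ a then insert u (level H g l t) else level H g l t := by
  ext v
  by_cases h : v = u
  · subst h
    by_cases hb : b < t ∧ t ≤ a
    · simp [level, hb]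
    · simp only [level, Set.mem_ofPred_eq, List.mem_cons, true_or, Function.update_self, true_and,
        hb, if_false, false_iff]
      exact fun h => hu h.1
  · split_ifs <;> simp [level, h]

/-- The new values concern only `u`, which occurs in no earlier suffix, and raising the threshold
only weakens `l_pow`, `lower` and `span`. -/
lemma History.cons (h : History M f al c H g l G θ) (hE : M.E = Set.univ) {u : N} (hu : u ∉ H)
    {a b θ' : ℝ} (hb : 0 ≤ b) (hba : b ≤ a) (ha : a = 0 ∨ ∃ z : ℤ, a = c ^ z)
    (hbp : b < a → b ≤ θ' ∨ ∃ z : ℤ, b = c ^ z) (hgap : b < a → c * b ≤ a) (hθ : θ ≤ θ')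
    (hc : 0 ≤ c)
    (hup : marg (expand (weight al g l) H f) u ∅ ≤ c * a)
    (hlow : b < a → ∀ ϑ, θ' ≤ ϑ → ϑ < a →
      a ≤ marg (expand (weight al g l) (H.filter fun v => l v < g v ∧ ϑ < g v) f) u ∅)
    (hind : ∀ t, b < t → t ≤ a → u ∉ M.closure (level H g l t))
    (hsp : ∀ t, 0 < t → c * θ' ≤ t → t ≤ a → t ≤ b → u ∈ M.closure (level H g l t)) :
    History M f al c (u :: H) (Function.update g u a) (Function.update l u b) (G + (a - b)) θ' := by
  have hne : ∀ v ∈ H, v ≠ u := fun v hv h => hu (h ▸ hv)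
  have hall : ∀ (p : N → ℝ → ℝ → Prop), (∀ v ∈ H, p v (g v) (l v)) → p u a b →
      ∀ v ∈ u :: H, p v (Function.update g u a v) (Function.update l u b v) := by
    intro p h1 h2 v hv
    by_cases hvu : v = u
    · subst hvu; simpa using h2
    · simpa [hvu] using h1 v (by simpa [hvu] using hv)
  have hsuf : ∀ v H', (v :: H') <:+ H → v ≠ u ∧ u ∉ H' := fun v H' hH' =>
    ⟨hne v (hH'.subset (by simp)), fun h' => hu (hH'.subset (by simp [h']))⟩
  have hfilt : ∀ (H' : List N) (ϑ : ℝ), u ∉ H' →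
      (H'.filter fun v => Function.update l u b v < Function.update g u a v ∧
        ϑ < Function.update g u a v) = H'.filter fun v => l v < g v ∧ ϑ < g v := by
    intro H' ϑ hu'
    refine List.filter_congr fun v hv => ?_
    have : v ≠ u := fun h => hu' (h ▸ hv)
    simp [this]
  refine ⟨List.nodup_cons.2 ⟨hu, h.nodup⟩, ?_, ?_, ?_, ?_, ?_, ?_, ?_, ?_, ?_, ?_⟩
  · rw [List.map_cons, List.sum_cons, Function.update_self, Function.update_self, h.total, add_comm]
    congr 2
    exact List.map_congr_left fun v hv => by simp [hne v hv]
  · exact hall (fun _ _ y => 0 ≤ y) h.l_nonneg hb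
  · exact hall (fun _ x y => y ≤ x) h.l_le hba
  · exact hall (fun _ x _ => x = 0 ∨ ∃ z : ℤ, x = c ^ z) h.g_pow ha
  · exact hall (fun _ x y => y < x → y ≤ θ' ∨ ∃ z : ℤ, y = c ^ z)
      (fun v hv hlt => (h.l_pow v hv hlt).imp (fun h => h.trans hθ) id) hbp
  · exact hall (fun _ x y => y < x → c * y ≤ x) h.gap hgap
  · intro v H' hH'
    rcases List.suffix_cons_iff.1 hH' with heq | hsf
    · obtain ⟨rfl, rfl⟩ := List.cons.inj heq
      rw [weight_update_expand hu, Function.update_self]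
      exact hup
    · obtain ⟨h1, h2⟩ := hsuf v H' hsf
      rw [weight_update_expand h2, Function.update_of_ne h1]
      exact h.upper v H' hsf
  · intro v H' hH'
    rcases List.suffix_cons_iff.1 hH' with heq | hsf
    · obtain ⟨rfl, rfl⟩ := List.cons.inj heq
      intro h1 ϑ h2 h3
      rw [hfilt _ _ hu, weight_update_expand (fun h' => hu (List.mem_of_mem_filter h'))]
      simp only [Function.update_self] at h1 h3 ⊢
      exact hlow h1 ϑ h2 h3
    · obtain ⟨h1, h2⟩ := hsuf v H' hsf
      intro h3 ϑ h4 h5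
      rw [hfilt _ _ h2, weight_update_expand (fun h' => h2 (List.mem_of_mem_filter h'))]
      simp only [Function.update_of_ne h1] at h3 h5 ⊢
      exact h.lower v H' hsf h3 ϑ (hθ.trans h4) h5
  · intro t
    rw [level_cons hu]
    split_ifs with ht
    · rw [(h.indep t).insert_indep_iff]
      left
      exact ⟨by rw [hE]; trivial, hind t ht.1 ht.2⟩
    · exact h.indep t
  · intro t ht0 hct v hv htv
    rw [level_cons hu]
    have hsub : M.closure (level H g l t) ⊆
        M.closure (if b < t ∧ t ≤ a then insert u (level H g l t) else level H g l t) := by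
      split_ifs
      · exact M.closure_subset_closure (Set.subset_insert _ _)
      · exact subset_rfl
    by_cases hvu : v = u
    · subst hvu
      rw [Function.update_self] at htv
      by_cases hbt : b < t
      · rw [if_pos ⟨hbt, htv⟩]
        exact M.mem_closure_of_mem (Set.mem_insert _ _) (by rw [hE]; exact Set.subset_univ _)
      · exact hsub (hsp t ht0 hct htv (not_lt.1 hbt))
    · rw [Function.update_of_ne hvu] at htv
      exact hsub (h.span t ht0 (le_trans (by gcongr) hct) v (by simpa [hvu] using hv) htv)

/-- The arrival of an element: what the slots tell about it suffices. -/
lemma History.arrive (h : History M f al c H g l G θ) (s : Slots al H g l θ K e gs as)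
    (hE : M.E = Set.univ) (hm : MonotoneSet f) (hs : Submodular f) (hal : 1 ≤ al)
    {u : N} (hu : u ∉ H) {a b θ' : ℝ} (hb : 0 ≤ b) (hba : b ≤ a)
    (ha : a = 0 ∨ ∃ z : ℤ, a = c ^ z) (hbp : b < a → b ≤ θ' ∨ ∃ z : ℤ, b = c ^ z)
    (hgap : b < a → c * b ≤ a) (hθ : θ ≤ θ') (hc : 0 ≤ c)
    (hup : marg (expand (weight al g l) (slotList e K) f) u ∅ ≤ c * a)
    (hlow : b < a → a ≤ marg (expand (weight al g l) (slotList e K) f) u ∅)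
    (hθb : b < a → θ ≤ b)
    (hind : ∀ t, b < t → t ≤ a → u ∉ M.closure (slotsAbove e gs K t))
    (hsp : ∀ t, 0 < t → c * θ' ≤ t → t ≤ a → t ≤ b → u ∈ M.closure (slotsAbove e gs K t)) :
    History M f al c (u :: H) (Function.update g u a) (Function.update l u b) (G + (a - b)) θ' := by
  have hw := h.weight_mem hal
  refine h.cons hE hu hb hba ha hbp hgap hθ hc ?_ ?_ ?_ ?_
  -- The slots hold a subset of `H` that contains the used elements above every `ϑ ≥ θ'`, so the
  -- marginal computed from them lies between the two marginals that must be bounded.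
  · exact (marg_expand_subset hm hs s.nodup s.subset hw u ∅).trans hup
  · intro hlt ϑ hϑ hϑa
    refine (hlow hlt).trans (marg_expand_subset hm hs (h.nodup.filter _) ?_
      (fun v hv => hw v (s.subset hv)) u ∅)
    intro v hv
    rw [List.mem_filter, decide_eq_true_iff] at hv
    exact mem_slotList.2 (s.stored v hv.1 hv.2.1 ((hθ.trans hϑ).trans_lt hv.2.2))
  -- Since `θ ≤ b < t`, the whole level set is stored.
  · intro t hbt hta hcl
    refine hind t hbt hta (M.closure_subset_closure ?_ hcl)
    rintro v ⟨hv, hv1, hv2⟩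
    obtain ⟨i, hi, hiv⟩ := s.stored v hv (hv1.trans_le hv2)
      (((hθb (hbt.trans_le hta)).trans_lt hbt).trans_le hv2)
    exact ⟨i, hi, hiv, by rw [(s.full i hi v hiv).2.1]; exact hv2⟩
  · intro t ht0 hct hta htb
    refine M.closure_subset_closure_of_subset_closure ?_ (hsp t ht0 hct hta htb)
    rintro v ⟨i, hi, hiv, hti⟩
    obtain ⟨h1, h2, -, -⟩ := s.full i hi v hiv
    exact h.span t ht0 (le_trans (by gcongr) hct) v h1 (h2 ▸ hti)

/-- Empty slots count as free because their entry is `0`. If all slots held elements with `g > θ`,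
then `c * l ≤ g` would give each a length of at least `(1 - 1 / c) * g > al / m * θ`, in total more
than `K * (al / m * θ) = G`. -/
lemma History.exists_free_slot (h : History M f al c H g l G θ) (s : Slots al H g l θ K e gs as)
    {m : ℕ} (hm0 : 0 < m) (hal : 1 ≤ al) (hc : 1 < c) (hcm : c * (m - al) = m) (hK : 0 < K)
    (hθ : θ = m / al * G / K) : ∃ i < K, gs i ≤ θ := by
  by_contra! hcon
  have hmpos : (0 : ℝ) < m := by exact_mod_cast hm0
  have hKpos : (0 : ℝ) < K := by exact_mod_cast hK
  have hal0 : 0 < al := by linarith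
  have hθ0 : 0 ≤ θ := by rw [hθ]; have := h.total_nonneg; positivity
  have hsome : ∀ i : Fin K, ∃ u, e i = some u := fun i => by
    by_contra! hn
    have h1 := s.empty i i.2 (Option.eq_none_iff_forall_ne_some.2 hn)
    have h2 := hcon i i.2
    linarith
  choose w hw using hsome
  have hwinj : Function.Injective w := fun i j hij =>
    Fin.ext (s.inj i i.2 j j.2 (w i) (hw i) (hij ▸ hw j))
  have h1 : ∑ i : Fin K, (g (w i) - l (w i)) ≤ G := by
    rw [h.total_eq, ← Finset.sum_image (f := fun u => g u - l u) (g := w)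
      (fun i _ j _ hij => hwinj hij)]
    refine Finset.sum_le_sum_of_subset_of_nonneg ?_
      fun u hu _ => sub_nonneg.2 (h.l_le u (List.mem_toFinset.1 hu))
    intro u hu
    obtain ⟨i, -, rfl⟩ := Finset.mem_image.1 hu
    exact List.mem_toFinset.2 (s.full i i.2 _ (hw i)).1
  have h2 : ∀ i : Fin K, al / m * θ < g (w i) - l (w i) := fun i => by
    obtain ⟨h3, h4, -, h5⟩ := s.full i i.2 _ (hw i)
    have h6 := h.gap _ h3 h5
    have h7 := hcon i i.2
    rw [h4] at h7
    have h8 : (m - al) * g (w i) ≥ m * l (w i) := by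
      have : 0 < m - al := by
        by_contra hneg
        nlinarith
      calc m * l (w i) = (m - al) * (c * l (w i)) := by linear_combination (-(l (w i))) * hcm
        _ ≤ (m - al) * g (w i) := by gcongr
    rw [div_mul_eq_mul_div, div_lt_iff₀ hmpos]
    nlinarith
  have h3 : ∑ _i : Fin K, al / m * θ < ∑ i : Fin K, (g (w i) - l (w i)) :=
    Finset.sum_lt_sum_of_nonempty ⟨⟨0, hK⟩, Finset.mem_univ _⟩ fun i _ => h2 i
  rw [Finset.sum_const, Finset.card_univ, Fintype.card_fin, nsmul_eq_mul] at h3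
  have h4 : (K : ℝ) * (al / m * θ) = G := by rw [hθ]; field_simp
  linarith

end Slots

/-! ### Subsets of the slots encoded by the bits of an integer. -/

section Masks

variable {N : Type*} [DecidableEq N]

/-- The set of the elements in the slots selected by the bits of `mask`. -/
def bitsSet (e : ℕ → Option N) (K mask : ℕ) : Finset N :=
  (Finset.range K).biUnion fun i => if mask.testBit i then (e i).toFinset else ∅

/-- The probability that precisely the slots selected by `mask` are chosen. -/
noncomputable def bitsProb (as : ℕ → ℝ) (K mask : ℕ) : ℝ :=
  ∏ i ∈ Finset.range K, if mask.testBit i then as i else 1 - as i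

/-- The minimum of `top` and the values at the slots selected by `mask`. -/
noncomputable def bitsMin (gs : ℕ → ℝ) (top : ℝ) (mask : ℕ) : ℕ → ℝ
  | 0 => top
  | n + 1 => if mask.testBit n then min (bitsMin gs top mask n) (gs n) else bitsMin gs top mask n

lemma le_bitsMin {gs : ℕ → ℝ} {top : ℝ} {mask n : ℕ} {t : ℝ} :
    t ≤ bitsMin gs top mask n ↔ t ≤ top ∧ ∀ i < n, mask.testBit i → t ≤ gs i := by
  induction n with
  | zero => simp [bitsMin]
  | succ n ih =>
    simp only [bitsMin]
    split_ifs with h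
    · rw [le_min_iff, ih, Nat.forall_lt_succ_right]; tauto
    · rw [ih, Nat.forall_lt_succ_right]; tauto

lemma bitsMin_eq (gs : ℕ → ℝ) (top : ℝ) (mask n : ℕ) :
    bitsMin gs top mask n = top ∨ ∃ i < n, bitsMin gs top mask n = gs i := by
  induction n with
  | zero => simp [bitsMin]
  | succ n ih =>
    have h0 : bitsMin gs top mask n = top ∨ ∃ i < n + 1, bitsMin gs top mask n = gs i :=
      ih.imp id fun ⟨i, hi, h⟩ => ⟨i, by omega, h⟩
    simp only [bitsMin]
    split_ifs
    · rcases min_choice (bitsMin gs top mask n) (gs n) with h | h <;> rw [h]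
      · exact h0
      · exact Or.inr ⟨n, by omega, rfl⟩
    · exact h0

lemma mem_bitsSet {e : ℕ → Option N} {K mask : ℕ} {u : N} :
    u ∈ bitsSet e K mask ↔ ∃ i < K, mask.testBit i ∧ e i = some u := by
  simp only [bitsSet, Finset.mem_biUnion, Finset.mem_range]
  refine exists_congr fun i => and_congr_right fun _ => ?_
  split_ifs with h <;> simp [h]

lemma exists_mask (e : ℕ → Option N) (K : ℕ) (B : Finset N)
    (hB : ∀ u ∈ B, ∃ i < K, e i = some u) :
    ∃ mask < 2 ^ K, bitsSet e K mask = B ∧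
      ∀ i < K, mask.testBit i → ∃ u ∈ B, e i = some u := by
  classical
  let b : Fin K → Bool := fun i => decide (∃ u ∈ B, e i = some u)
  have hb : ∀ i < K, (Nat.ofBits b).testBit i ↔ ∃ u ∈ B, e i = some u := fun i hi => by
    rw [Nat.testBit_ofBits_lt b i hi]; simp [b]
  refine ⟨Nat.ofBits b, Nat.ofBits_lt_two_pow b, ?_, fun i hi => (hb i hi).1⟩
  ext u
  rw [mem_bitsSet]
  constructor
  · rintro ⟨i, hi, h1, h2⟩
    obtain ⟨v, hv, hv2⟩ := (hb i hi).1 h1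
    rw [h2] at hv2
    exact (Option.some.inj hv2) ▸ hv
  · intro hu
    obtain ⟨i, hi, h1⟩ := hB u hu
    exact ⟨i, hi, (hb i hi).2 ⟨u, hu, h1⟩, h1⟩

lemma bitsSet_succ (e : ℕ → Option N) (n mask : ℕ) :
    bitsSet e (n + 1) mask =
      bitsSet e n mask ∪ if mask.testBit n then (e n).toFinset else ∅ := by
  simp only [bitsSet, Finset.range_add_one, Finset.biUnion_insert, Finset.union_comm]

lemma testBit_two_pow_add_of_lt {n i mask : ℕ} (hi : i < n) :
    (2 ^ n + mask).testBit i = mask.testBit i := Nat.testBit_two_pow_add_gt hi mask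

lemma bitsSet_two_pow_add (e : ℕ → Option N) (n mask : ℕ) :
    bitsSet e n (2 ^ n + mask) = bitsSet e n mask :=
  Finset.biUnion_congr rfl fun i hi => by
    rw [testBit_two_pow_add_of_lt (Finset.mem_range.1 hi)]

lemma bitsProb_two_pow_add (as : ℕ → ℝ) (n mask : ℕ) :
    bitsProb as n (2 ^ n + mask) = bitsProb as n mask :=
  Finset.prod_congr rfl fun i hi => by
    rw [testBit_two_pow_add_of_lt (Finset.mem_range.1 hi)]

/-- The multilinear extension as a sum over all subsets. -/
lemma sum_bits (x : N → ℝ) (e : ℕ → Option N) (as : ℕ → ℝ) (n : ℕ)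
    (hx : ∀ i < n, ∀ u, e i = some u → as i = x u) (f : Finset N → ℝ) (S : Finset N) :
    ∑ mask ∈ Finset.range (2 ^ n), bitsProb as n mask * f (S ∪ bitsSet e n mask) =
      expand x (slotList e n) f S := by
  induction n generalizing f with
  | zero => simp [bitsProb, bitsSet, slotList, expand]
  | succ n ih =>
    have hlow : ∀ mask ∈ Finset.range (2 ^ n), bitsProb as (n + 1) mask *
        f (S ∪ bitsSet e (n + 1) mask) =
        bitsProb as n mask * ((1 - as n) * f (S ∪ bitsSet e n mask)) := fun mask hm => by
      have : mask.testBit n = false := Nat.testBit_lt_two_pow (Finset.mem_range.1 hm)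
      rw [bitsSet_succ, bitsProb, Finset.prod_range_succ, this]
      simp only [Bool.false_eq_true, if_false, Finset.union_empty]
      rw [bitsProb]; ring
    have hhigh : ∀ mask ∈ Finset.range (2 ^ n), bitsProb as (n + 1) (2 ^ n + mask) *
        f (S ∪ bitsSet e (n + 1) (2 ^ n + mask)) =
        bitsProb as n mask * (as n * f (S ∪ bitsSet e n mask ∪ (e n).toFinset)) := fun mask hm => by
      have : (2 ^ n + mask).testBit n = true := by
        rw [Nat.testBit_two_pow_add_eq, Nat.testBit_lt_two_pow (Finset.mem_range.1 hm)]; rfl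
      rw [bitsSet_succ, bitsSet_two_pow_add, bitsProb, Finset.prod_range_succ, this]
      simp only [if_true]
      rw [← bitsProb, bitsProb_two_pow_add, Finset.union_assoc]; ring
    rw [pow_succ, mul_two, Finset.sum_range_add, Finset.sum_congr rfl hlow,
      Finset.sum_congr rfl hhigh, ← Finset.sum_add_distrib]
    have hx' : ∀ i < n, ∀ u, e i = some u → as i = x u := fun i hi => hx i (by omega)
    -- For an empty slot the two probabilities add up to `1`, so its entry in `as` is irrelevant.
    cases he : e n with
    | none =>
      rw [slotList_succ_none he, ← ih hx' f]
      refine Finset.sum_congr rfl fun mask _ => ?_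
      simp only [Option.toFinset_none, Finset.union_empty]; ring
    | some u =>
      rw [slotList_succ_some he, expand_append, ← ih hx']
      refine Finset.sum_congr rfl fun mask _ => ?_
      have : insert u (S ∪ bitsSet e n mask) = S ∪ bitsSet e n mask ∪ {u} := by
        ext; simp
      simp only [expand, mix, Option.toFinset_some, this, hx n (by omega) u he]; ring

lemma sum_bits_marg (x : N → ℝ) (e : ℕ → Option N) (as : ℕ → ℝ) (n : ℕ)
    (hx : ∀ i < n, ∀ u, e i = some u → as i = x u) (f : Finset N → ℝ) (u : N) :
    ∑ mask ∈ Finset.range (2 ^ n), bitsProb as n mask *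
      (f (insert u (bitsSet e n mask)) - f (bitsSet e n mask)) =
      marg (expand x (slotList e n) f) u ∅ := by
  unfold marg
  rw [← sum_bits x e as n hx, ← sum_bits x e as n hx, ← Finset.sum_sub_distrib]
  refine Finset.sum_congr rfl fun mask _ => ?_
  simp only [Finset.empty_union, Finset.insert_union]; ring

/-- This turns spanning into independence queries: a basis of the elements above `t` serves as the
subset. As `u` is not stored, dependence of `insert u` really means that `u` is spanned. -/
lemma mem_closure_slotsAbove_iff {M : Matroid N} (hE : M.E = Set.univ) {al : ℝ} {H : List N}
    {g l : N → ℝ} {θ : ℝ} {K : ℕ} {e : ℕ → Option N} {gs as : ℕ → ℝ}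
    (s : Slots al H g l θ K e gs as) {u : N} (hu : u ∉ H) (t : ℝ) :
    u ∈ M.closure (slotsAbove e gs K t) ↔ ∃ mask < 2 ^ K, M.Indep (bitsSet e K mask : Set N) ∧
      ¬ M.Indep (insert u (bitsSet e K mask) : Finset N) ∧
      ∀ i < K, mask.testBit i → t ≤ gs i := by
  constructor
  · intro h
    obtain ⟨I, hI⟩ := M.exists_isBasis (slotsAbove e gs K t) (by rw [hE]; exact Set.subset_univ _)
    have hfin : I.Finite := by
      refine (slotList e K).finite_toSet.subset fun v hv => ?_
      obtain ⟨j, hj, hjv, -⟩ := hI.subset hv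
      exact mem_slotList.2 ⟨j, hj, hjv⟩
    obtain ⟨mask, hmask, hset, hbit⟩ := exists_mask e K hfin.toFinset fun v hv => by
      obtain ⟨j, hj, hjv, -⟩ := hI.subset (hfin.mem_toFinset.1 hv)
      exact ⟨j, hj, hjv⟩
    have hcoe : (bitsSet e K mask : Set N) = I := by rw [hset, hfin.coe_toFinset]
    refine ⟨mask, hmask, by rw [hcoe]; exact hI.indep, ?_, ?_⟩
    · rw [Finset.coe_insert, hcoe]
      have hclI : u ∈ M.closure I := by rw [hI.closure_eq_closure]; exact h
      have huI : u ∉ I := fun h' => by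
        obtain ⟨j, hj, hjv, -⟩ := hI.subset h'
        exact hu (s.full j hj u hjv).1
      exact ((hI.indep.mem_closure_iff_of_notMem huI).1 hclI).not_indep
    · intro i hi hbi
      obtain ⟨v, hv, hiv⟩ := hbit i hi hbi
      obtain ⟨j, hj, hjv, hjt⟩ := hI.subset (hfin.mem_toFinset.1 hv)
      rwa [s.inj i hi j hj v hiv hjv]
  · rintro ⟨mask, -, h1, h2, h3⟩
    have hsub : (bitsSet e K mask : Set N) ⊆ slotsAbove e gs K t := fun v hv => by
      obtain ⟨i, hi, hb, hiv⟩ := mem_bitsSet.1 (Finset.mem_coe.1 hv)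
      exact ⟨i, hi, hiv, h3 i hi hb⟩
    refine M.closure_subset_closure hsub ?_
    by_contra hcl
    rw [Finset.coe_insert] at h2
    exact h2 ((h1.notMem_closure_iff (by rw [hE]; trivial)).1 hcl).1

end Masks

/-! ### Bookkeeping for memory updates. -/

section StateLemmas

variable {m : ℕ} {N : Type*}

@[simp] lemma State.setVar_elem (s : State m N) (x : Fin (m + 1)) (v : ℕ) :
    (s.setVar x v).elem = s.elem := rfl
@[simp] lemma State.setVar_num (s : State m N) (x : Fin (m + 1)) (v : ℕ) :
    (s.setVar x v).num = s.num := rfl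
@[simp] lemma State.setVar_var (s : State m N) (x : Fin (m + 1)) (v : ℕ) :
    (s.setVar x v).var = Function.update s.var x v := rfl
@[simp] lemma State.setNum_elem (s : State m N) (i : ℕ) (v : ℝ) :
    (s.setNum i v).elem = s.elem := rfl
@[simp] lemma State.setNum_num (s : State m N) (i : ℕ) (v : ℝ) :
    (s.setNum i v).num = Function.update s.num i v := rfl
@[simp] lemma State.setNum_var (s : State m N) (i : ℕ) (v : ℝ) :
    (s.setNum i v).var = s.var := rfl
@[simp] lemma State.setElem_elem (s : State m N) (i : ℕ) (u : Option N) :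
    (s.setElem i u).elem = Function.update s.elem i u := rfl
@[simp] lemma State.setElem_num (s : State m N) (i : ℕ) (u : Option N) :
    (s.setElem i u).num = s.num := rfl
@[simp] lemma State.setElem_var (s : State m N) (i : ℕ) (u : Option N) :
    (s.setElem i u).var = s.var := rfl

lemma State.setNum_setNum (s : State m N) (i : ℕ) (v w : ℝ) :
    (s.setNum i v).setNum i w = s.setNum i w := by
  simp [State.setNum]

lemma State.setVar_setVar (s : State m N) (x : Fin (m + 1)) (v w : ℕ) :
    (s.setVar x v).setVar x w = s.setVar x w := by
  simp [State.setVar]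

end StateLemmas

/-! ### Total-correctness rules for commands. -/

section Runs

variable {m : ℕ} {N : Type*} [DecidableEq N] {O : Oracles N} {σ : Space}

/-- Started in `s`, the command `c` terminates, and `Q` holds afterwards. -/
def Runs (O : Oracles N) (σ : Space) (c : Cmd m) (s : State m N) (Q : State m N → Prop) : Prop :=
  ∃ t, Exec O σ c s t ∧ Q t

lemma Runs.skip {s : State m N} {Q : State m N → Prop} (h : Q s) : Runs O σ .skip s Q :=
  ⟨s, .skip s, h⟩

lemma Runs.seq {c d : Cmd m} {s : State m N} {Q : State m N → Prop}
    (h : Runs O σ c s fun t => Runs O σ d t Q) : Runs O σ (.seq c d) s Q := by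
  obtain ⟨t, h1, r, h2, h3⟩ := h
  exact ⟨r, .seq h1 h2, h3⟩

lemma Runs.setVar {x : Fin (m + 1)} {e : NatExp m} {s : State m N} {Q : State m N → Prop}
    (h : e.eval s < 2 ^ σ.bits) (hQ : Q (s.setVar x (e.eval s))) :
    Runs O σ (.setVar x e) s Q := ⟨_, .setVar x e s h, hQ⟩

lemma Runs.setNum {i : NatExp m} {e : NumExp m} {s : State m N} {Q : State m N → Prop}
    (h : i.eval s < σ.nums) (hQ : Q (s.setNum (i.eval s) (e.eval O s))) :
    Runs O σ (.setNum i e) s Q := ⟨_, .setNum i e s h, hQ⟩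

lemma Runs.copyElem {i j : NatExp m} {s : State m N} {Q : State m N → Prop}
    (h : i.eval s < σ.elems) (hQ : Q (s.setElem (i.eval s) (s.elem (j.eval s)))) :
    Runs O σ (.copyElem i j) s Q := ⟨_, .copyElem i j s h, hQ⟩

lemma Runs.eraseElem {i : NatExp m} {s : State m N} {Q : State m N → Prop}
    (h : i.eval s < σ.elems) (hQ : Q (s.setElem (i.eval s) none)) :
    Runs O σ (.eraseElem i) s Q := ⟨_, .eraseElem i s h, hQ⟩

lemma Runs.ite {b : Cond m} {c d : Cmd m} {s : State m N} {Q : State m N → Prop}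
    (h1 : b.Holds O s → Runs O σ c s Q) (h2 : ¬ b.Holds O s → Runs O σ d s Q) :
    Runs O σ (.ite b c d) s Q := by
  by_cases hb : b.Holds O s
  · obtain ⟨t, ht, hQ⟩ := h1 hb
    exact ⟨t, .iteTrue hb ht, hQ⟩
  · obtain ⟨t, ht, hQ⟩ := h2 hb
    exact ⟨t, .iteFalse hb ht, hQ⟩

lemma Runs.mono {c : Cmd m} {s : State m N} {Q Q' : State m N → Prop} (h : Runs O σ c s Q)
    (hQ : ∀ t, Q t → Q' t) : Runs O σ c s Q' := by
  obtain ⟨t, h1, h2⟩ := h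
  exact ⟨t, h1, hQ t h2⟩

/-- The rule for loops, with an invariant `I n` where `n` decreases. -/
lemma Runs.while {b : Cond m} {c : Cmd m} {Q : State m N → Prop} (I : ℕ → State m N → Prop)
    (hstep : ∀ n s, I n s → b.Holds O s → Runs O σ c s fun t => ∃ n' < n, I n' t)
    (hend : ∀ n s, I n s → ¬ b.Holds O s → Q s) {n : ℕ} {s : State m N} (h : I n s) :
    Runs O σ (.while b c) s Q := by
  induction n using Nat.strong_induction_on generalizing s with
  | _ n ih =>
    by_cases hb : b.Holds O s
    · obtain ⟨t, ht, n', hn', hI⟩ := hstep n s h hb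
      obtain ⟨r, hr, hQ⟩ := ih n' hn' hI
      exact ⟨r, .whileTrue hb ht hr, hQ⟩
    · exact ⟨s, .whileFalse hb, hend n s h hb⟩

lemma State.mem_cells {s : State m N} {lo hi : ℕ} {u : N} :
    u ∈ s.cells lo hi ↔ ∃ j, lo ≤ j ∧ j < hi ∧ s.elem j = some u := by
  simp [State.cells, and_assoc]

end Runs

/-! ### Enumeration of subsets

Element cell `0` holds the last element, the cells `1, …, K` a subset of the slots, which are the
cells `K + 1, …, 2 K`. Number cells: `0` and `1` for the probability and the minimum belonging to
the subset, `2` the marginal, `3` the lower end, `4` the total, `5` the rounded marginal, `6` the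
best value, `7` the number `K`, `8` the threshold, then `2 K` cells for the data of the slots.
Integer variables: `1` for `K`, `2` for `2 ^ K`, `3` the subset, `4` the index of a slot, `5` the
remaining bits, `6` the best subset. -/

section Programs

/-- Copy the subset given by variable `3`. -/
def loadCmd : Cmd 6 :=
  .seq (.setVar 4 (.lit 0)) <| .seq (.setVar 5 (.var 3)) <| .seq (.setNum (.lit 0) (.lit 1)) <|
  .seq (.setNum (.lit 1) (.cell (.lit 5))) <|
  .while (.natLe (.add (.var 4) (.lit 1)) (.var 1)) <|
    .seq (.ite (.natLe (.lit 1) (.mod (.var 5) (.lit 2)))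
      (.seq (.copyElem (.add (.var 4) (.lit 1)) (.add (.add (.var 1) (.lit 1)) (.var 4))) <|
        .seq (.setNum (.lit 0) (.mul (.cell (.lit 0))
          (.cell (.add (.add (.lit 9) (.var 1)) (.var 4))))) <|
        .ite (.numLe (.cell (.lit 1)) (.cell (.add (.lit 9) (.var 4)))) .skip
          (.setNum (.lit 1) (.cell (.add (.lit 9) (.var 4)))))
      (.seq (.eraseElem (.add (.var 4) (.lit 1)))
        (.setNum (.lit 0) (.mul (.cell (.lit 0))
          (.sub (.lit 1) (.cell (.add (.add (.lit 9) (.var 1)) (.var 4)))))))) <|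
    .seq (.setVar 5 (.div (.var 5) (.lit 2))) (.setVar 4 (.add (.var 4) (.lit 1)))

/-- Run `body` for all subsets. -/
def enumCmd (body : Cmd 6) : Cmd 6 :=
  .seq (.setVar 3 (.lit 0)) <|
  .while (.natLe (.add (.var 3) (.lit 1)) (.var 2)) <|
    .seq loadCmd <| .seq body (.setVar 3 (.add (.var 3) (.lit 1)))

variable {N : Type*} [DecidableEq N] {O : Oracles N} {σ : Space} {K : ℕ}

/-- The effect of the first `i` steps of `loadCmd`. -/
structure Loaded (K mask i : ℕ) (s t : State 6 N) : Prop where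
  scratch : ∀ j < i, t.elem (j + 1) = if mask.testBit j then s.elem (K + 1 + j) else none
  elem : ∀ j, (j = 0 ∨ i < j) → t.elem j = s.elem j
  prob : t.num 0 = bitsProb (fun j => s.num (9 + K + j)) i mask
  min : t.num 1 = bitsMin (fun j => s.num (9 + j)) (s.num 5) mask i
  num : ∀ j, 2 ≤ j → t.num j = s.num j
  var : ∀ x, x ≠ 4 → x ≠ 5 → t.var x = s.var x

lemma testBit_iff_div_mod (mask i : ℕ) : mask.testBit i = true ↔ 1 ≤ mask / 2 ^ i % 2 := by
  rw [Nat.testBit_eq_decide_div_mod_eq, decide_eq_true_iff]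
  omega

lemma runs_load (hσe : 1 + K ≤ σ.elems) (hσn : 2 ≤ σ.nums) (hσb : K < 2 ^ σ.bits)
    {s : State 6 N} (hK : s.var 1 = K) (hmask : s.var 3 < 2 ^ σ.bits) {Q : State 6 N → Prop}
    (hQ : ∀ t, Loaded K (s.var 3) K s t → Q t) : Runs O σ loadCmd s Q := by
  unfold loadCmd
  refine .seq (.setVar (by simp [NatExp.eval]) ?_)
  refine .seq (.setVar (by simpa [NatExp.eval] using hmask) ?_)
  refine .seq (.setNum (by simp only [NatExp.eval]; omega) ?_)
  refine .seq (.setNum (by simp only [NatExp.eval]; omega) ?_)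
  -- The bits are peeled off one by one: after `i` rounds variable `5` holds the mask divided by `2
  -- ^ i`.
  refine Runs.while (fun n t => ∃ i, i + n = K ∧ Loaded K (s.var 3) i s t ∧ t.var 4 = i ∧
    t.var 5 = s.var 3 / 2 ^ i) ?_ ?_ (n := K) ?_
  · rintro n t ⟨i, hin, hL, h4, h5⟩ hb
    have h1 : t.var 1 = K := by rw [hL.var 1 (by decide) (by decide), hK]
    simp only [Cond.Holds, NatExp.eval, h4, h1] at hb
    have hdone : ∀ r : State 6 N, Loaded K (s.var 3) (i + 1) s r → r.var 4 = i →
        r.var 5 = s.var 3 / 2 ^ i →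
        Runs O σ (.seq (.setVar 5 (.div (.var 5) (.lit 2))) (.setVar 4 (.add (.var 4) (.lit 1)))) r
        fun t => ∃ n' < n, ∃ i, i + n' = K ∧ Loaded K (s.var 3) i s t ∧ t.var 4 = i ∧
          t.var 5 = s.var 3 / 2 ^ i := by
      intro r hr h4 h5
      refine .seq (.setVar ?_ (.setVar ?_ ?_))
      · simp only [NatExp.eval, h5]
        exact (Nat.div_le_self _ _).trans_lt ((Nat.div_le_self _ _).trans_lt hmask)
      · simp [NatExp.eval, h4]; omega
      · refine ⟨n - 1, by omega, i + 1, by omega, ⟨?_, ?_, ?_, ?_, ?_, ?_⟩, ?_, ?_⟩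
        · simpa using hr.scratch
        · simpa using hr.elem
        · simpa using hr.prob
        · simpa using hr.min
        · simpa using hr.num
        · intro x hx4 hx5; simpa [hx4, hx5] using hr.var x hx4 hx5
        · simp [NatExp.eval, h4]
        · simp [NatExp.eval, h5, Nat.div_div_eq_div_mul, pow_succ]
    refine .seq (.ite (fun hbit => ?_) (fun hbit => ?_))
    · simp only [Cond.Holds, NatExp.eval, h5, ← testBit_iff_div_mod] at hbit
      refine .seq (.copyElem (by simp only [NatExp.eval, h4]; omega) ?_)
      refine .seq (.setNum (by simp only [NatExp.eval]; omega) ?_)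
      have hscr : ∀ j < i + 1, Function.update t.elem (i + 1) (t.elem (K + 1 + i)) (j + 1) =
          if (s.var 3).testBit j then s.elem (K + 1 + j) else none := by
        intro j hj
        rcases Nat.lt_succ_iff_lt_or_eq.1 hj with hj | rfl
        · rw [Function.update_of_ne (by omega), hL.scratch j hj]
        · rw [Function.update_self, hbit, if_pos rfl, hL.elem _ (by omega)]
      have hel : ∀ j, (j = 0 ∨ i + 1 < j) →
          Function.update t.elem (i + 1) (t.elem (K + 1 + i)) j = s.elem j := by
        intro j hj
        rw [Function.update_of_ne (by omega), hL.elem j (by omega)]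
      have hpr : t.num 0 * t.num (9 + K + i) =
          bitsProb (fun j => s.num (9 + K + j)) (i + 1) (s.var 3) := by
        rw [bitsProb, Finset.prod_range_succ, hbit, if_pos rfl, hL.prob, bitsProb,
          hL.num _ (by omega)]
      have hmi := hL.min
      have hgi : t.num (9 + i) = s.num (9 + i) := hL.num _ (by omega)
      refine .ite (fun hle => .skip (hdone _ ⟨?_, ?_, ?_, ?_, ?_, ?_⟩ ?_ ?_))
        (fun hle => .setNum (by simp only [NatExp.eval]; omega)
          (hdone _ ⟨?_, ?_, ?_, ?_, ?_, ?_⟩ ?_ ?_))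
      · simpa [NatExp.eval, h4, h1] using hscr
      · simpa [NatExp.eval, h4, h1] using hel
      · simpa [NatExp.eval, NumExp.eval, h4, h1] using hpr
      · simp [Cond.Holds, NatExp.eval, NumExp.eval, h4, h1, hmi, hgi] at hle
        simp [bitsMin, hbit, NatExp.eval, hmi, min_eq_left hle]
      · intro j hj
        have : j ≠ 0 := by omega
        simpa [NatExp.eval, this] using hL.num j hj
      · simpa using hL.var
      · simpa using h4
      · simpa using h5
      · simpa [NatExp.eval, h4, h1] using hscr
      · simpa [NatExp.eval, h4, h1] using hel
      · simpa [NatExp.eval, NumExp.eval, h4, h1] using hpr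
      · simp [Cond.Holds, NatExp.eval, NumExp.eval, h4, h1, hmi, hgi] at hle
        simp [bitsMin, hbit, NatExp.eval, NumExp.eval, h4, hgi, min_eq_right hle.le]
      · intro j hj
        have h0 : j ≠ 0 := by omega
        have h1 : j ≠ 1 := by omega
        simpa [NatExp.eval, h0, h1] using hL.num j hj
      · simpa using hL.var
      · simpa using h4
      · simpa using h5
    · simp only [Cond.Holds, NatExp.eval, h5, ← testBit_iff_div_mod] at hbit
      refine .seq (.eraseElem (by simp only [NatExp.eval, h4]; omega) ?_)
      refine .setNum (by simp only [NatExp.eval]; omega) (hdone _ ⟨?_, ?_, ?_, ?_, ?_, ?_⟩ ?_ ?_)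
      · intro j hj
        rcases Nat.lt_succ_iff_lt_or_eq.1 hj with hj | rfl
        · have : j ≠ i := by omega
          simpa [NatExp.eval, h4, this] using hL.scratch j hj
        · simp [NatExp.eval, h4, hbit]
      · intro j hj
        have : j ≠ i + 1 := by omega
        simpa [NatExp.eval, h4, this] using hL.elem j (by omega)
      · rw [bitsProb, Finset.prod_range_succ, if_neg hbit]
        have := hL.prob
        rw [bitsProb] at this
        have h9 := hL.num (9 + K + i) (by omega)
        simp [NatExp.eval, NumExp.eval, h4, h1, this, h9]
      · simpa [bitsMin, hbit, NatExp.eval] using hL.min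
      · intro j hj
        have h0 : j ≠ 0 := by omega
        simpa [NatExp.eval, h0] using hL.num j hj
      · simpa using hL.var
      · simpa using h4
      · simpa using h5
  · rintro n t ⟨i, hin, hL, h4, h5⟩ hb
    have h1 : t.var 1 = K := by rw [hL.var 1 (by decide) (by decide), hK]
    simp only [Cond.Holds, NatExp.eval, h4, h1] at hb
    have : i = K := by omega
    subst this
    exact hQ t hL
  · refine ⟨0, by simp, ⟨by simp, ?_, ?_, ?_, ?_, ?_⟩, ?_, ?_⟩
    · simp
    · simp [NatExp.eval, NumExp.eval, bitsProb]
    · simp [NatExp.eval, NumExp.eval, bitsMin]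
    · intro j hj
      have h0 : j ≠ 0 := by omega
      have h1 : j ≠ 1 := by omega
      simp [NatExp.eval, h0, h1]
    · intro x hx4 hx5; simp [hx4, hx5]
    · simp [NatExp.eval]
    · simp [NatExp.eval]

/-- What an enumeration that accumulates in number cell `z` leaves unchanged. -/
structure Frame (K z : ℕ) (s t : State 6 N) : Prop where
  elem : ∀ j, (j = 0 ∨ K < j) → t.elem j = s.elem j
  num : ∀ j, 2 ≤ j → j ≠ z → t.num j = s.num j
  var : ∀ x : Fin 7, x.val < 3 → t.var x = s.var x

/-- The situation when the body of an enumeration is run for `mask`. -/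
structure Current (K z mask : ℕ) (s t : State 6 N) : Prop extends Frame K z s t where
  scratch : t.cells 1 (K + 1) = bitsSet (fun i => s.elem (K + 1 + i)) K mask
  with_last : ∀ u, s.elem 0 = some u →
    t.cells 0 (K + 1) = insert u (bitsSet (fun i => s.elem (K + 1 + i)) K mask)
  prob : t.num 0 = bitsProb (fun j => s.num (9 + K + j)) K mask
  min : t.num 1 = bitsMin (fun j => s.num (9 + j)) (s.num 5) mask K
  mask_eq : t.var 3 = mask

lemma Loaded.cells {mask : ℕ} {s t : State 6 N} (h : Loaded K mask K s t) :
    t.cells 1 (K + 1) = bitsSet (fun i => s.elem (K + 1 + i)) K mask := by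
  ext u
  rw [State.mem_cells, mem_bitsSet]
  constructor
  · rintro ⟨j, h1, h2, h3⟩
    obtain ⟨i, rfl⟩ := Nat.exists_eq_add_of_le' h1
    rw [h.scratch i (by omega)] at h3
    split_ifs at h3 with hb
    exact ⟨i, by omega, hb, h3⟩
  · rintro ⟨i, h1, h2, h3⟩
    exact ⟨i + 1, by omega, by omega, by rw [h.scratch i h1, if_pos h2, h3]⟩

lemma cells_zero {s : State 6 N} {u : N} {n : ℕ} (h : s.elem 0 = some u) :
    s.cells 0 (n + 1) = insert u (s.cells 1 (n + 1)) := by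
  ext v
  rw [Finset.mem_insert, State.mem_cells, State.mem_cells]
  constructor
  · rintro ⟨j, -, h2, h3⟩
    rcases Nat.eq_zero_or_pos j with rfl | hj
    · left; rw [h] at h3; exact (Option.some.inj h3).symm
    · exact Or.inr ⟨j, hj, h2, h3⟩
  · rintro (rfl | ⟨j, h1, h2, h3⟩)
    · exact ⟨0, by omega, by omega, h⟩
    · exact ⟨j, by omega, h2, h3⟩

/-- `J n v b` relates the accumulator (cell `z`) and variable `6` to the masks below `n`. The
accumulator must not be cell `5`, where each minimum starts, nor a cell with data of the slots. -/
lemma runs_enum {z : ℕ} (hz : 2 ≤ z) (hz5 : z ≠ 5) (hz9 : z < 9) (hσe : 1 + K ≤ σ.elems)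
    (hσn : 2 ≤ σ.nums) (hσb : 2 ^ K < 2 ^ σ.bits) {body : Cmd 6} {s : State 6 N}
    (hK : s.var 1 = K) (hP : s.var 2 = 2 ^ K) (J : ℕ → ℝ → ℕ → Prop)
    (hJ : J 0 (s.num z) (s.var 6))
    (hbody : ∀ mask < 2 ^ K, ∀ t, Current K z mask s t → J mask (t.num z) (t.var 6) →
      Runs O σ body t fun r => r.elem = t.elem ∧ (∀ j, j ≠ z → r.num j = t.num j) ∧
        (∀ x, x ≠ 6 → r.var x = t.var x) ∧ J (mask + 1) (r.num z) (r.var 6))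
    {Q : State 6 N → Prop}
    (hQ : ∀ r, Frame K z s r → J (2 ^ K) (r.num z) (r.var 6) → Q r) :
    Runs O σ (enumCmd body) s Q := by
  have hKb : K < 2 ^ σ.bits := Nat.lt_two_pow_self.trans hσb
  unfold enumCmd
  refine .seq (.setVar (by simp [NatExp.eval]) ?_)
  refine Runs.while (fun n t => ∃ mask, mask + n = 2 ^ K ∧ Frame K z s t ∧ t.var 3 = mask ∧
    J mask (t.num z) (t.var 6)) ?_ ?_ (n := 2 ^ K) ?_
  · rintro n t ⟨mask, hn, hF, h3, hJt⟩ hb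
    have h1 : t.var 1 = K := by rw [hF.var 1 (by decide), hK]
    have h2 : t.var 2 = 2 ^ K := by rw [hF.var 2 (by decide), hP]
    simp only [Cond.Holds, NatExp.eval, h3, h2] at hb
    refine .seq (runs_load hσe hσn hKb h1 (by omega) fun r hr => ?_)
    rw [h3] at hr
    have hslot : (fun i => t.elem (K + 1 + i)) = fun i => s.elem (K + 1 + i) := by
      funext i; exact hF.elem _ (by omega)
    have hcells := hr.cells
    rw [hslot] at hcells
    have hgs : (fun j => t.num (9 + j)) = fun j => s.num (9 + j) := by
      funext j; exact hF.num _ (by omega) (by omega)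
    have has : (fun j => t.num (9 + K + j)) = fun j => s.num (9 + K + j) := by
      funext j; exact hF.num _ (by omega) (by omega)
    have hcur : Current K z mask s r :=
      { elem := fun j hj => by rw [hr.elem j hj, hF.elem j hj]
        num := fun j hj hjz => by rw [hr.num j hj, hF.num j hj hjz]
        var := fun x hx => by
          rw [hr.var x (by rintro rfl; simp at hx) (by rintro rfl; simp at hx), hF.var x hx]
        scratch := hcells
        with_last := fun u hu => by
          rw [cells_zero (u := u) (by rw [hr.elem 0 (by omega), hF.elem 0 (by omega), hu]), hcells]
        prob := by rw [hr.prob, has]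
        min := by rw [hr.min, hgs, hF.num 5 (by omega) hz5.symm]
        mask_eq := by rw [hr.var 3 (by decide) (by decide), h3] }
    refine .seq ((hbody mask (by omega) r hcur ?_).mono ?_)
    · rw [hr.num z hz, hr.var 6 (by decide) (by decide)]; exact hJt
    · rintro q ⟨hq1, hq2, hq3, hq4⟩
      have hq3' : q.var 3 = mask := by rw [hq3 3 (by decide), hcur.mask_eq]
      refine .setVar (by simp only [NatExp.eval, hq3']; omega)
        ⟨n - 1, by omega, mask + 1, by omega, ⟨?_, ?_, ?_⟩, ?_, ?_⟩
      · intro j hj; rw [State.setVar_elem, hq1, hcur.elem j hj]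
      · intro j hj hjz; rw [State.setVar_num, hq2 j hjz, hcur.num j hj hjz]
      · intro x hx
        rw [State.setVar_var, Function.update_of_ne (by rintro rfl; simp at hx),
          hq3 x (by rintro rfl; simp at hx), hcur.var x hx]
      · simp [NatExp.eval, hq3']
      · simpa using hq4
  · rintro n t ⟨mask, hn, hF, h3, hJt⟩ hb
    have h2 : t.var 2 = 2 ^ K := by rw [hF.var 2 (by decide), hP]
    simp only [Cond.Holds, NatExp.eval, h3, h2] at hb
    have : mask = 2 ^ K := by omega
    subst this
    exact hQ t hF hJt
  · refine ⟨0, by simp, ⟨by simp, by simp, ?_⟩, by simp [NatExp.eval], by simpa using hJ⟩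
    intro x hx
    rw [State.setVar_var, Function.update_of_ne (by rintro rfl; simp at hx)]

end Programs

/-! ### The program and the correctness of its pieces. -/

section Algorithm

/-- Store in cell `5` the largest power of `c` that is at most the number in cell `2`. -/
def roundCmd (c : ℚ) : Cmd 6 :=
  .seq (.setNum (.lit 5) (.lit 1)) <|
  .seq (.while (.numLe (.cell (.lit 5)) (.cell (.lit 2)))
    (.setNum (.lit 5) (.mul (.cell (.lit 5)) (.lit c)))) <|
  .while (.not (.numLe (.cell (.lit 5)) (.cell (.lit 2))))
    (.setNum (.lit 5) (.div (.cell (.lit 5)) (.lit c)))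

/-- One term of the multilinear extension. -/
def margBody : Cmd 6 :=
  .setNum (.lit 2) (.add (.cell (.lit 2)) (.mul (.cell (.lit 0))
    (.sub (.value (.lit 0) (.add (.var 1) (.lit 1))) (.value (.lit 1) (.add (.var 1) (.lit 1))))))

/-- Test whether the current subset spans the last element. -/
def spanBody : Cmd 6 :=
  .ite (.and (.indep (.lit 1) (.add (.var 1) (.lit 1)))
    (.and (.not (.indep (.lit 0) (.add (.var 1) (.lit 1))))
      (.not (.numLe (.cell (.lit 1)) (.cell (.lit 3))))))
    (.setNum (.lit 3) (.cell (.lit 1))) .skip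

/-- Compare the current subset with the best independent subset so far. -/
def bestBody : Cmd 6 :=
  .ite (.and (.indep (.lit 1) (.add (.var 1) (.lit 1)))
    (.not (.numLe (.value (.lit 1) (.add (.var 1) (.lit 1))) (.cell (.lit 6)))))
    (.seq (.setNum (.lit 6) (.value (.lit 1) (.add (.var 1) (.lit 1)))) (.setVar 6 (.var 3))) .skip

/-- Put the last element in a free slot. -/
def storeCmd (al : ℚ) : Cmd 6 :=
  .seq (.setNum (.lit 4) (.add (.cell (.lit 4)) (.sub (.cell (.lit 5)) (.cell (.lit 3))))) <|
  .seq (.setVar 4 (.lit 0)) <|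
  .seq (.while (.not (.numLe (.cell (.add (.lit 9) (.var 4))) (.cell (.lit 8))))
    (.setVar 4 (.add (.var 4) (.lit 1)))) <|
  .seq (.copyElem (.add (.add (.var 1) (.lit 1)) (.var 4)) (.lit 0)) <|
  .seq (.setNum (.add (.lit 9) (.var 4)) (.cell (.lit 5))) <|
  .setNum (.add (.add (.lit 9) (.var 1)) (.var 4))
    (.div (.sub (.cell (.lit 5)) (.cell (.lit 3))) (.mul (.lit al) (.cell (.lit 5))))

/-- What is done on the arrival of an element. -/
def arriveCmd (al c : ℚ) (m : ℕ) : Cmd 6 :=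
  .seq (.setNum (.lit 2) (.lit 0)) <| .seq (enumCmd margBody) <|
  .ite (.numLe (.cell (.lit 2)) (.lit 0)) .skip <|
  .seq (roundCmd c) <|
  .seq (.setNum (.lit 8) (.div (.mul (.lit (m / al)) (.cell (.lit 4))) (.cell (.lit 7)))) <|
  .ite (.numLe (.mul (.lit c) (.cell (.lit 8))) (.cell (.lit 5)))
    (.seq (.setNum (.lit 3) (.cell (.lit 8))) <| .seq (enumCmd spanBody) <|
      .ite (.numLe (.cell (.lit 5)) (.cell (.lit 3))) .skip (storeCmd al))
    .skip

/-- Compute the number `K = m² k` of slots, `2 ^ K`, and `K` as a real number. -/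
def initCmd (m : ℕ) : Cmd 6 :=
  .seq (.setVar 1 (.mul (.lit (m ^ 2)) (.var 0))) <| .seq (.setVar 2 (.lit 1)) <|
  .while (.natLe (.add (.var 4) (.lit 1)) (.var 1)) <|
    .seq (.setVar 2 (.add (.var 2) (.var 2))) <|
    .seq (.setNum (.lit 7) (.add (.cell (.lit 7)) (.lit 1))) <|
    .setVar 4 (.add (.var 4) (.lit 1))

/-- Output the best independent subset of the slots. -/
def finishCmd : Cmd 6 :=
  .seq (.setVar 6 (.lit 0)) <| .seq (.setNum (.lit 6) (.value (.lit 0) (.lit 0))) <|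
  .seq (enumCmd bestBody) <| .seq (.setVar 3 (.var 6)) <| .seq loadCmd <|
  .seq (.eraseElem (.lit 0)) <| .setVar 0 (.add (.var 1) (.lit 1))

/-- The algorithm with level ratio `c = m / (m - al)`. -/
def algorithm (al c : ℚ) (m : ℕ) : Algorithm where
  m := 6
  init := initCmd m
  arrive := arriveCmd al c m
  finish := finishCmd

/-- The memory on matroids of rank `k`. -/
def space (m k : ℕ) : Space where
  -- One cell for the arriving element, `K` for the enumerated subset and `K` for the slots; the
  -- number cells are nine registers and two entries per slot, and `bits` has room for `2 ^ K`.
  elems := 1 + 2 * (m ^ 2 * k)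
  nums := 9 + 2 * (m ^ 2 * k)
  bits := m ^ 2 * k + k + 1

variable {N : Type*} [DecidableEq N] {O : Oracles N} {σ : Space} {K : ℕ}

/-- The upward loop ends above the marginal; every downward step starts from a power above it, which
preserves `s.num 2 < c * c ^ z`. The power `z₁` below the marginal bounds the number of downward
steps. -/
lemma runs_round {c : ℚ} (hc : (1 : ℝ) < c) (hσn : 9 ≤ σ.nums) {s : State 6 N}
    (hv : 0 < s.num 2) {Q : State 6 N → Prop}
    (hQ : ∀ z : ℤ, (c : ℝ) ^ z ≤ s.num 2 → s.num 2 < c * (c : ℝ) ^ z →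
      Q (s.setNum 5 ((c : ℝ) ^ z))) : Runs O σ (roundCmd c) s Q := by
  have hc0 : (0 : ℝ) < c := by linarith
  obtain ⟨B, hB⟩ := pow_unbounded_of_one_lt (s.num 2) hc
  obtain ⟨z₁, hz₁, -⟩ := exists_mem_Ico_zpow hv hc
  unfold roundCmd
  refine .seq (.setNum (by simp only [NatExp.eval]; omega) (.seq ?_))
  refine Runs.while (fun k t => ∃ n, n + k = B ∧ t = s.setNum 5 ((c : ℝ) ^ n)) ?_ ?_ (n := B)
    ⟨0, by simp, by simp [NatExp.eval, NumExp.eval]⟩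
  · rintro k t ⟨n, hn, rfl⟩ hb
    simp [Cond.Holds, NatExp.eval, NumExp.eval] at hb
    have hnB : n < B := (pow_lt_pow_iff_right₀ hc).1 (hb.trans_lt hB)
    refine .setNum (by simp only [NatExp.eval]; omega) ⟨k - 1, by omega, n + 1, by omega, ?_⟩
    simp [NatExp.eval, NumExp.eval, State.setNum_setNum, pow_succ]
  · rintro k t ⟨n, hn, rfl⟩ hb
    simp [Cond.Holds, NatExp.eval, NumExp.eval] at hb
    have hz : z₁ < n := by
      rw [← zpow_natCast] at hb
      exact (zpow_lt_zpow_iff_right₀ hc).1 (hz₁.trans_lt hb)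
    refine Runs.while (fun k t => ∃ z : ℤ, z = z₁ + k ∧ s.num 2 < c * (c : ℝ) ^ z ∧
      t = s.setNum 5 ((c : ℝ) ^ z)) ?_ ?_ (n := (n - z₁).toNat) ?_
    · rintro k t ⟨z, hz, hlt, rfl⟩ hb
      simp [Cond.Holds, NatExp.eval, NumExp.eval] at hb
      have h1 : z₁ < z := (zpow_lt_zpow_iff_right₀ hc).1 (hz₁.trans_lt hb)
      refine .setNum (by simp only [NatExp.eval]; omega) ⟨k - 1, by omega, z - 1, by omega, ?_, ?_⟩
      · rw [zpow_sub_one₀ hc0.ne']; field_simp; exact hb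
      · simp [NatExp.eval, NumExp.eval, State.setNum_setNum, zpow_sub_one₀ hc0.ne', div_eq_mul_inv]
    · rintro k t ⟨z, hz, hlt, rfl⟩ hb
      simp [Cond.Holds, NatExp.eval, NumExp.eval] at hb
      exact hQ z hb hlt
    · refine ⟨n, by omega, ?_, by simp⟩
      rw [zpow_natCast]
      nlinarith

/-- The elements of `H` have arrived. -/
structure Reached (M : Matroid N) (f : Finset N → ℝ) (al c : ℝ) (m K : ℕ) (H : List N)
    (g l : N → ℝ) (s : State 6 N) : Prop where
  history : History M f al c H g l (s.num 4) (m / al * s.num 4 / K)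
  slots : Slots al H g l (m / al * s.num 4 / K) K (fun i => s.elem (K + 1 + i))
    (fun i => s.num (9 + i)) (fun i => s.num (9 + K + i))
  size : s.var 1 = K
  pow_size : s.var 2 = 2 ^ K
  real_size : s.num 7 = K

variable {M : Matroid N} {f : Finset N → ℝ} {al c : ℚ} {m : ℕ} {H : List N} {g l : N → ℝ}

/-- Expressions have neither powers nor a conversion from integers to reals, so `2 ^ K` and the real
number `K` are built by a loop. -/
lemma runs_init {k : ℕ} {Q : State 6 N → Prop} (O : Oracles N)
    (hQ : ∀ s : State 6 N, (∀ i, s.elem i = none) → (∀ i, i ≠ 7 → s.num i = 0) →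
      s.var 1 = m ^ 2 * k → s.var 2 = 2 ^ (m ^ 2 * k) → s.num 7 = (m ^ 2 * k : ℕ) → Q s) :
    Runs O (space m k) (initCmd m) (State.initial 6 N k) Q := by
  obtain ⟨K, hK⟩ : ∃ K, K = m ^ 2 * k := ⟨_, rfl⟩
  have hbits : (space m k).bits = K + k + 1 := by rw [hK]; rfl
  have hb1 : 2 * 2 ^ K ≤ 2 ^ (space m k).bits := by
    rw [hbits, ← pow_succ']
    exact Nat.pow_le_pow_right (by norm_num) (by omega)
  have hb2 : K < 2 ^ K := Nat.lt_two_pow_self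
  unfold initCmd
  refine .seq (.setVar ?_ (.seq (.setVar ?_ ?_)))
  · simp [NatExp.eval, State.initial, ← hK]; omega
  · simp only [NatExp.eval]; omega
  refine Runs.while (fun n t => ∃ i, i + n = K ∧ (∀ j, t.elem j = none) ∧
    (∀ j, j ≠ 7 → t.num j = 0) ∧ t.var 1 = K ∧ t.var 2 = 2 ^ i ∧ t.num 7 = i ∧ t.var 4 = i)
    ?_ ?_ (n := K) ?_
  · rintro n t ⟨i, hin, he, hn, h1, h2, h7, h4⟩ hb
    simp only [Cond.Holds, NatExp.eval, h1, h4] at hb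
    have h3 : 2 ^ i ≤ 2 ^ K := Nat.pow_le_pow_right (by norm_num) (by omega)
    have h5 : 2 ^ i < 2 ^ K := Nat.pow_lt_pow_right (by norm_num) (by omega)
    refine .seq (.setVar (by simp only [NatExp.eval, h2]; omega) ?_)
    refine .seq (.setNum (by simp only [NatExp.eval, space]; omega) ?_)
    refine .setVar (by simp [NatExp.eval, h4]; omega) ⟨n - 1, by omega, i + 1, by omega, ?_⟩
    refine ⟨by simpa using he, fun j hj => ?_, by simpa using h1, ?_, ?_, ?_⟩
    · simpa [NatExp.eval, hj] using hn j hj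
    · simp [NatExp.eval, h2, pow_succ, mul_two]
    · simp [NatExp.eval, NumExp.eval, h7]
    · simp [NatExp.eval, h4]
  · rintro n t ⟨i, hin, he, hn, h1, h2, h7, h4⟩ hb
    simp only [Cond.Holds, NatExp.eval, h1, h4] at hb
    have : i = K := by omega
    subst this
    exact hQ t he hn (h1.trans hK) (by rw [h2, hK]) (by rw [h7, hK])
  · refine ⟨0, by simp, ?_⟩
    simp [State.initial, NatExp.eval, hK]

lemma reached_nil {s : State 6 N} (he : ∀ i, s.elem i = none)
    (hn : ∀ i, i ≠ 7 → s.num i = 0) (h1 : s.var 1 = K) (h2 : s.var 2 = 2 ^ K)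
    (h7 : s.num 7 = K) : Reached M f al c m K [] (fun _ => 0) (fun _ => 0) s := by
  have h4 : s.num 4 = 0 := hn 4 (by decide)
  refine ⟨?_, ?_, h1, h2, h7⟩
  · constructor <;> simp [h4, level]
  · constructor
    · intro i _ _; exact hn _ (by omega)
    · intro i _ u hu; simp [he] at hu
    · intro i _ j _ u hu; simp [he] at hu
    · simp

lemma runs_marg {x : N → ℝ} (hσe : 1 + K ≤ σ.elems) (hσn : 9 ≤ σ.nums)
    (hσb : 2 ^ K < 2 ^ σ.bits) {s : State 6 N} (hK : s.var 1 = K) (hP : s.var 2 = 2 ^ K)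
    {u : N} (hu : s.elem 0 = some u) (h2 : s.num 2 = 0)
    (hx : ∀ i < K, ∀ u, s.elem (K + 1 + i) = some u → s.num (9 + K + i) = x u)
    {Q : State 6 N → Prop}
    (hQ : ∀ r, Frame K 2 s r →
      r.num 2 = marg (expand x (slotList (fun i => s.elem (K + 1 + i)) K) O.value) u ∅ → Q r) :
    Runs O σ (enumCmd margBody) s Q := by
  refine runs_enum (z := 2) le_rfl (by decide) (by decide) hσe (by omega) hσb hK hP
    (fun n v _ => v = ∑ mask ∈ Finset.range n, bitsProb (fun i => s.num (9 + K + i)) K mask *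
      (O.value (insert u (bitsSet (fun i => s.elem (K + 1 + i)) K mask)) -
        O.value (bitsSet (fun i => s.elem (K + 1 + i)) K mask))) (by simpa using h2) ?_ ?_
  · intro mask _ t hcur ht
    refine .setNum (by simp only [NatExp.eval]; omega) ⟨rfl, fun j hj => ?_, fun x _ => rfl, ?_⟩
    · simp [NatExp.eval, hj]
    · have h1 : t.var 1 = K := by rw [hcur.var 1 (by decide), hK]
      simp only [NatExp.eval, NumExp.eval, State.setNum_num, Function.update_self, h1,
        hcur.scratch, hcur.with_last u hu, hcur.prob, ht, Finset.sum_range_succ]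
  · intro r hr hv
    rw [sum_bits_marg x _ _ K hx] at hv
    exact hQ r hr hv

/-- Cell `3` ends as the maximum of its initial value and the minima of the subsets that span `u`.
It is characterised by the numbers `t` below it, which is the form needed to compare it with spans
at level `t`. -/
lemma runs_span (hσe : 1 + K ≤ σ.elems) (hσn : 9 ≤ σ.nums)
    (hσb : 2 ^ K < 2 ^ σ.bits) {s : State 6 N} (hK : s.var 1 = K) (hP : s.var 2 = 2 ^ K)
    {u : N} (hu : s.elem 0 = some u) {Q : State 6 N → Prop}
    (hQ : ∀ r, Frame K 3 s r → s.num 3 ≤ r.num 3 →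
      (r.num 3 = s.num 3 ∨ r.num 3 = s.num 5 ∨ ∃ i < K, r.num 3 = s.num (9 + i)) →
      (∀ t, s.num 3 < t → (t ≤ r.num 3 ↔ t ≤ s.num 5 ∧
        ∃ mask < 2 ^ K, O.indep (bitsSet (fun i => s.elem (K + 1 + i)) K mask) ∧
        ¬ O.indep (insert u (bitsSet (fun i => s.elem (K + 1 + i)) K mask)) ∧
        ∀ i < K, mask.testBit i → t ≤ s.num (9 + i))) → Q r) :
    Runs O σ (enumCmd spanBody) s Q := by
  refine runs_enum (z := 3) (by decide) (by decide) (by decide) hσe (by omega) hσb hK hP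
    (fun n v _ => s.num 3 ≤ v ∧
      (v = s.num 3 ∨ v = s.num 5 ∨ ∃ i < K, v = s.num (9 + i)) ∧
      ∀ t, s.num 3 < t → (t ≤ v ↔ t ≤ s.num 5 ∧
        ∃ mask < n, O.indep (bitsSet (fun i => s.elem (K + 1 + i)) K mask) ∧
        ¬ O.indep (insert u (bitsSet (fun i => s.elem (K + 1 + i)) K mask)) ∧
        ∀ i < K, mask.testBit i → t ≤ s.num (9 + i)))
    ⟨le_rfl, Or.inl rfl, fun t ht => ?_⟩ ?_ ?_
  · simp [ht]
  · intro mask _ t hcur ⟨hv0, hv1, hv2⟩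
    have h1 : t.var 1 = K := by rw [hcur.var 1 (by decide), hK]
    have hbody : ∀ y, y ≤ t.num 1 ↔ y ≤ s.num 5 ∧ ∀ i < K, mask.testBit i → y ≤ s.num (9 + i) :=
      fun y => by rw [hcur.min]; exact le_bitsMin
    refine .ite (fun hb => ?_) (fun hb => ?_)
    · simp only [Cond.Holds, NatExp.eval, NumExp.eval, h1, hcur.scratch, hcur.with_last u hu,
        not_le] at hb
      obtain ⟨hb1, hb2, hb3⟩ := hb
      refine .setNum (by simp only [NatExp.eval]; omega)
        ⟨rfl, fun j hj => by simp [NatExp.eval, hj], fun x _ => rfl, ?_⟩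
      simp only [NatExp.eval, NumExp.eval, State.setNum_num, Function.update_self]
      refine ⟨hv0.trans hb3.le, ?_, fun y hy => ?_⟩
      · rw [hcur.min]; exact Or.inr (bitsMin_eq _ _ _ _)
      · constructor
        · intro h
          obtain ⟨h5, h6⟩ := (hbody y).1 h
          exact ⟨h5, mask, by omega, hb1, hb2, h6⟩
        · rintro ⟨h5, mask', hm, h6, h7, h8⟩
          rcases Nat.lt_succ_iff_lt_or_eq.1 hm with hm | rfl
          · exact ((hv2 y hy).2 ⟨h5, mask', hm, h6, h7, h8⟩).trans hb3.le
          · exact (hbody y).2 ⟨h5, h8⟩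
    · simp only [Cond.Holds, NatExp.eval, NumExp.eval, h1, hcur.scratch, hcur.with_last u hu,
        not_le] at hb
      refine .skip ⟨rfl, fun _ _ => rfl, fun _ _ => rfl, hv0, hv1, fun y hy => ?_⟩
      rw [hv2 y hy]
      refine and_congr_right fun h5 => ⟨?_, ?_⟩
      · rintro ⟨mask', hm, h⟩; exact ⟨mask', by omega, h⟩
      · rintro ⟨mask', hm, h6, h7, h8⟩
        rcases Nat.lt_succ_iff_lt_or_eq.1 hm with hm | rfl
        · exact ⟨mask', hm, h6, h7, h8⟩
        · have h9 : t.num 1 ≤ t.num 3 := by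
            by_contra hlt
            exact hb ⟨h6, h7, not_le.1 hlt⟩
          exact ((hv2 y hy).1 (((hbody y).2 ⟨h5, h8⟩).trans h9)).2
  · rintro r hr ⟨h1, h2, h3⟩
    exact hQ r hr h1 h2 h3

lemma runs_store (hσe : 1 + 2 * K ≤ σ.elems) (hσn : 9 + 2 * K ≤ σ.nums)
    (hσb : K < 2 ^ σ.bits) {s : State 6 N} (hK : s.var 1 = K)
    (hfree : ∃ i < K, s.num (9 + i) ≤ s.num 8) {Q : State 6 N → Prop}
    (hQ : ∀ i < K, s.num (9 + i) ≤ s.num 8 → ∀ r : State 6 N,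
      (∀ j, r.elem (K + 1 + j) =
        Function.update (fun j => s.elem (K + 1 + j)) i (s.elem 0) j) →
      (∀ j < K, r.num (9 + j) = Function.update (fun j => s.num (9 + j)) i (s.num 5) j) →
      (∀ j, r.num (9 + K + j) = Function.update (fun j => s.num (9 + K + j)) i
        ((s.num 5 - s.num 3) / (al * s.num 5)) j) →
      r.num 4 = s.num 4 + (s.num 5 - s.num 3) → r.num 7 = s.num 7 →
      (∀ x, x ≠ 4 → r.var x = s.var x) → Q r) :
    Runs O σ (storeCmd al) s Q := by
  obtain ⟨i₁, hi₁, hi₁'⟩ := hfree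
  unfold storeCmd
  refine .seq (.setNum (by simp only [NatExp.eval]; omega) (.seq (.setVar ?_ (.seq ?_))))
  · simp [NatExp.eval]
  -- The search ends at the free slot `i₁` at the latest.
  refine Runs.while (fun n t => ∃ i, i + n = i₁ ∧ t = (s.setNum 4 (s.num 4 + (s.num 5 - s.num 3))
    ).setVar 4 i) ?_ ?_ (n := i₁) ⟨0, by simp, by simp [NatExp.eval, NumExp.eval]⟩
  · rintro n t ⟨i, hin, rfl⟩ hb
    have h9 : 9 + i ≠ 4 := by omega
    simp [Cond.Holds, NatExp.eval, NumExp.eval, h9] at hb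
    have hne : i ≠ i₁ := by rintro rfl; linarith
    refine .setVar (by simp [NatExp.eval]; omega) ⟨n - 1, by omega, i + 1, by omega, ?_⟩
    simp [NatExp.eval, State.setVar_setVar]
  · rintro n t ⟨i, hin, rfl⟩ hb
    have h9 : 9 + i ≠ 4 := by omega
    simp [Cond.Holds, NatExp.eval, NumExp.eval, h9] at hb
    have hi : i < K := by omega
    refine .seq (.copyElem (by simp [NatExp.eval, hK]; omega) ?_)
    refine .seq (.setNum (by simp [NatExp.eval]; omega) ?_)
    refine .setNum (by simp [NatExp.eval, hK]; omega) (hQ i hi hb _ ?_ ?_ ?_ ?_ ?_ ?_)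
    · intro j
      by_cases hj : j = i
      · subst hj; simp [NatExp.eval, hK]
      · have : K + 1 + j ≠ K + 1 + i := by omega
        simp [NatExp.eval, hK, hj]
    · intro j hjK
      have e1 : 9 + j ≠ 9 + K + i := by omega
      have e2 : 9 + j ≠ 4 := by omega
      by_cases hj : j = i
      · subst hj
        simp only [NatExp.eval, NumExp.eval, State.setNum_num, State.setElem_num,
          State.setElem_var, State.setNum_var, State.setVar_var, State.setVar_num,
          Function.update_self, Function.update_of_ne (show (1 : Fin 7) ≠ 4 by decide), hK,
          Function.update_of_ne e1]
        simp
      · simp [NatExp.eval, NumExp.eval, hK, e1, e2, hj]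
    · intro j
      have e1 : 9 + K + j ≠ 9 + i := by omega
      have e2 : 9 + K + j ≠ 4 := by omega
      have e3 : 5 ≠ 9 + i := by omega
      have e4 : 3 ≠ 9 + i := by omega
      by_cases hj : j = i
      · subst hj; simp [NatExp.eval, NumExp.eval, hK, e3, e4]
      · simp [NatExp.eval, NumExp.eval, hK, e1, e2, hj]
    · have e1 : 4 ≠ 9 + K + i := by omega
      have e2 : 4 ≠ 9 + i := by omega
      simp [NatExp.eval, hK, e1, e2]
    · have e1 : 7 ≠ 9 + K + i := by omega
      have e2 : 7 ≠ 9 + i := by omega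
      simp [NatExp.eval, hK, e1, e2]
    · intro x hx
      simp [hx]

end Algorithm

/-! ### The arrival of an element preserves the invariant. -/

section Arrival

variable {N : Type*} {K : ℕ}
variable {M : Matroid N} {f : Finset N → ℝ} {al c : ℚ} {m : ℕ} {H : List N} {g l : N → ℝ}

lemma Slots.congr {al θ : ℝ} {e e' : ℕ → Option N} {gs gs' as as' : ℕ → ℝ}
    (s : Slots al H g l θ K e gs as) (he : ∀ i < K, e' i = e i) (hg : ∀ i < K, gs' i = gs i)
    (ha : ∀ i < K, as' i = as i) : Slots al H g l θ K e' gs' as' where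
  empty i hi h := by rw [hg i hi]; exact s.empty i hi (he i hi ▸ h)
  full i hi u h := by rw [hg i hi, ha i hi]; exact s.full i hi u (he i hi ▸ h)
  inj i hi j hj u h h' := s.inj i hi j hj u (he i hi ▸ h) (he j hj ▸ h')
  stored u hu h h' := by
    obtain ⟨i, hi, hiu⟩ := s.stored u hu h h'
    exact ⟨i, hi, by rw [he i hi, hiu]⟩

variable [DecidableEq N]

/-- An element that is not used. -/
lemma Reached.skip {s t : State 6 N} (h : Reached M f al c m K H g l s) (hE : M.E = Set.univ)
    (hm : MonotoneSet f) (hs : Submodular f) (hal : (1 : ℝ) ≤ al) (hc : (0 : ℝ) ≤ c)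
    {u : N} (hu : u ∉ H)
    (helem : ∀ i, t.elem (K + 1 + i) = s.elem (K + 1 + i)) (hnum : ∀ i, t.num (9 + i) = s.num (9 + i))
    (h4 : t.num 4 = s.num 4) (h7 : t.num 7 = s.num 7) (hv1 : t.var 1 = s.var 1)
    (hv2 : t.var 2 = s.var 2) {a : ℝ} (ha0 : 0 ≤ a) (ha : a = 0 ∨ ∃ z : ℤ, a = (c : ℝ) ^ z)
    (hup : marg (expand (weight al g l) (slotList (fun i => s.elem (K + 1 + i)) K) f) u ∅ ≤ c * a)
    (hsp : ∀ y, 0 < y → c * (m / al * s.num 4 / K) ≤ y → y ≤ a →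
      u ∈ M.closure (slotsAbove (fun i => s.elem (K + 1 + i)) (fun i => s.num (9 + i)) K y)) :
    Reached M f al c m K (u :: H) (Function.update g u a) (Function.update l u a) t := by
  refine ⟨?_, ?_, by rw [hv1, h.size], by rw [hv2, h.pow_size], by rw [h7, h.real_size]⟩
  · have := h.history.arrive h.slots hE hm hs hal hu (a := a) (b := a) ha0 le_rfl ha
      (fun h => absurd h (lt_irrefl _)) (fun h => absurd h (lt_irrefl _)) le_rfl hc hup
      (fun h => absurd h (lt_irrefl _)) (fun h => absurd h (lt_irrefl _))
      (fun y h1 h2 => absurd h1 (not_lt.2 h2)) (fun y h1 h2 h3 _ => hsp y h1 h2 h3)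
    rw [sub_self, add_zero] at this
    rwa [h4]
  · rw [h4]
    refine (h.slots.skip hu a).congr (fun i _ => helem i) (fun i _ => hnum i) fun i _ => ?_
    have := hnum (K + i)
    rwa [← add_assoc] at this

lemma bitsSet_zero (e : ℕ → Option N) (K : ℕ) : bitsSet e K 0 = ∅ := by
  ext u; rw [mem_bitsSet]; simp

/-- An element is left unused, with `l u = g u`, if its marginal is not positive, if it is below `c
* θ`, or if it is spanned at all levels up to `g u`; otherwise it goes to a free slot. -/
lemma runs_arrive (hE : M.E = Set.univ) {k : ℕ} (hk : M.eRank = k)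
    (hm : MonotoneSet f) (hs : Submodular f) (hm0 : 0 < m) (hal : (1 : ℝ) ≤ al)
    (hc : (1 : ℝ) < c) (hcm : (c : ℝ) * (m - al) = m) (hK : K = m ^ 2 * k)
    {s : State 6 N} (h : Reached M f al c m K H g l s) {u : N} (hu : u ∉ H) :
    Runs ⟨f, fun S => M.Indep (S : Set N)⟩ (space m k) (arriveCmd al c m) (s.setElem 0 (some u))
      fun t => ∃ g l, Reached M f al c m K (u :: H) g l t := by
  have hc0 : (0 : ℝ) < c := by linarith
  have hal0 : (0 : ℝ) < al := by linarith
  have hmpos : (0 : ℝ) < m := by exact_mod_cast hm0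
  have hσe : (space m k).elems = 1 + 2 * K := by rw [hK]; rfl
  have hσn : (space m k).nums = 9 + 2 * K := by rw [hK]; rfl
  have hσb : 2 ^ K < 2 ^ (space m k).bits := by
    have : (space m k).bits = K + k + 1 := by rw [hK]; rfl
    rw [this]; exact Nat.pow_lt_pow_right (by norm_num) (by omega)
  have hG := h.history.total_nonneg
  obtain ⟨θ, hθ⟩ : ∃ θ, θ = m / al * s.num 4 / K := ⟨_, rfl⟩
  have hθ0 : 0 ≤ θ := by rw [hθ]; positivity
  obtain ⟨v, hv⟩ : ∃ v, v = marg (expand (weight al g l)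
    (slotList (fun i => s.elem (K + 1 + i)) K) f) u ∅ := ⟨_, rfl⟩
  have helem1 : ∀ i, ((s.setElem 0 (some u)).setNum 2 0).elem (K + 1 + i) = s.elem (K + 1 + i) :=
    fun i => by
      simp
  have hnum1 : ∀ i, i ≠ 2 → ((s.setElem 0 (some u)).setNum 2 0).num i = s.num i :=
    fun i hi => by simp [hi]
  unfold arriveCmd
  refine .seq (.setNum (by simp only [NatExp.eval]; omega) (.seq ?_))
  simp only [NatExp.eval, NumExp.eval, Rat.cast_zero]
  refine runs_marg (u := u) (x := weight al g l) (by omega) (by omega) hσb (K := K)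
    (by simpa using h.size) (by simpa using h.pow_size) (by simp) (by simp) ?_ ?_
  · intro i hi w hw
    rw [helem1] at hw
    rw [hnum1 _ (by omega)]
    exact (h.slots.full i hi w hw).2.2.1
  intro r hr hr2
  simp only [helem1] at hr2
  rw [← hv] at hr2
  have rel : ∀ i, r.elem (K + 1 + i) = s.elem (K + 1 + i) := fun i => by
    rw [hr.elem _ (by omega), helem1]
  have rel0 : r.elem 0 = some u := by rw [hr.elem _ (by omega)]; simp
  have rnum : ∀ i, 3 ≤ i → r.num i = s.num i := fun i hi => by
    rw [hr.num _ (by omega) (by omega), hnum1 _ (by omega)]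
  have rvar : ∀ x : Fin 7, x.val < 3 → r.var x = s.var x := fun x hx => by
    rw [hr.var x hx]; rfl
  refine .ite (fun hb => ?_) (fun hb => ?_)
  · simp [Cond.Holds, NatExp.eval, NumExp.eval, hr2] at hb
    exact .skip ⟨_, _, h.skip hE hm hs hal hc0.le hu rel (fun i => rnum _ (by omega))
      (rnum 4 (by decide)) (rnum 7 (by decide)) (rvar 1 (by decide)) (rvar 2 (by decide)) le_rfl
      (Or.inl rfl) (by rw [← hv, mul_zero]; exact hb)
      (fun y h1 _ h2 => absurd h1 (not_lt.2 h2))⟩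
  simp [Cond.Holds, NatExp.eval, NumExp.eval, hr2] at hb
  refine .seq (runs_round hc (by omega) (by rw [hr2]; exact hb) fun z hz1 hz2 => ?_)
  rw [hr2] at hz1 hz2
  obtain ⟨a, ha⟩ : ∃ a, a = (c : ℝ) ^ z := ⟨_, rfl⟩
  rw [← ha] at hz1 hz2 ⊢
  have ha0 : 0 < a := by rw [ha]; positivity
  refine .seq (.setNum (by simp only [NatExp.eval]; omega) ?_)
  have hth : NumExp.eval ⟨f, fun S => M.Indep (S : Set N)⟩ (r.setNum 5 a)
      (.div (.mul (.lit (m / al)) (.cell (.lit 4))) (.cell (.lit 7)) : NumExp 6) = θ := by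
    simp [NumExp.eval, NatExp.eval, rnum, h.real_size, hθ]
  rw [hth]
  simp only [NatExp.eval]
  set r' : State 6 N := (r.setNum 5 a).setNum 8 θ with hr'
  have rel' : ∀ i, r'.elem (K + 1 + i) = s.elem (K + 1 + i) := rel
  have rnum' : ∀ i, 3 ≤ i → i ≠ 5 → i ≠ 8 → r'.num i = s.num i := fun i h1 h2 h3 => by
    rw [hr', State.setNum_num, State.setNum_num, Function.update_of_ne h3,
      Function.update_of_ne h2, rnum i h1]
  have rvar' : ∀ x : Fin 7, x.val < 3 → r'.var x = s.var x := rvar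
  have rel0' : r'.elem 0 = some u := rel0
  have r'5 : r'.num 5 = a := by simp [hr']
  have r'8 : r'.num 8 = θ := by simp [hr']
  clear_value r'
  clear hr' hth
  refine .ite (fun hb2 => ?_) (fun hb2 => ?_)
  swap
  -- Here `a < c * θ`, so no level subject to the spanning condition is concerned.
  · simp [Cond.Holds, NatExp.eval, NumExp.eval, r'5, r'8] at hb2
    refine .skip ⟨_, _, h.skip hE hm hs hal hc0.le hu rel' (fun i => rnum' _ (by omega) (by omega)
      (by omega)) (rnum' 4 (by decide) (by decide) (by decide))
      (rnum' 7 (by decide) (by decide) (by decide)) (rvar' 1 (by decide)) (rvar' 2 (by decide))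
      ha0.le (Or.inr ⟨z, ha⟩) (by rw [← hv]; exact hz2.le) (fun y _ h1 h2 => ?_)⟩
    rw [← hθ] at h1
    linarith
  simp [Cond.Holds, NatExp.eval, NumExp.eval, r'5, r'8] at hb2
  refine .seq (.setNum (by simp only [NatExp.eval]; omega) (.seq ?_))
  simp only [NatExp.eval, NumExp.eval, r'8]
  set p : State 6 N := r'.setNum 3 θ with hp
  have pel : ∀ i, p.elem (K + 1 + i) = s.elem (K + 1 + i) := rel'
  have pnum : ∀ i, 4 ≤ i → p.num i = r'.num i := fun i h1 => by
    rw [hp, State.setNum_num, Function.update_of_ne (by omega)]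
  have p3 : p.num 3 = θ := by simp [hp]
  have pgs : ∀ i, p.num (9 + i) = s.num (9 + i) := fun i => by
    rw [pnum _ (by omega), rnum' _ (by omega) (by omega) (by omega)]
  have pel0 : p.elem 0 = some u := rel0'
  have pvar : ∀ x : Fin 7, x.val < 3 → p.var x = s.var x := rvar'
  refine runs_span (K := K) (u := u) (s := p) (by omega) (by omega) hσb
    ((pvar 1 (by decide)).trans h.size) ((pvar 2 (by decide)).trans h.pow_size) pel0 ?_
  simp only [pel, pgs, p3, pnum 5 (by decide), r'5]
  intro q hq hq3 hqb hspan
  obtain ⟨b, hb'⟩ : ∃ b, b = q.num 3 := ⟨_, rfl⟩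
  rw [← hb'] at hq3 hqb hspan
  have hspan' : ∀ t, θ < t → t ≤ a → (t ≤ b ↔
      u ∈ M.closure (slotsAbove (fun i => s.elem (K + 1 + i)) (fun i => s.num (9 + i)) K t)) := by
    intro t h1 h2
    rw [hspan t h1, mem_closure_slotsAbove_iff hE h.slots hu]
    exact ⟨fun h => h.2, fun h => ⟨h2, h⟩⟩
  have hθlt : ∀ t, 0 < t → c * θ ≤ t → θ < t := fun t h1 h2 => by
    rcases hθ0.eq_or_lt with h0 | h0
    · rwa [← h0]
    · nlinarith
  have qel : ∀ i, q.elem (K + 1 + i) = s.elem (K + 1 + i) := fun i => by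
    rw [hq.elem _ (by omega), pel]
  have qel0 : q.elem 0 = some u := by rw [hq.elem _ (by omega), pel0]
  have qnum : ∀ i, 4 ≤ i → q.num i = r'.num i := fun i hi => by
    rw [hq.num _ (by omega) (by omega), pnum i hi]
  have qvar : ∀ x : Fin 7, x.val < 3 → q.var x = s.var x := fun x hx => by
    rw [hq.var x hx]; exact pvar x hx
  have qgs : ∀ i, q.num (9 + i) = s.num (9 + i) := fun i => by
    rw [qnum _ (by omega), rnum' _ (by omega) (by omega) (by omega)]
  have q4 : q.num 4 = s.num 4 := by
    rw [qnum _ (by omega), rnum' _ (by omega) (by omega) (by omega)]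
  have q5 : q.num 5 = a := by rw [qnum _ (by omega), r'5]
  have q7 : q.num 7 = s.num 7 := by
    rw [qnum _ (by omega), rnum' _ (by omega) (by omega) (by omega)]
  have q8 : q.num 8 = θ := by rw [qnum _ (by omega), r'8]
  refine .ite (fun hab => ?_) (fun hab => ?_)
  · simp [Cond.Holds, NatExp.eval, NumExp.eval, q5, ← hb'] at hab
    refine .skip ⟨_, _, h.skip hE hm hs hal hc0.le hu qel qgs q4 q7 (qvar 1 (by decide))
      (qvar 2 (by decide)) ha0.le (Or.inr ⟨z, ha⟩) (by rw [← hv]; exact hz2.le)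
      (fun y h0 h1 h2 => ?_)⟩
    rw [← hθ] at h1
    exact (hspan' y (hθlt y h0 h1) h2).1 (h2.trans hab)
  simp [Cond.Holds, NatExp.eval, NumExp.eval, q5, ← hb'] at hab
  -- If `K = 0`, the rank is `0` and `u` is a loop; the empty mask, whose minimum is `a`, then
  -- forces `b ≥ a`.
  have hK0 : 0 < K := by
    by_contra hK0
    have hk0 : k = 0 := by
      have h1 : m ^ 2 * k = 0 := by omega
      rcases Nat.mul_eq_zero.1 h1 with h2 | h2
      · have := pow_pos hm0 2; omega
      · exact h2
    refine absurd ((hspan a (hq3.trans_lt hab)).2 ⟨le_rfl, 0, by positivity, ?_, ?_, ?_⟩)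
      (not_le.2 hab)
    · simp [bitsSet_zero]
    · intro hind
      have := card_le_rank hk hind
      simp [bitsSet_zero, hk0] at this
    · simp
  have hfree := h.history.exists_free_slot h.slots hm0 hal hc hcm hK0 rfl
  simp only [← hθ] at hfree
  refine runs_store (K := K) (by omega) (by omega) (Nat.lt_two_pow_self.trans hσb)
    ((qvar 1 (by decide)).trans h.size) (by simpa only [qgs, q8] using hfree) ?_
  intro i hi hgi t tel tgs tas t4 t7 tvar
  simp only [qel, qgs, q5, q8, qel0, ← hb', q4, q7] at hgi tel tgs tas t4 t7
  have qas : ∀ i, q.num (9 + K + i) = s.num (9 + K + i) := fun i => by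
    rw [qnum _ (by omega), rnum' _ (by omega) (by omega) (by omega)]
  simp only [qas] at tas
  have hθ' : m / al * s.num 4 / K ≤ m / al * (s.num 4 + (a - b)) / K := by
    have : s.num 4 ≤ s.num 4 + (a - b) := by linarith
    gcongr
  -- The value `0` comes from an empty slot in the mask. In each case `c * b ≤ a`: for `b = θ` by
  -- the test made before, for powers of `c` because `b < a`.
  have hbcases : b = θ ∨ b = 0 ∨ ∃ w : ℤ, b = (c : ℝ) ^ w := by
    rcases hqb with h1 | h1 | ⟨j, hj, h1⟩
    · exact Or.inl h1
    · exact absurd h1 hab.ne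
    · right
      cases hej : s.elem (K + 1 + j) with
      | none => left; rw [h1]; exact h.slots.empty j hj hej
      | some w =>
        obtain ⟨h2, h3, -⟩ := h.slots.full j hj w hej
        rw [h1, h3]
        exact h.history.g_pow w h2
  have hist := h.history.arrive h.slots hE hm hs hal hu (a := a) (b := b) (hθ0.trans hq3) hab.le
    (Or.inr ⟨z, ha⟩)
    (fun _ => by
      rcases hbcases with h1 | h1 | h1
      · left; exact (h1.trans hθ).le.trans hθ'
      · left; exact h1.le.trans ((hθ ▸ hθ0).trans hθ')
      · exact Or.inr h1)
    (fun _ => by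
      rcases hbcases with h1 | h1 | ⟨w, h1⟩
      · rw [h1]; exact hb2
      · rw [h1, mul_zero]; exact ha0.le
      · rw [h1, ha] at hab
        have h2 := (zpow_lt_zpow_iff_right₀ hc).1 hab
        rw [h1, ha, mul_comm, ← zpow_add_one₀ hc0.ne']
        exact (zpow_le_zpow_iff_right₀ hc).2 (by omega))
    hθ' hc0.le (by rw [← hv]; exact hz2.le) (fun _ => by rw [← hv]; exact hz1)
    (fun _ => by rw [← hθ]; exact hq3)
    (fun y h1 h2 h3 => absurd ((hspan' y (hq3.trans_lt h1) h2).2 h3) (not_le.2 h1))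
    (fun y h0 h1 h2 h3 => by
      refine (hspan' y (hθlt y h0 (le_trans ?_ h1)) h2).1 h3
      rw [hθ]
      gcongr)
  refine ⟨_, _, ⟨by rw [t4]; exact hist, ?_, ?_, ?_, by rw [t7, h.real_size]⟩⟩
  · rw [t4]
    exact (h.slots.insert hu hab hθ' hi (hθ ▸ hgi)).congr (fun j _ => tel j) tgs (fun j _ => tas j)
  · rw [tvar 1 (by decide)]; exact (qvar 1 (by decide)).trans h.size
  · rw [tvar 2 (by decide)]; exact (qvar 2 (by decide)).trans h.pow_size

end Arrival

universe v

/-! ### The whole run, its output and its memory. -/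

section Correctness

variable {N : Type*} [DecidableEq N] {K : ℕ}
variable {M : Matroid N} {f : Finset N → ℝ} {al c : ℚ} {m : ℕ}

lemma pass_reached (hE : M.E = Set.univ) {k : ℕ} (hk : M.eRank = k)
    (hm : MonotoneSet f) (hs : Submodular f) (hm0 : 0 < m) (hal : (1 : ℝ) ≤ al)
    (hc : (1 : ℝ) < c) (hcm : (c : ℝ) * (m - al) = m) (hK : K = m ^ 2 * k) (stream : List N)
    (hn : stream.Nodup) {H : List N} (hdisj : ∀ u ∈ stream, u ∉ H) {g l : N → ℝ} {s : State 6 N}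
    (h : Reached M f al c m K H g l s) :
    ∃ t g l, Pass ⟨f, fun S => M.Indep (S : Set N)⟩ (space m k) (arriveCmd al c m) stream s t ∧
      Reached M f al c m K (stream.reverse ++ H) g l t := by
  induction stream generalizing H g l s with
  | nil => exact ⟨s, g, l, .nil s, by simpa using h⟩
  | cons u us ih =>
    rw [List.nodup_cons] at hn
    obtain ⟨t, ht, g', l', h'⟩ :=
      runs_arrive hE hk hm hs hm0 hal hc hcm hK h (hdisj u (by simp))
    obtain ⟨r, g'', l'', hr, h''⟩ := ih hn.2 (H := u :: H) (fun w hw hw' => by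
      rcases List.mem_cons.1 hw' with rfl | hw'
      · exact hn.1 hw
      · exact hdisj w (by simp [hw]) hw') h'
    refine ⟨r, g'', l'', .cons (by simp [space]) ht hr, ?_⟩
    simpa using h''

/-- The search starts from the empty set, mask `0`. At the end the best subset is loaded again, and
cell `0` is erased so that the output cells `0, …, K` hold exactly this subset. -/
lemma runs_finish {O : Oracles N} {σ : Space} (hσe : 1 + K ≤ σ.elems) (hσn : 9 ≤ σ.nums)
    (hσb : 2 ^ K < 2 ^ σ.bits) (hKb : K + 1 < 2 ^ σ.bits) {s : State 6 N} (hK : s.var 1 = K)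
    (hP : s.var 2 = 2 ^ K) (hempty : O.indep ∅) {Q : State 6 N → Prop}
    (hQ : ∀ t : State 6 N, ∀ mask < 2 ^ K,
      t.cells 0 (t.var 0) = bitsSet (fun i => s.elem (K + 1 + i)) K mask →
      O.indep (bitsSet (fun i => s.elem (K + 1 + i)) K mask) →
      (∀ mask' < 2 ^ K, O.indep (bitsSet (fun i => s.elem (K + 1 + i)) K mask') →
        O.value (bitsSet (fun i => s.elem (K + 1 + i)) K mask') ≤
          O.value (bitsSet (fun i => s.elem (K + 1 + i)) K mask)) → Q t) :
    Runs O σ finishCmd s Q := by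
  obtain ⟨S, hS⟩ : ∃ S, S = fun mask => bitsSet (fun i => s.elem (K + 1 + i)) K mask := ⟨_, rfl⟩
  have hS' : ∀ mask, bitsSet (fun i => s.elem (K + 1 + i)) K mask = S mask := fun mask => by rw [hS]
  simp only [hS'] at hQ
  have hS0 : S 0 = ∅ := by rw [hS]; exact bitsSet_zero _ _
  have hcell0 : s.cells 0 0 = ∅ := by simp [State.cells]
  unfold finishCmd
  refine .seq (.setVar (by simp [NatExp.eval]) (.seq (.setNum (by simp only [NatExp.eval]; omega)
    (.seq ?_))))
  refine runs_enum (K := K) (z := 6) (by decide) (by decide) (by decide) hσe (by omega) hσb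
    (by simpa using hK) (by simpa using hP)
    (fun n v b => b < 2 ^ K ∧ O.indep (S b) ∧ v = O.value (S b) ∧
      ∀ mask < n, O.indep (S mask) → O.value (S mask) ≤ v) ?_ ?_ ?_
  · refine ⟨by simp [NatExp.eval], ?_, ?_, by simp⟩
    · simpa [NatExp.eval, hS0] using hempty
    · simp only [NatExp.eval, NumExp.eval, State.setNum_num, Function.update_self,
        State.setNum_var, State.setVar_var, hS0]
      rw [← hcell0]; rfl
  · intro mask hmask t hcur ⟨hb1, hb2, hb3, hb4⟩
    have h1 : t.var 1 = K := by rw [hcur.var 1 (by decide)]; simpa using hK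
    have hcells : t.cells 1 (K + 1) = S mask := by rw [hcur.scratch, ← hS']; rfl
    refine .ite (fun hb => ?_) (fun hb => ?_)
    · simp only [Cond.Holds, NatExp.eval, NumExp.eval, h1, hcells, not_le] at hb
      refine .seq (.setNum (by simp only [NatExp.eval]; omega) (.setVar ?_ ?_))
      · simp only [NatExp.eval, State.setNum_var, hcur.mask_eq]; omega
      refine ⟨rfl, ?_, ?_, ?_⟩
      · intro j hj; simp [NatExp.eval, hj]
      · intro x hx; simp [hx]
      · simp only [NatExp.eval, NumExp.eval, State.setNum_num, State.setNum_var, State.setVar_num,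
          State.setVar_var, Function.update_self, h1, hcells, hcur.mask_eq]
        refine ⟨hmask, hb.1, trivial, fun mask' hm hi => ?_⟩
        rcases Nat.lt_succ_iff_lt_or_eq.1 hm with hm | rfl
        · exact (hb4 mask' hm hi).trans hb.2.le
        · exact le_rfl
    · simp only [Cond.Holds, NatExp.eval, NumExp.eval, h1, hcells, not_le] at hb
      refine .skip ⟨rfl, fun _ _ => rfl, fun _ _ => rfl, hb1, hb2, hb3, fun mask' hm hi => ?_⟩
      rcases Nat.lt_succ_iff_lt_or_eq.1 hm with hm | rfl
      · exact hb4 mask' hm hi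
      · by_contra hlt
        exact hb ⟨hi, not_le.1 hlt⟩
  · intro r hr ⟨hb1, hb2, hb3, hb4⟩
    have r1 : r.var 1 = K := by rw [hr.var 1 (by decide)]; simpa using hK
    refine .seq (.setVar (by simp only [NatExp.eval]; omega) (.seq ?_))
    refine runs_load (K := K) hσe (by omega) (by omega) (by simpa using r1)
      (by simp only [NatExp.eval, State.setVar_var, Function.update_self]; omega) fun t ht => ?_
    refine .seq (.eraseElem (by simp only [NatExp.eval]; omega) (.setVar ?_ ?_))
    · have : t.var 1 = K := by rw [ht.var 1 (by decide) (by decide)]; simpa using r1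
      simpa [NatExp.eval, this] using hKb
    · have t1 : t.var 1 = K := by rw [ht.var 1 (by decide) (by decide)]; simpa using r1
      have hcells := ht.cells
      simp only [NatExp.eval, State.setVar_var, Function.update_self, State.setVar_elem] at hcells
      have hslot : (fun i => r.elem (K + 1 + i)) = fun i => s.elem (K + 1 + i) := by
        funext i; rw [hr.elem _ (by omega)]; rfl
      rw [hslot, hS'] at hcells
      refine hQ _ (r.var 6) hb1 ?_ hb2 fun mask' hm hi => hb3 ▸ hb4 mask' hm hi
      rw [← hcells]
      ext u
      simp only [State.mem_cells, NatExp.eval, State.setVar_var, State.setElem_var,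
        Function.update_self, State.setVar_elem, State.setElem_elem, t1]
      constructor
      · rintro ⟨j, -, h2, h3⟩
        have hj : j ≠ 0 := by rintro rfl; simp at h3
        rw [Function.update_of_ne hj] at h3
        exact ⟨j, by omega, h2, h3⟩
      · rintro ⟨j, h1, h2, h3⟩
        exact ⟨j, by omega, h2, by rw [Function.update_of_ne (by omega)]; exact h3⟩

end Correctness

lemma SemiStreamingRatio.mono {ρ ρ' : ℝ} (h : SemiStreamingRatio.{v} ρ) (hρ : ρ' ≤ ρ) :
    SemiStreamingRatio.{v} ρ' := by
  obtain ⟨A, σ, C, d, h1, h2, h3⟩ := h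
  refine ⟨A, σ, C, d, h1, h2, fun N _ M f k stream a1 a2 a3 a4 a5 a6 a7 => ?_⟩
  obtain ⟨R, hR, hI, hS⟩ := h3 N M f k stream a1 a2 a3 a4 a5 a6 a7
  exact ⟨R, hR, hI, fun S hSi => (mul_le_mul_of_nonneg_right hρ (a5 S)).trans (hS S hSi)⟩

lemma semiStreamingRatio_of_parameters {al : ℚ} {m : ℕ} {ρ : ℝ} (hal : (1 : ℝ) ≤ al)
    (halm : (al : ℝ) < m) (hρ0 : 0 ≤ ρ) (hρ1 : ρ ≤ 1)
    (hρ : ∀ c : ℝ, c = m / (m - al) →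
      ρ * (c / al + c + c ^ 2 / (al * m)) ≤ (1 - (c ^ m)⁻¹) / al * (1 - c / (al * m))) :
    SemiStreamingRatio.{v} ρ := by
  have hal0 : (0 : ℝ) < al := by linarith
  have hmpos : (0 : ℝ) < m := by linarith
  have hm0 : 0 < m := by exact_mod_cast hmpos
  obtain ⟨c, hcdef⟩ : ∃ c : ℚ, c = m / (m - al) := ⟨_, rfl⟩
  have hcR : (c : ℝ) = m / (m - al) := by rw [hcdef]; push_cast; rfl
  have hsub : (0 : ℝ) < m - al := by linarith
  have hc1 : (1 : ℝ) < c := by rw [hcR, one_lt_div hsub]; linarith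
  have hcm : (c : ℝ) * (m - al) = m := by rw [hcR]; field_simp
  -- Seven variables of `m² k + k + 1` bits and `9 + 2 m² k` number cells: the additional memory is
  -- `O(k)`, without a logarithmic factor.
  refine ⟨algorithm al c m, space m, 9 + 9 * m ^ 2 + 14, 0, fun k => ?_, fun k => ?_, ?_⟩
  · simp only [space]
    have h1 : 1 ≤ max k 1 := le_max_right _ _
    have h2 : k ≤ max k 1 := le_max_left _ _
    nlinarith [Nat.zero_le (m ^ 2), Nat.mul_le_mul_left (m ^ 2) h2]
  · simp only [Algorithm.additionalMemory, space, algorithm, pow_zero, mul_one]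
    have h1 : 1 ≤ max k 1 := le_max_right _ _
    have h2 : k ≤ max k 1 := le_max_left _ _
    nlinarith [Nat.zero_le (m ^ 2), Nat.mul_le_mul_left (m ^ 2) h2]
  · intro N _ M f k stream hE hk hnodup hall h0 hmono hsub
    obtain ⟨K, hK⟩ : ∃ K, K = m ^ 2 * k := ⟨_, rfl⟩
    have hbits : (space m k).bits = K + k + 1 := by rw [hK]; rfl
    have hKlt : K < 2 ^ K := Nat.lt_two_pow_self
    have hb1 : 2 * 2 ^ K ≤ 2 ^ (space m k).bits := by
      rw [hbits, ← pow_succ']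
      exact Nat.pow_le_pow_right (by norm_num) (by omega)
    obtain ⟨s₁, hs₁, e1, e2, e3, e4, e5⟩ :=
      runs_init (N := N) (m := m) (k := k) ⟨f, fun S => M.Indep (S : Set N)⟩
        (fun s h1 h2 h3 h4 h5 => (⟨h1, h2, h3, h4, h5⟩ : (∀ i, s.elem i = none) ∧
          (∀ i, i ≠ 7 → s.num i = 0) ∧ s.var 1 = m ^ 2 * k ∧ s.var 2 = 2 ^ (m ^ 2 * k) ∧
          s.num 7 = (m ^ 2 * k : ℕ)))
    rw [← hK] at e3 e4 e5
    have hstart : Reached M f al c m K [] (fun _ => 0) (fun _ => 0) s₁ :=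
      reached_nil e1 e2 e3 e4 e5
    obtain ⟨s₂, g, l, hpass, hreach⟩ := pass_reached hE hk hmono hsub hm0 hal hc1 hcm hK stream
      hnodup (by simp) hstart
    rw [List.append_nil] at hreach
    have hθ : (m / al * s₂.num 4 / K : ℝ) = s₂.num 4 / (al * m * k) := by
      rw [hK]
      push_cast
      field_simp
    obtain ⟨B, hB, hBmem, hBval⟩ := hreach.history.exists_approx hE hal hc1 hm0 hcm hk hθ h0 hmono
      hsub (fun u => by simpa using hall u) hρ0 hρ1 (hρ c hcR)
    obtain ⟨t, ht, mask, -, hcells, hind, hbest⟩ :=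
      runs_finish (O := ⟨f, fun S => M.Indep (S : Set N)⟩) (σ := space m k) (K := K)
        (Q := fun t => ∃ mask < 2 ^ K,
          t.cells 0 (t.var 0) = bitsSet (fun i => s₂.elem (K + 1 + i)) K mask ∧
          M.Indep (bitsSet (fun i => s₂.elem (K + 1 + i)) K mask : Set N) ∧
          ∀ mask' < 2 ^ K, M.Indep (bitsSet (fun i => s₂.elem (K + 1 + i)) K mask' : Set N) →
            f (bitsSet (fun i => s₂.elem (K + 1 + i)) K mask') ≤
              f (bitsSet (fun i => s₂.elem (K + 1 + i)) K mask))
        (by simp only [space]; omega) (by simp only [space]; omega) (by omega) (by omega)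
        hreach.size hreach.pow_size (by simp)
        (fun t mask h1 h2 h3 h4 => ⟨mask, h1, h2, h3, h4⟩)
    refine ⟨t.cells 0 (t.var 0), ⟨?_, s₁, s₂, t, hs₁, hpass, ht, rfl⟩, by rw [hcells]; exact hind,
      fun S hS => ?_⟩
    · rw [hbits]
      exact Nat.lt_two_pow_self.trans_le (Nat.pow_le_pow_right (by norm_num) (by omega))
    -- The good set `B` consists of used elements above the final threshold. These are all still
    -- stored, so `B` is among the enumerated subsets.
    · obtain ⟨mask', hm', hset, -⟩ := exists_mask (fun i => s₂.elem (K + 1 + i)) K B fun u hu =>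
        hreach.slots.stored u (by simpa using hall u) (hBmem u hu).1 (hBmem u hu).2
      have h1 := hbest mask' hm' (by rw [hset]; exact hB)
      rw [hset] at h1
      rw [hcells]
      exact (hBval S hS).trans h1

lemma semiStreamingRatio_of_lt {α ρ : ℝ} (hα : 1 < α) (he : Real.exp α = α + 2)
    (hρ : ρ < 1 / (α + 2)) : SemiStreamingRatio.{v} ρ := by
  have hpos : 0 < 1 / (α + 2) := by positivity
  -- For large `ε` the ratio is negative, while the analysis needs a nonnegative one.
  have hlt : max ρ 0 < 1 / (α + 2) := max_lt hρ hpos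
  obtain ⟨al, m, h1, h2, h3⟩ := exists_parameters hα he hlt
  refine (semiStreamingRatio_of_parameters h1 h2 (le_max_right _ _) ?_ h3).mono (le_max_left _ _)
  refine hlt.le.trans ?_
  rw [div_le_one (by linarith)]
  linarith

end DataStream

theorem theorem1 :
    DataStream.SemiStreamingRatio.{u} 0.3178 ∧
    ∃ α : ℝ, 0 < α ∧ (∀ β : ℝ, 0 < β → (Real.exp β = β + 2 ↔ β = α)) ∧
      ∀ ε : ℝ, 0 < ε → DataStream.SemiStreamingRatio.{u} (1 / (α + 2) - ε) := by
  obtain ⟨α, h1, h2, he⟩ := DataStream.exists_root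
  refine ⟨DataStream.semiStreamingRatio_of_lt h1 he ?_, α, by linarith, fun β hβ => ⟨fun h => ?_, ?_⟩,
    fun ε hε => DataStream.semiStreamingRatio_of_lt h1 he (by linarith)⟩
  -- `0.3178 * 3.1466 < 1`.
  · rw [lt_div_iff₀ (by linarith)]
    norm_num at h2 ⊢
    linarith
  · exact DataStream.root_unique (by linarith) hβ he h
  · rintro rfl
    exact he
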